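/- Let $G$ be a simply connected complex semisimple (e.g. simple) algebraic group of arbitrary Cartan–Killing type, with index set $I$ of simple roots, Cartan matrix $a_{ij}=\langle\alpha_i^\vee,\alpha_j\rangle$, torus $H$, Borel subgroup $B_+=HU_+$ and pinning $x_i,y_i$. Let $\chi_i:\mathbb C^\times\to H$ be the simple coroots, $\dot s_i$ the image of $\begin{pmatrix}0&-1\\1&0\end{pmatrix}$ under the $SL_2$ of $i\in I$, $B_i(z)=x_i(z)\dot s_i$, and $\dot w=\dot s_{j_1}\cdots\dot s_{j_\ell}$ for a reduced expression of $w\in W$; let $w_\circ$ be the longest element, $s_{i^*}=w_\circ s_iw_\circ$, and let $*$ be the Demazure product. For weighted flags $F,F'\in G/U_+$ write $F\xrightarrow{w}F'$ if $F^{-1}F'\in U_+\dot wU_+$ and $F\overset{w}{\Rightarrow}F'$ if $F^{-1}F'\in B_+\dot wB_+$. Let $\beta=(i_1,\dots,i_N)\in(\pm I)^N$ be a double braid word. Put $w_N=e$, and $w_{c-1}=w_c*s_i$ if $i_c=i>0$, $w_{c-1}=s_{i^*}*w_c$ if $i_c=-i<0$. The double braid variety $R(\beta)$ is the set of pairs $(X_\bullet,Y_\bullet)\in((G/U_+)^{[0,N]})^2$,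 modulo the diagonal action of $G$, with $X_N=Y_N$, $Y_0\overset{w_\circ}{\Rightarrow}X_0$, and for $1\le c\le N$: $X_c\xrightarrow{s_i}X_{c-1}$, $Y_{c-1}=Y_c$ if $i_c=i>0$, and $Y_{c-1}\xrightarrow{s_{i^*}}Y_c$, $X_{c-1}=X_c$ if $i_c=-i<0$. The Deodhar torus $T_\beta\subseteq R(\beta)$ is given by $Y_c\overset{w_c}{\Rightarrow}X_c$ for all $c\in[0,N]$. Let $z_1,\dots,z_N$ be coordinates of $(X_\bullet,Y_\bullet)$: starting from a representative of $Y_0$ (taken to be $1$ by acting with $G$), the flags $Y_0,\dots,Y_N=X_N,\dots,X_0$ are obtained by right multiplication by $B_{i^*}(z_c)$ at a step $Y_{c-1}\to Y_c$ and by $B_i(z_c)$ at a step $X_c\to X_{c-1}$. A double inductive weave of $\beta$ is built from top to bottom, its horizontal slices being reduced words. From depth $c$ to depth $c+1$ one reads the letter $i_{N-c}$ and adds a strand, of colour $i$ on the right of the slice if $i_{N-c}=i>0$, of colour $i^*$ on its left if $i_{N-c}=-i<0$; if the extended word is reduced, the strand is kept; otherwise the slice is brought by braid moves ($2m_{ij}$-valent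 vertices, $m_{ij}\in\{2,3,4,6\}$) into a form where the adjacent strand has the same colour, and these two strands merge in a trivalent vertex $\mathsf v_c$. Its edges $\mathsf e$ of colour $i$ are labelled by $g_{\mathsf e}=B_i(f_{\mathsf e})\chi_i(u_{\mathsf e})$ as follows. Top edges have label $B_i(z_c)$ (resp. $B_{i^*}(z_c)$) and $u=1$. At a trivalent vertex $g_1g_2=g_3t$ with $t\in U_+$, where $g_3$ labels the southern edge, whose $u$-variable is by definition the cluster variable $x_c$ of $\mathsf v_c$; then $t$ is moved to the right across all further strands, including those of the right side that are added later, by $tg=g't'$ with $t'\in U_+$, where $g'$ has the same $u$ as $g$. At a $2m$-valent vertex the product of the labels is preserved. For every edge $u_{\mathsf e}=\prod_cx_c^{\nu_c(\mathsf e)}$, where $\nu_c$ is $1$ on the southern edge of $\mathsf v_c$, $0$ on the other edges starting above depth $c+1$, and $0$ on the southern edges of the other trivalent vertices, and propagates through $2m$-valent vertices by the tropical Lusztig rules (tropicalization of the transition maps $x_i(t_1)x_j(t_2)\cdots=x_j(p_1)x_i(p_2)\cdots$). **Proposition.** Let $(X_\bullet,Y_\bullet)$ represent a point of $T_\beta$,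 with coordinates $z$; let $c\in[0,N]$, $\bar c=N-c$, and let a double inductive weave of $\beta$ be given. Then the horizontal path at depth $c$ reads a reduced word $\mathbf j=(j_1,\dots,j_\ell)$ for $w_{\bar c}$, the edge labels (above depth $c$) exist, with all $u_{\mathsf e}\in\mathbb C^\times$, and if $\mathsf e_1,\dots,\mathsf e_\ell$ are the edges crossed by this path, then there is a unique $h^+_{\bar c}\in H$ with $Z_{\bar c}:=Y_{\bar c}^{-1}X_{\bar c}\in U_+\dot w_{\bar c}h^+_{\bar c}U_+$, and $$h^+_{\bar c}=\chi^{\mathbf j}_1(u_{\mathsf e_1})\cdots\chi^{\mathbf j}_\ell(u_{\mathsf e_\ell}),\qquad \chi^{\mathbf j}_p=s_{j_\ell}s_{j_{\ell-1}}\cdots s_{j_{p+1}}\cdot\chi_{j_p}.$$ -/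

import Mathlib

open Matrix

noncomputable section

namespace Weave

/-! ## Cartan matrices, Weyl groups, reduced words, Demazure products -/

/-- `A` is a generalized Cartan matrix, `A i j = ⟨α_i^∨, α_j⟩`. (Finite type is forced below by the
existence of a finite-dimensional representation whose weights span the weight lattice.) -/
structure IsCartan {r : ℕ} (A : Matrix (Fin r) (Fin r) ℤ) : Prop where
  diag : ∀ i, A i i = 2
  nonpos : ∀ i j, i ≠ j → A i j ≤ 0
  zero : ∀ i j, A i j = 0 → A j i = 0

section Weyl

variable {r : ℕ} (A : Matrix (Fin r) (Fin r) ℤ)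

/-- The simple reflection `s_i` acting on the coroot (= cocharacter) lattice `⨁ ℤ χ_k = ℤ^r`,
`s_i(lam) = lam - ⟨lam, α_i⟩ χ_i`. -/
def simpleRefl (i : Fin r) : Module.End ℤ (Fin r → ℤ) where
  toFun lam := lam - (∑ k, lam k * A k i) • Pi.single i 1
  map_add' x y := by
    simp only [Pi.add_apply, add_mul, Finset.sum_add_distrib, add_smul]
    abel
  map_smul' c x := by
    simp only [Pi.smul_apply, smul_eq_mul, mul_assoc, ← Finset.mul_sum, mul_smul, smul_sub,
      RingHom.id_apply]

/-- The Weyl group element `s_{j_1} ⋯ s_{j_l}` of a word, in the faithful action of the Weyl group on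
the coroot lattice. -/
def weyl (j : List (Fin r)) : Module.End ℤ (Fin r → ℤ) := (j.map (simpleRefl A)).prod

/-- A word is reduced if no word for the same Weyl group element is shorter. -/
def IsReduced (j : List (Fin r)) : Prop := ∀ k, weyl A k = weyl A j → j.length ≤ k.length

/-- `j` is a reduced expression for `w`. -/
def IsReducedExpr (j : List (Fin r)) (w : Module.End ℤ (Fin r → ℤ)) : Prop :=
  IsReduced A j ∧ weyl A j = w

/-- Length of a Weyl group element. -/
def len (w : Module.End ℤ (Fin r → ℤ)) : ℕ := sInf {n | ∃ j, j.length = n ∧ weyl A j = w}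

open Classical in
/-- The longest element `w_∘` of the (finite) Weyl group. -/
def longest : Module.End ℤ (Fin r → ℤ) :=
  if h : ∃ j, IsReduced A j ∧ ∀ k, IsReduced A k → k.length ≤ j.length
  then weyl A (Classical.choose h) else 1

open Classical in
/-- The involution `i ↦ i*` of the Dynkin diagram, `w_∘ χ_i = - χ_{i*}`. -/
def star (i : Fin r) : Fin r :=
  if h : ∃ k, longest A (Pi.single i 1) = - Pi.single k 1 then Classical.choose h else i

/-- Demazure product `w * s_i`. -/
def demRight (w : Module.End ℤ (Fin r → ℤ)) (i : Fin r) : Module.End ℤ (Fin r → ℤ) :=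
  if len A w < len A (w * simpleRefl A i) then w * simpleRefl A i else w

/-- Demazure product `s_i * w`. -/
def demLeft (i : Fin r) (w : Module.End ℤ (Fin r → ℤ)) : Module.End ℤ (Fin r → ℤ) :=
  if len A w < len A (simpleRefl A i * w) then simpleRefl A i * w else w

/-- The coroots `χ^j_1, …, χ^j_l`, with `χ^j_p = s_{j_l} ⋯ s_{j_{p+1}} · χ_{j_p}`. -/
def inversions : List (Fin r) → List (Fin r → ℤ)
  | [] => []
  | i :: j => j.foldl (fun lam k => simpleRefl A k lam) (Pi.single i 1) :: inversions j

end Weyl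

/-- Letters of a double braid word, i.e. elements of `±I`. -/
inductive Letter (r : ℕ)
  | pos (i : Fin r)
  | neg (i : Fin r)

/-- The Weyl group elements of a double braid word: `demazure A (i_{c+1} ⋯ i_N)` is `w_c`, given by
`w_N = 1` and `w_{c-1} = w_c * s_i` if `i_c = i > 0`, `w_{c-1} = s_{i*} * w_c` if `i_c = -i < 0`. -/
def demazure {r : ℕ} (A : Matrix (Fin r) (Fin r) ℤ) :
    List (Letter r) → Module.End ℤ (Fin r → ℤ)
  | [] => 1
  | .pos i :: l => demRight A (demazure A l) i
  | .neg i :: l => demLeft A (star A i) (demazure A l)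

/-! ## The group -/

/-- A representation, of dimension `d`, of the complex semisimple Lie algebra with Cartan matrix `A`
(Chevalley–Serre generators and relations), written in a basis of weight vectors, whose weights
generate the whole weight lattice `ℤ^r` (a weight `mu` is recorded by the integers `⟨α_i^∨, mu⟩`). -/
structure ChevalleyRep {r : ℕ} (A : Matrix (Fin r) (Fin r) ℤ) (d : ℕ) where
  wt : Fin d → Fin r → ℤ
  e : Fin r → Matrix (Fin d) (Fin d) ℂ
  f : Fin r → Matrix (Fin d) (Fin d) ℂ
  comm_ef : ∀ i j, ⁅e i, f j⁆ = if i = j then Matrix.diagonal (fun k => (wt k i : ℂ)) else 0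
  comm_he : ∀ i j, ⁅Matrix.diagonal (fun k => (wt k i : ℂ)), e j⁆ = (A i j : ℂ) • e j
  comm_hf : ∀ i j, ⁅Matrix.diagonal (fun k => (wt k i : ℂ)), f j⁆ = (-A i j : ℂ) • f j
  serre_e : ∀ i j, i ≠ j →
    (fun M => ⁅e i, M⁆)^[(1 - A i j).toNat] (e j) = 0
  serre_f : ∀ i j, i ≠ j →
    (fun M => ⁅f i, M⁆)^[(1 - A i j).toNat] (f j) = 0
  span_wt : AddSubgroup.closure (Set.range wt) = ⊤

/-- The invertible matrix `exp M`. -/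
def expUnit {d : ℕ} (M : Matrix (Fin d) (Fin d) ℂ) : GL (Fin d) ℂ where
  val := NormedSpace.exp M
  inv := NormedSpace.exp (-M)
  val_inv := by
    rw [← Matrix.exp_add_of_commute _ _ (Commute.refl M).neg_right, add_neg_cancel,
      NormedSpace.exp_zero]
  inv_val := by
    rw [← Matrix.exp_add_of_commute _ _ (Commute.refl M).neg_left, neg_add_cancel,
      NormedSpace.exp_zero]

namespace ChevalleyRep

variable {r d : ℕ} {A : Matrix (Fin r) (Fin r) ℤ} (R : ChevalleyRep A d)

/-- The simply connected complex semisimple group `G` with Cartan matrix `A`, as the Chevalley group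
generated by the one-parameter groups `exp (t e_i)`, `exp (t f_i)`. -/
def G : Subgroup (GL (Fin d) ℂ) :=
  Subgroup.closure {g | ∃ i, ∃ t : ℂ, g = expUnit (t • R.e i) ∨ g = expUnit (t • R.f i)}

/-- The pinning, `x_i(t) = exp (t e_i)`. -/
def x (i : Fin r) (t : ℂ) : R.G :=
  ⟨expUnit (t • R.e i), Subgroup.subset_closure ⟨i, t, Or.inl rfl⟩⟩

/-- The pinning, `y_i(t) = exp (t f_i)`. -/
def y (i : Fin r) (t : ℂ) : R.G :=
  ⟨expUnit (t • R.f i), Subgroup.subset_closure ⟨i, t, Or.inr rfl⟩⟩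

/-- `ṡ_i`, the image of `(0 -1; 1 0)` under the `SL₂` of the `i`-th node. -/
def sdot (i : Fin r) : R.G := R.x i (-1) * R.y i 1 * R.x i (-1)

/-- The coroot `χ_i(t)`, the image of `diag(t, t⁻¹) = (0 t; -t⁻¹ 0) (0 -1; 1 0)` under the `SL₂` of
the `i`-th node. -/
def chi (i : Fin r) (t : ℂˣ) : R.G :=
  R.x i t * R.y i (-((t⁻¹ : ℂˣ) : ℂ)) * R.x i t * R.sdot i

/-- `B_i(z) = x_i(z) ṡ_i`. -/
def braidMatrix (i : Fin r) (z : ℂ) : R.G := R.x i z * R.sdot i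

/-- The value at `t` of the cocharacter `∑ lam_i χ_i`. -/
def cochar (lam : Fin r → ℤ) (t : ℂˣ) : R.G := (List.ofFn fun i => R.chi i (t ^ lam i)).prod

/-- The maximal unipotent subgroup `U_+`. -/
def U : Subgroup R.G := Subgroup.closure {g | ∃ i t, g = R.x i t}

/-- The Cartan torus `H`. -/
def H : Subgroup R.G := Subgroup.closure {g | ∃ i t, g = R.chi i t}

/-- The Borel subgroup `B_+ = H U_+`. -/
def B : Subgroup R.G := R.H ⊔ R.U

open Classical in
/-- The lift `ẇ = ṡ_{j_1} ⋯ ṡ_{j_l}` of `w`, for a reduced expression `j` of `w`. -/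
def lift (w : Module.End ℤ (Fin r → ℤ)) : R.G :=
  if h : ∃ j, IsReducedExpr A j w then ((Classical.choose h).map R.sdot).prod else 1

/-- Weighted flags, the elements of `G / U_+`. -/
abbrev WFlag : Type := R.G ⧸ R.U

/-- The weighted flags `F, F'` are strictly `w`-related: `F⁻¹ F' ∈ U_+ ẇ U_+`. -/
def StrictRel (w : Module.End ℤ (Fin r → ℤ)) (F F' : R.WFlag) : Prop :=
  ∃ g g' : R.G, (g : R.WFlag) = F ∧ (g' : R.WFlag) = F' ∧
    g⁻¹ * g' ∈ DoubleCoset.doubleCoset (R.lift w) R.U R.U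

/-- The weighted flags `F, F'` are weakly `w`-related: `F⁻¹ F' ∈ B_+ ẇ B_+`. -/
def WeakRel (w : Module.End ℤ (Fin r → ℤ)) (F F' : R.WFlag) : Prop :=
  ∃ g g' : R.G, (g : R.WFlag) = F ∧ (g' : R.WFlag) = F' ∧
    g⁻¹ * g' ∈ DoubleCoset.doubleCoset (R.lift w) R.B R.B

/-! ## Double braid varieties and Deodhar tori -/

/-- `(X_•, Y_•)` represents a point of the double braid variety `R(β)`, where `R(β)` is the set of such
pairs modulo the diagonal action of `G`. With `N` the length of `β`: `X_N = Y_N`, `Y_0` and `X_0` are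
weakly `w_∘`-related, and for a letter `i_c = i > 0` one has `X_c → X_{c-1}` (strictly `s_i`-related)
and `Y_{c-1} = Y_c`, while for `i_c = -i < 0` one has `Y_{c-1} → Y_c` (strictly `s_{i*}`-related) and
`X_{c-1} = X_c`. The letter `i_c` is the entry of `β` at position `c - 1`. -/
structure InVariety (β : List (Letter r)) (X Y : Fin (β.length + 1) → R.WFlag) : Prop where
  last : X (Fin.last _) = Y (Fin.last _)
  zero : R.WeakRel (longest A) (Y 0) (X 0)
  step : ∀ c : Fin β.length,
    match β.get c with
    | .pos i => R.StrictRel (simpleRefl A i) (X c.succ) (X c.castSucc) ∧ Y c.castSucc = Y c.succ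
    | .neg i => R.StrictRel (simpleRefl A (star A i)) (Y c.castSucc) (Y c.succ) ∧
        X c.castSucc = X c.succ

/-- `(X_•, Y_•)` represents a point of the Deodhar torus `T_β ⊆ R(β)`: for all `c ∈ [0, N]`, `Y_c` and
`X_c` are weakly `w_c`-related. -/
structure InDeodharTorus (β : List (Letter r)) (X Y : Fin (β.length + 1) → R.WFlag) : Prop
    extends R.InVariety β X Y where
  rel : ∀ c : Fin (β.length + 1), R.WeakRel (demazure A (β.drop c)) (Y c) (X c)

/-- `z_1, …, z_N` are coordinates of `(X_•, Y_•)`: going from `Y_0` along `Y_0, …, Y_N = X_N, …, X_0`,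
suitable representatives get multiplied on the right by `B_{i*}(z_c)` at a step `Y_{c-1} → Y_c` with
`i_c = -i` and by `B_i(z_c)` at a step `X_c → X_{c-1}` with `i_c = i`. Acting by `G` one can take the
representative of `Y_0` to be `1`. -/
def IsCoordinates (β : List (Letter r)) (X Y : Fin (β.length + 1) → R.WFlag)
    (z : Fin β.length → ℂ) : Prop :=
  ∃ p q : Fin (β.length + 1) → R.G,
    (∀ c, (p c : R.WFlag) = X c) ∧ (∀ c, (q c : R.WFlag) = Y c) ∧
    p (Fin.last _) = q (Fin.last _) ∧
    ∀ c : Fin β.length,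
      match β.get c with
      | .pos i => p c.castSucc = p c.succ * R.braidMatrix i (z c) ∧ q c.castSucc = q c.succ
      | .neg i => q c.succ = q c.castSucc * R.braidMatrix (star A i) (z c) ∧
          p c.castSucc = p c.succ

/-- `h` is a torus element with `Z = Y⁻¹ X ∈ U_+ ẇ h U_+`. -/
def IsCartanElement (w : Module.End ℤ (Fin r → ℤ)) (X Y : R.WFlag) (h : R.G) : Prop :=
  h ∈ R.H ∧ ∃ p q : R.G, (p : R.WFlag) = X ∧ (q : R.WFlag) = Y ∧
    q⁻¹ * p ∈ DoubleCoset.doubleCoset (R.lift w * h) R.U R.U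

end ChevalleyRep

/-! ## Double inductive weaves -/

/-- The order `m_{ij}` of `s_i s_j` (`0` if infinite). -/
def coxOrder {r : ℕ} (A : Matrix (Fin r) (Fin r) ℤ) (i j : Fin r) : ℕ :=
  if A i j * A j i = 0 then 2 else if A i j * A j i = 1 then 3
  else if A i j * A j i = 2 then 4 else if A i j * A j i = 3 then 6 else 0

/-- The word `i j i j ⋯` with `m` letters. -/
def altWord {r : ℕ} : ℕ → Fin r → Fin r → List (Fin r)
  | 0, _, _ => []
  | m + 1, i, j => i :: altWord m j i

/-- `DoubleInductiveWeave A l j` is the type of double inductive weaves of the double braid word `l`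
whose bottom word is `j`. The double string reads `l` from its last letter to its first one; a positive
letter `i` adds a strand of colour `i` on the right of the current slice, a negative letter `-i` adds a
strand of colour `i*` on its left. If the slice, extended by the new strand, stays reduced, the strand
is just kept (`posKeep`, `negKeep`); otherwise, the slice having first been brought by
`2m_{ij}`-valent vertices (`vertex`; 4-, 6-, 8- or 12-valent) into a form in which the adjacent
strand has the same colour, it ends in a trivalent vertex with that strand (`posTri`, `negTri`).

For a weave of a word `β` with `N` letters, the part above depth `c` is a weave of the
last `c` letters of `β`, and `j` is the word read along the horizontal path at depth `c`. -/
inductive DoubleInductiveWeave {r : ℕ} (A : Matrix (Fin r) (Fin r) ℤ) :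
    List (Letter r) → List (Fin r) → Type
  | nil : DoubleInductiveWeave A [] []
  | vertex {l : List (Letter r)} (p s : List (Fin r)) (i j : Fin r) (hij : i ≠ j)
      (W : DoubleInductiveWeave A l (p ++ altWord (coxOrder A i j) i j ++ s)) :
      DoubleInductiveWeave A l (p ++ altWord (coxOrder A i j) j i ++ s)
  | posKeep {l : List (Letter r)} {j : List (Fin r)} (i : Fin r)
      (hred : IsReduced A (j ++ [i])) (W : DoubleInductiveWeave A l j) :
      DoubleInductiveWeave A (.pos i :: l) (j ++ [i])
  | posTri {l : List (Letter r)} {j : List (Fin r)} (i : Fin r)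
      (W : DoubleInductiveWeave A l (j ++ [i])) :
      DoubleInductiveWeave A (.pos i :: l) (j ++ [i])
  | negKeep {l : List (Letter r)} {j : List (Fin r)} (i : Fin r)
      (hred : IsReduced A (star A i :: j)) (W : DoubleInductiveWeave A l j) :
      DoubleInductiveWeave A (.neg i :: l) (star A i :: j)
  | negTri {l : List (Letter r)} {j : List (Fin r)} (i : Fin r)
      (W : DoubleInductiveWeave A l (star A i :: j)) :
      DoubleInductiveWeave A (.neg i :: l) (star A i :: j)

/-! ## Edge labels -/

/-- The tropical Lusztig rules at a vertex with incoming weights `a_1, …, a_m` on strands coloured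
`i j i j ⋯`, for `m = 2`, `m = 3`, `m = 4` with `a_{ij} = -2` and `m = 6` with `a_{ij} = -3`
(tropicalization of the transition maps `x_i(t_1) x_j(t_2) ⋯ = x_j(p_1) x_i(p_2) ⋯`). -/
def tropStd : List ℤ → List ℤ
  | [a₁, a₂] => [a₂, a₁]
  | [a₁, a₂, a₃] => [a₂ + a₃ - min a₁ a₃, min a₁ a₃, a₂ + a₁ - min a₁ a₃]
  | [a₁, a₂, a₃, a₄] =>
    let π₁ := min (a₁ + a₂) (min a₁ a₃ + a₄)
    let π₂ := min (2 * a₁ + a₂) (2 * min a₁ a₃ + a₄)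
    [a₂ + 2 * a₃ + a₄ - π₂, π₂ - π₁, 2 * π₁ - π₂, a₁ + a₂ + a₃ - π₁]
  | [a₁, a₂, a₃, a₄, a₅, a₆] =>
    let μ := min (min (a₁ + a₃) (2 * a₃)) (min (a₃ + a₅) (a₁ + a₅))
    let π₁ := min (a₁ + a₂ + 2 * a₃ + a₄)
      (min (a₁ + a₂ + 2 * min a₃ a₅ + a₆) (min a₁ a₃ + a₄ + 2 * a₅ + a₆))
    let π₂ := min (min (2 * a₁ + 2 * a₂ + 3 * a₃ + a₄) (2 * a₁ + 2 * a₂ + 3 * min a₃ a₅ + a₆))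
      (min (2 * min a₁ a₃ + 2 * a₄ + 3 * a₅ + a₆) (a₁ + a₂ + a₄ + 2 * a₅ + a₆ + μ))
    let π₃ := min (min (3 * a₁ + 2 * a₂ + 3 * a₃ + a₄) (3 * a₁ + 2 * a₂ + 3 * min a₃ a₅ + a₆))
      (min (3 * min a₁ a₃ + 2 * a₄ + 3 * a₅ + a₆) (2 * a₁ + a₂ + a₄ + 2 * a₅ + a₆ + μ))
    let π₄ := min
      (2 * a₁ + 2 * a₂ + 3 * a₃ + a₄ +
        min (a₁ + a₂ + 3 * a₃ + a₄)
          (min (a₁ + a₂ + 3 * min a₃ a₅ + a₆) (μ + a₄ + 2 * a₅ + a₆)))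
      (2 * a₆ + 3 * min (a₁ + a₂ + 2 * min a₃ a₅) (min a₁ a₃ + a₄ + 2 * a₅))
    [a₂ + 3 * a₃ + 2 * a₄ + 3 * a₅ + a₆ - π₃, π₃ - π₂, 3 * π₂ - π₃ - π₄, π₄ - π₁ - π₂,
      3 * π₁ - π₄, a₁ + a₂ + 2 * a₃ + a₄ + a₅ - π₁]
  | _ => []

/-- The tropical Lusztig rule at a vertex with incoming colours `i j i j ⋯`. For `a_{ij} > a_{ji}` it
is obtained from `tropStd` by reading words backwards. -/
def tropLusztig {r : ℕ} (A : Matrix (Fin r) (Fin r) ℤ) (i j : Fin r) (a : List ℤ) : List ℤ :=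
  if A i j ≤ A j i then tropStd a else (tropStd a.reverse).reverse

/-- A labelled weave edge: its colour `i`, the value `f`, and the exponents `ν` of the monomial `u`, the
value `ν e` being that of the vertex cycle `ν_e` on this edge. -/
structure Edge (r : ℕ) where
  color : Fin r
  f : ℂ
  ν : ℕ →₀ ℤ

/-- The value `u = ∏_e x_e ^ ν_e` of the `u`-variable, given the values `x_e` of the cluster variables
of the trivalent vertices (indexed by depth). -/
def Edge.u {r : ℕ} (ed : Edge r) (x : ℕ → ℂˣ) : ℂˣ := ed.ν.prod fun e n => x e ^ n

namespace ChevalleyRep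

variable {r d : ℕ} {A : Matrix (Fin r) (Fin r) ℤ} (R : ChevalleyRep A d)

/-- The label `g = B_i(f) χ_i(u)` of an edge. -/
def lab (x : ℕ → ℂˣ) (ed : Edge r) : R.G := R.braidMatrix ed.color ed.f * R.chi ed.color (ed.u x)

/-- `Rake x t E E' t'`: moving `t ∈ U_+` from left to right across edges labelled by `E`, by the rule
`t g = g' t'` with `t, t' ∈ U_+`, changes the labels to `E'` (only the values `f` change) and leaves `t'`
on the right. -/
inductive Rake (x : ℕ → ℂˣ) : R.G → List (Edge r) → List (Edge r) → R.G → Prop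
  | nil (t : R.G) (ht : t ∈ R.U) : Rake x t [] [] t
  | cons (t t₁ t' : R.G) (ed ed' : Edge r) (E E' : List (Edge r)) (ht : t ∈ R.U)
      (hcolor : ed'.color = ed.color) (hν : ed'.ν = ed.ν)
      (h : t * R.lab x ed = R.lab x ed' * t₁) (hrest : Rake x t₁ E E' t') :
      Rake x t (ed :: E) (ed' :: E') t'

/-- `Labeling x W z E t`: the edge labeling of the weave `W` at the point with coordinates `z`, propagated
from top to bottom, exists, has value `x_e` for the cluster variable of the trivalent vertex
between depths `e` and `e + 1`, and labels the bottom edges of `W` by `E`; `t ∈ U_+` is the product of the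
unipotent elements that have left the slice on the right.

* Top edges are labelled by `B_i(z_c)`, with `u = 1`. A strand added on the right is met by the
  unipotent elements coming out of the earlier trivalent vertices.
* At a `2m`-valent vertex the product of the labels is preserved, and the exponents of the
  `u`-variables change by the tropical Lusztig rules.
* At a trivalent vertex, `g_1 g_2 = g_3 t` with `t ∈ U_+`, which moves on to the right; the `u`-variable of
  the southern edge is the cluster variable of this vertex. -/
inductive Labeling (x : ℕ → ℂˣ) : {l : List (Letter r)} → {j : List (Fin r)} →
    DoubleInductiveWeave A l j → List ℂ → List (Edge r) → R.G → Prop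
  | nil : Labeling x .nil [] [] 1
  | vertex {l : List (Letter r)} {p s : List (Fin r)} {i j : Fin r} {hij : i ≠ j}
      {W : DoubleInductiveWeave A l (p ++ altWord (coxOrder A i j) i j ++ s)} {z : List ℂ} {t : R.G}
      (P M M' S : List (Edge r)) (hW : Labeling x W z (P ++ M ++ S) t)
      (hP : P.map Edge.color = p) (hM : M.map Edge.color = altWord (coxOrder A i j) i j)
      (hM' : M'.map Edge.color = altWord (coxOrder A i j) j i)
      (htrop : ∀ e, M'.map (fun ed => ed.ν e) = tropLusztig A i j (M.map (fun ed => ed.ν e)))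
      (hprod : (M.map (R.lab x)).prod = (M'.map (R.lab x)).prod) :
      Labeling x (.vertex p s i j hij W) z (P ++ M' ++ S) t
  | posKeep {l : List (Letter r)} {j : List (Fin r)} {i : Fin r} {hred : IsReduced A (j ++ [i])}
      {W : DoubleInductiveWeave A l j} {z : List ℂ} {E : List (Edge r)} {t : R.G}
      (z₀ : ℂ) (ed : Edge r) (t' : R.G) (hW : Labeling x W z E t)
      (hr : R.Rake x t [⟨i, z₀, 0⟩] [ed] t') :
      Labeling x (.posKeep i hred W) (z₀ :: z) (E ++ [ed]) t'
  | posTri {l : List (Letter r)} {j : List (Fin r)} {i : Fin r}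
      {W : DoubleInductiveWeave A l (j ++ [i])} {z : List ℂ} {E : List (Edge r)} {t : R.G}
      (z₀ : ℂ) (e₁ e₂ e₃ : Edge r) (t₁ t₂ : R.G) (hW : Labeling x W z (E ++ [e₁]) t)
      (hr : R.Rake x t [⟨i, z₀, 0⟩] [e₂] t₁)
      (hcolor : e₃.color = i) (hν : e₃.ν = Finsupp.single l.length 1) (ht₂ : t₂ ∈ R.U)
      (hprod : R.lab x e₁ * R.lab x e₂ = R.lab x e₃ * t₂) :
      Labeling x (.posTri i W) (z₀ :: z) (E ++ [e₃]) (t₂ * t₁)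
  | negKeep {l : List (Letter r)} {j : List (Fin r)} {i : Fin r}
      {hred : IsReduced A (star A i :: j)}
      {W : DoubleInductiveWeave A l j} {z : List ℂ} {E : List (Edge r)} {t : R.G}
      (z₀ : ℂ) (hW : Labeling x W z E t) :
      Labeling x (.negKeep i hred W) (z₀ :: z) (⟨star A i, z₀, 0⟩ :: E) t
  | negTri {l : List (Letter r)} {j : List (Fin r)} {i : Fin r}
      {W : DoubleInductiveWeave A l (star A i :: j)} {z : List ℂ} {E : List (Edge r)} {t : R.G}
      (z₀ : ℂ) (e₂ e₃ : Edge r) (E' : List (Edge r)) (t₁ t₂ : R.G)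
      (hW : Labeling x W z (e₂ :: E) t)
      (hcolor : e₃.color = star A i) (hν : e₃.ν = Finsupp.single l.length 1)
      (hprod : R.lab x ⟨star A i, z₀, 0⟩ * R.lab x e₂ = R.lab x e₃ * t₁)
      (hr : R.Rake x t₁ E E' t₂) :
      Labeling x (.negTri i W) (z₀ :: z) (e₃ :: E') (t₂ * t)

end ChevalleyRep

end Weave

end

/-! Along the coordinates, Y_c⁻¹X_c is represented by a product `braidProd` of braid matrices: a
positive letter multiplies it by one on the right, a negative letter by one on the left. Each rule
of the edge labelling preserves the product of the labels of the slice times the unipotent element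
that has left on the right, so this product always equals `braidProd` (`Labeling.spec`). Pushing the
torus factor χ_i(u) of each label through the labels to its right applies the simple reflections of
those strands to the coroot. Hence the product of labels is a product of braid matrices along the
reduced word j times ∏ χ^j_p(u_p) (`coe_prod_lab`). For reduced j the first factor lies in U_+ ẇ U_+
(`bprod_eq_mul_wdot_mul`), which gives the formula for h^+. Uniqueness follows from a refined
disjointness of Bruhat cells: a coset U_+ ẇh U_+ determines ẇh (`bruhat_disjoint`).

For the existence of labels, the one possible obstruction is at a trivalent vertex. There
B_i(a)χ_i(u)·B_i(b)χ_i(v) has the form B_i(f)χ_i(ubv)·t as soon as b ≠ 0 (`bb_mul_bb`). If b = 0,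
the two strands collapse to x_i(a) times a torus element, and Y_c⁻¹X_c lies in the cell of a word
with one letter less. The Deodhar condition puts it in the cell of w_c, and cells are disjoint. At a
2m-valent vertex, the values f for the new word come from `exists_bprod_eq`, whose uniqueness
argument is U_+ ∩ U_- = 1. The torus parts match because the tropical Lusztig rules preserve the
weight ∑ a_p χ^j_p (`inversionSum_tropLusztig`).

The structure theory of G is derived from the Chevalley–Serre relations inside GL_d. The trace form
on cocharacters is positive definite and Weyl invariant, which bounds the Cartan integers. The
adjoint action of exp(t e_i) is a polynomial in t, which gives the action of ṡ_i, the braid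
relations and the normalization of the torus. The splitting U_+ = x_i(ℂ)·N_i, with ṡ_i conjugating
N_i into U_+, shows that every real root is positive or negative. The exchange condition follows,
and with it the independence of ẇ of the reduced word. -/

open Matrix

noncomputable section

namespace Weave

/-! ## Exponentials -/

section NormedAlgebra

open NormedSpace

variable {𝔸 : Type*} [NormedRing 𝔸] [NormedAlgebra ℂ 𝔸] [NormedAlgebra ℚ 𝔸] [CompleteSpace 𝔸]

theorem exp_smul_mul_exp_neg_smul (M : 𝔸) (t : ℂ) : exp (t • M) * exp (-(t • M)) = 1 := by
  rw [← exp_add_of_commute (Commute.refl (t • M)).neg_right, add_neg_cancel, exp_zero]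

/-- The Lax equation P' = [M, P] is solved by conjugation: exp(-tM) P(t) exp(tM) has derivative
zero. -/
theorem exp_smul_mul_eq_of_hasDerivAt (M : 𝔸) (P : ℂ → 𝔸)
    (hP : ∀ t, HasDerivAt P (M * P t - P t * M) t) (t : ℂ) :
    exp (t • M) * P 0 = P t * exp (t • M) := by
  have key : ∀ t, HasDerivAt (fun t : ℂ => exp (t • (-M)) * P t * exp (t • M)) 0 t := by
    intro t
    have h1 := hasDerivAt_exp_smul_const (𝕂 := ℂ) (-M) t
    have h2 := hasDerivAt_exp_smul_const' (𝕂 := ℂ) M t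
    refine ((h1.fun_mul (hP t)).fun_mul h2).congr_deriv ?_
    noncomm_ring
  have hc := is_const_of_deriv_eq_zero (fun s => (key s).differentiableAt)
    (fun s => (key s).deriv) t 0
  simp only [zero_smul, exp_zero, one_mul, mul_one, smul_neg, neg_zero] at hc
  rw [← hc, ← mul_assoc, ← mul_assoc, exp_smul_mul_exp_neg_smul, one_mul]

/-- The Baker–Campbell–Hausdorff series stops after the first bracket when that bracket is central.
The curve exp(-t(x+y)) exp(tx) exp(ty) exp(-t²z/2) has derivative zero. -/
theorem exp_add_of_two_step (x y z : 𝔸) (hz : x * y - y * x = z) (hx : Commute x z)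
    (hy : Commute y z) : exp (x + y) = exp x * exp y * exp (-((2⁻¹ : ℂ) • z)) := by
  have hAd : ∀ t : ℂ, exp (t • x) * y = (y + t • z) * exp (t • x) := by
    intro t
    have := exp_smul_mul_eq_of_hasDerivAt x (fun t => y + t • z) (fun t => by
      have h : HasDerivAt (fun t : ℂ => y + t • z) ((1 : ℂ) • z) t :=
        ((hasDerivAt_id t).smul_const z).const_add y
      convert h using 1
      rw [one_smul, mul_add, add_mul, mul_smul_comm, smul_mul_assoc, hx.eq, ← hz]
      abel) t
    simpa using this
  have hsq : ∀ t : ℂ, HasDerivAt (fun t : ℂ => exp ((t * t) • (-((2⁻¹ : ℂ) • z))))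
      (-(t • z) * exp ((t * t) • (-((2⁻¹ : ℂ) • z)))) t := by
    intro t
    have h1 := hasDerivAt_exp_smul_const' (𝕂 := ℂ) (-((2⁻¹ : ℂ) • z)) (t * t)
    have h2 : HasDerivAt (fun t : ℂ => t * t) (t + t) t := by
      simpa using (hasDerivAt_id t).fun_mul (hasDerivAt_id t)
    refine (HasDerivAt.scomp (h := fun t : ℂ => t * t) t h1 h2).congr_deriv ?_
    rw [← smul_mul_assoc]
    congr 1
    rw [smul_neg, smul_smul]
    congr 2
    ring
  have hzc : ∀ t : ℂ, Commute z (exp (t • y)) := fun t =>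
    ((hy.smul_left t).exp_left).symm
  have hzc' : ∀ t : ℂ, Commute z (exp (t • x)) := fun t =>
    ((hx.smul_left t).exp_left).symm
  have key : ∀ t : ℂ, HasDerivAt (fun t : ℂ => exp (t • (-(x + y))) *
      (exp (t • x) * exp (t • y) * exp ((t * t) • (-((2⁻¹ : ℂ) • z))))) 0 t := by
    intro t
    have h0 := hasDerivAt_exp_smul_const (𝕂 := ℂ) (-(x + y)) t
    have h1 := hasDerivAt_exp_smul_const' (𝕂 := ℂ) x t
    have h2 := hasDerivAt_exp_smul_const' (𝕂 := ℂ) y t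
    refine (h0.fun_mul ((h1.fun_mul h2).fun_mul (hsq t))).congr_deriv ?_
    set a := exp (t • x)
    set b := exp (t • y)
    set c := exp ((t * t) • (-((2⁻¹ : ℂ) • z)))
    set e := exp (t • (-(x + y)))
    have e1 : a * (y * b) = (y + t • z) * a * b := by rw [← mul_assoc, hAd]
    have e2 : a * b * (-(t • z) * c) = -(t • z) * a * b * c := by
      have : Commute (-(t • z)) (a * b) :=
        (((hzc' t).mul_right (hzc t)).smul_left t).neg_left
      rw [← mul_assoc, ← this.eq]
      noncomm_ring
    rw [e1, e2]
    noncomm_ring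
  have hc := is_const_of_deriv_eq_zero (fun s => (key s).differentiableAt)
    (fun s => (key s).deriv) 1 0
  simp only [zero_smul, exp_zero, mul_one, smul_neg, one_smul, mul_zero, neg_zero] at hc
  have h1 := exp_smul_mul_exp_neg_smul (x + y) 1
  rw [one_smul] at h1
  rw [← mul_one (exp (x + y)), ← hc, ← mul_assoc, h1, one_mul]

/-- When ad M is nilpotent on v, the finite sum exp(t ad M)v solves the Lax equation with initial
value v. -/
theorem exp_smul_mul_eq_sum (M v : 𝔸) (n : ℕ) (h : (fun N => M * N - N * M)^[n] v = 0) (t : ℂ) :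
    exp (t • M) * v = (∑ k ∈ Finset.range n,
      (t ^ k * (k.factorial : ℂ)⁻¹) • (fun N => M * N - N * M)^[k] v) * exp (t • M) := by
  -- For n = 0 the sum is empty and the hypothesis says v = 0; the derivative computation needs a
  -- last term to drop.
  rcases n with _ | n
  · simp only [Function.iterate_zero, id] at h
    simp [h]
  set D : 𝔸 → 𝔸 := fun N => M * N - N * M
  have hderiv : ∀ t : ℂ, HasDerivAt (fun t : ℂ => ∑ k ∈ Finset.range (n + 1),
      (t ^ k * (k.factorial : ℂ)⁻¹) • D^[k] v)
      (M * (∑ k ∈ Finset.range (n + 1), (t ^ k * (k.factorial : ℂ)⁻¹) • D^[k] v)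
        - (∑ k ∈ Finset.range (n + 1), (t ^ k * (k.factorial : ℂ)⁻¹) • D^[k] v) * M) t := by
    intro t
    have h1 : HasDerivAt (fun t : ℂ => ∑ k ∈ Finset.range (n + 1),
      (t ^ k * (k.factorial : ℂ)⁻¹) • D^[k] v) (∑ k ∈ Finset.range (n + 1),
      ((k : ℂ) * t ^ (k - 1) * (k.factorial : ℂ)⁻¹) • D^[k] v) t := by
      refine HasDerivAt.fun_sum fun k _ => ?_
      exact ((hasDerivAt_pow k t).mul_const _).smul_const _
    convert h1 using 1
    have h2 : M * (∑ k ∈ Finset.range (n + 1), (t ^ k * (k.factorial : ℂ)⁻¹) • D^[k] v)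
        - (∑ k ∈ Finset.range (n + 1), (t ^ k * (k.factorial : ℂ)⁻¹) • D^[k] v) * M
        = ∑ k ∈ Finset.range (n + 1), (t ^ k * (k.factorial : ℂ)⁻¹) • D^[k + 1] v := by
      rw [Finset.mul_sum, Finset.sum_mul, ← Finset.sum_sub_distrib]
      refine Finset.sum_congr rfl fun k _ => ?_
      rw [Function.iterate_succ_apply', mul_smul_comm, smul_mul_assoc, ← smul_sub]
    rw [h2, Finset.sum_range_succ, h, smul_zero, add_zero, Finset.sum_range_succ']
    simp only [Nat.cast_zero, zero_mul, zero_smul, add_zero]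
    refine Finset.sum_congr rfl fun k _ => ?_
    congr 1
    rw [Nat.factorial_succ, Nat.add_sub_cancel, Nat.cast_mul]
    have : ((k + 1 : ℕ) : ℂ) ≠ 0 := Nat.cast_ne_zero.mpr (Nat.succ_ne_zero k)
    field_simp
  have := exp_smul_mul_eq_of_hasDerivAt M _ hderiv t
  rw [← this, Finset.sum_range_succ']
  simp

end NormedAlgebra

open scoped Matrix.Norms.Operator in
theorem Matrix.exp_smul_mul_eq_sum {d : ℕ} (M v : Matrix (Fin d) (Fin d) ℂ) (n : ℕ)
    (h : (fun N => ⁅M, N⁆)^[n] v = 0) (t : ℂ) :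
    NormedSpace.exp (t • M) * v = (∑ k ∈ Finset.range n,
      (t ^ k * (k.factorial : ℂ)⁻¹) • (fun N => ⁅M, N⁆)^[k] v) * NormedSpace.exp (t • M) :=
  Weave.exp_smul_mul_eq_sum M v n h t

open scoped Matrix.Norms.Operator in
theorem Matrix.exp_add_of_two_step {d : ℕ} (x y : Matrix (Fin d) (Fin d) ℂ)
    (hx : ⁅x, ⁅x, y⁆⁆ = 0) (hy : ⁅y, ⁅x, y⁆⁆ = 0) :
    NormedSpace.exp (x + y) =
      NormedSpace.exp x * NormedSpace.exp y * NormedSpace.exp (-((2⁻¹ : ℂ) • ⁅x, y⁆)) :=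
  Weave.exp_add_of_two_step x y _ rfl (sub_eq_zero.mp hx) (sub_eq_zero.mp hy)

open scoped Matrix.Norms.Operator in
theorem Matrix.hasSum_exp_apply {d : ℕ} (M : Matrix (Fin d) (Fin d) ℂ) (a b : Fin d) :
    HasSum (fun n : ℕ => ((n.factorial : ℂ)⁻¹) * (M ^ n) a b) (NormedSpace.exp M a b) := by
  have h := NormedSpace.exp_series_hasSum_exp' (𝕂 := ℂ) M
  have h1 : Continuous fun N : Matrix (Fin d) (Fin d) ℂ => N a b :=
    (continuous_apply b).comp (continuous_apply a)
  exact h.map (⟨⟨fun N : Matrix (Fin d) (Fin d) ℂ => N a b, rfl⟩, fun _ _ => rfl⟩ :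
    Matrix (Fin d) (Fin d) ℂ →+ ℂ) h1

/-- `M` raises the degree `φ` by `c`. -/
def IsHomog {d : ℕ} (φ : Fin d → ℤ) (c : ℤ) (M : Matrix (Fin d) (Fin d) ℂ) : Prop :=
  ∀ a b, M a b ≠ 0 → φ a = φ b + c

/-! ### Homogeneous matrices and the entries of their exponentials -/

namespace IsHomog

variable {d : ℕ} {φ : Fin d → ℤ} {c : ℤ} {M : Matrix (Fin d) (Fin d) ℂ}

theorem smul (h : IsHomog φ c M) (t : ℂ) : IsHomog φ c (t • M) := fun a b hab =>
  h a b fun h0 => hab (by simp [h0])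

theorem mul {c' : ℤ} {N : Matrix (Fin d) (Fin d) ℂ} (h : IsHomog φ c M) (h' : IsHomog φ c' N) :
    IsHomog φ (c + c') (M * N) := by
  intro a b hab
  rw [Matrix.mul_apply] at hab
  obtain ⟨k, -, hk⟩ := Finset.exists_ne_zero_of_sum_ne_zero hab
  have h1 := h a k (left_ne_zero_of_mul hk)
  have h2 := h' k b (right_ne_zero_of_mul hk)
  omega

theorem one : IsHomog φ 0 (1 : Matrix (Fin d) (Fin d) ℂ) := by
  intro a b hab
  by_cases h : a = b
  · simp [h]
  · exact absurd (Matrix.one_apply_ne h) hab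

theorem pow (h : IsHomog φ c M) (n : ℕ) : IsHomog φ (n * c) (M ^ n) := by
  induction n with
  | zero => simpa using one
  | succ n ih =>
    rw [pow_succ]
    have := ih.mul h
    convert this using 1
    push_cast; ring

/-- The n-th power of M shifts degrees by nc, so for c ≠ 0 a given difference of degrees is reached
by one term of the exponential series only. -/
theorem exp_apply (h : IsHomog φ c M) (hc : c ≠ 0) {a b : Fin d} {n : ℕ} (hn : φ a = φ b + n * c) :
    NormedSpace.exp M a b = ((n.factorial : ℂ)⁻¹) * (M ^ n) a b := by
  refine (Matrix.hasSum_exp_apply M a b).unique (hasSum_single n fun k hk => ?_)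
  by_contra h0
  have := (h.pow k) a b (right_ne_zero_of_mul h0)
  rw [hn] at this
  have h2 : (n : ℤ) * c = k * c := by omega
  exact hk (by exact_mod_cast (mul_right_cancel₀ hc h2).symm)

theorem exists_of_exp_apply_ne_zero (h : IsHomog φ c M) {a b : Fin d}
    (hab : NormedSpace.exp M a b ≠ 0) : ∃ n : ℕ, φ a = φ b + n * c := by
  by_contra! h0
  refine hab ((Matrix.hasSum_exp_apply M a b).unique ?_)
  convert hasSum_zero with n
  by_contra h1
  exact h0 n ((h.pow n) a b (right_ne_zero_of_mul h1))

end IsHomog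
end Weave

namespace Weave

/-! ## Commutators in a ring -/

section Bracket

variable {S : Type*} [Ring S] (a b c : S)

theorem bracket_self : ⁅a, a⁆ = 0 := by rw [Ring.lie_def, sub_self]

theorem bracket_swap : ⁅a, b⁆ = -⁅b, a⁆ := by rw [Ring.lie_def, Ring.lie_def, neg_sub]

theorem bracket_neg : ⁅a, -b⁆ = -⁅a, b⁆ := by rw [Ring.lie_def, Ring.lie_def]; noncomm_ring

theorem neg_bracket : ⁅-a, b⁆ = -⁅a, b⁆ := by rw [Ring.lie_def, Ring.lie_def]; noncomm_ring

theorem bracket_zero : ⁅a, (0 : S)⁆ = 0 := by rw [Ring.lie_def]; simp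

theorem zero_bracket : ⁅(0 : S), a⁆ = 0 := by rw [Ring.lie_def]; simp

theorem bracket_add : ⁅a, b + c⁆ = ⁅a, b⁆ + ⁅a, c⁆ := by
  simp only [Ring.lie_def]; noncomm_ring

theorem add_bracket : ⁅a + b, c⁆ = ⁅a, c⁆ + ⁅b, c⁆ := by
  simp only [Ring.lie_def]; noncomm_ring

theorem bracket_smul [Algebra ℂ S] (t : ℂ) : ⁅a, t • b⁆ = t • ⁅a, b⁆ := by
  rw [Ring.lie_def, Ring.lie_def, mul_smul_comm, smul_mul_assoc, smul_sub]

theorem smul_bracket [Algebra ℂ S] (t : ℂ) : ⁅t • a, b⁆ = t • ⁅a, b⁆ := by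
  rw [Ring.lie_def, Ring.lie_def, mul_smul_comm, smul_mul_assoc, smul_sub]

theorem bracket_bracket : ⁅a, ⁅b, c⁆⁆ = ⁅⁅a, b⁆, c⁆ + ⁅b, ⁅a, c⁆⁆ := by
  simp only [Ring.lie_def]; noncomm_ring

end Bracket

/-! ## The adjoint action -/

/-- Conjugation by `g`. -/
def Ad {d : ℕ} (g : GL (Fin d) ℂ) : Matrix (Fin d) (Fin d) ℂ →ₐ[ℂ] Matrix (Fin d) (Fin d) ℂ where
  toFun M := g * M * ((g⁻¹ : GL (Fin d) ℂ) : Matrix (Fin d) (Fin d) ℂ)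
  map_one' := by simp
  map_zero' := by simp
  map_mul' M N := by simp [mul_assoc]
  map_add' M N := by rw [mul_add, add_mul]
  commutes' c := by
    rw [Algebra.algebraMap_eq_smul_one]
    simp [-coe_units_inv]

section Ad

variable {d : ℕ} (g g' : GL (Fin d) ℂ) (M N : Matrix (Fin d) (Fin d) ℂ)

theorem Ad_apply : Ad g M = g * M * ((g⁻¹ : GL (Fin d) ℂ) : Matrix (Fin d) (Fin d) ℂ) := rfl

theorem Ad_mul : Ad (g * g') M = Ad g (Ad g' M) := by
  simp only [Ad_apply, _root_.mul_inv_rev, Units.val_mul, mul_assoc]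

theorem Ad_one : Ad (1 : GL (Fin d) ℂ) M = M := by simp [Ad_apply]

theorem Ad_lie : Ad g ⁅M, N⁆ = ⁅Ad g M, Ad g N⁆ := by
  simp only [Ring.lie_def, map_sub, map_mul]

theorem Ad_inv_Ad : Ad g⁻¹ (Ad g M) = M := by rw [← Ad_mul, inv_mul_cancel, Ad_one]

variable {g M N} in
theorem Ad_eq_iff : Ad g M = N ↔ (g : Matrix (Fin d) (Fin d) ℂ) * M = N * g := by
  rw [Ad_apply]
  constructor
  · rintro rfl
    simp only [mul_assoc, ← Units.val_mul, inv_mul_cancel, Units.val_one, mul_one]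
  · intro h
    rw [h]
    simp only [mul_assoc, ← Units.val_mul, mul_inv_cancel, Units.val_one, mul_one]

theorem conj_expUnit : g * expUnit M * g⁻¹ = expUnit (Ad g M) := by
  ext1
  exact (Matrix.exp_units_conj g M).symm

theorem Ad_expUnit_smul (n : ℕ) (h : (fun N => ⁅M, N⁆)^[n] N = 0) (t : ℂ) :
    Ad (expUnit (t • M)) N = ∑ k ∈ Finset.range n,
      (t ^ k * (k.factorial : ℂ)⁻¹) • (fun N => ⁅M, N⁆)^[k] N :=
  Ad_eq_iff.mpr (Matrix.exp_smul_mul_eq_sum M N n h t)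

variable {M N} in
theorem expUnit_add (h : Commute M N) : expUnit (M + N) = expUnit M * expUnit N := by
  ext1
  exact Matrix.exp_add_of_commute M N h

theorem expUnit_zero : expUnit (0 : Matrix (Fin d) (Fin d) ℂ) = 1 := by
  ext1
  exact NormedSpace.exp_zero

theorem expUnit_neg : expUnit (-M) = (expUnit M)⁻¹ := by
  rw [eq_inv_iff_mul_eq_one, ← expUnit_add (Commute.refl M).neg_left, neg_add_cancel, expUnit_zero]

theorem expUnit_add_smul (s t : ℂ) : expUnit ((s + t) • M) = expUnit (s • M) * expUnit (t • M) := by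
  rw [add_smul, expUnit_add]
  exact ((Commute.refl M).smul_left s).smul_right t

end Ad

namespace ChevalleyRep

variable {r d : ℕ} {A : Matrix (Fin r) (Fin r) ℤ} (R : ChevalleyRep A d)

/-- The opposite representation, twisted by the Chevalley involution. -/
def op : ChevalleyRep A d where
  wt k i := -R.wt k i
  e := R.f
  f := R.e
  comm_ef i j := by
    rw [bracket_swap, R.comm_ef j i]
    by_cases h : i = j
    · subst h
      ext a b
      by_cases hab : a = b
      · subst hab; simp
      · simp [hab]
    · simp [h, Ne.symm h]
  comm_he i j := by
    have := R.comm_hf i j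
    have e : diagonal (fun k => ((-R.wt k i : ℤ) : ℂ)) = -diagonal (fun k => (R.wt k i : ℂ)) := by
      rw [diagonal_neg]; congr 1; ext a; simp
    rw [e, neg_bracket, this]; simp
  comm_hf i j := by
    have := R.comm_he i j
    have e : diagonal (fun k => ((-R.wt k i : ℤ) : ℂ)) = -diagonal (fun k => (R.wt k i : ℂ)) := by
      rw [diagonal_neg]; congr 1; ext a; simp
    rw [e, neg_bracket, this]; simp
  serre_e := R.serre_f
  serre_f := R.serre_e
  span_wt := by
    rw [eq_top_iff, ← R.span_wt, AddSubgroup.closure_le]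
    rintro _ ⟨k, rfl⟩
    have : (fun i => -R.wt k i) ∈ AddSubgroup.closure (Set.range fun k i => -R.wt k i) :=
      AddSubgroup.subset_closure ⟨k, rfl⟩
    have h := neg_mem this
    have e : (-fun i => -R.wt k i) = R.wt k := by ext i; simp
    rwa [e] at h

/-- The pairing of the weights with the cocharacter `lam`. -/
def deg (lam : Fin r → ℤ) (a : Fin d) : ℤ := ∑ k, lam k * R.wt a k

/-- The pairing of the simple root `α_j` with the cocharacter `lam`. -/
def _root_.Weave.alpha (A : Matrix (Fin r) (Fin r) ℤ) (j : Fin r) (lam : Fin r → ℤ) : ℤ :=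
  ∑ k, lam k * A k j

theorem _root_.Weave.simpleRefl_apply (i : Fin r) (lam : Fin r → ℤ) :
    simpleRefl A i lam = lam - alpha A i lam • Pi.single i 1 := rfl

theorem _root_.Weave.alpha_add (j : Fin r) (x y : Fin r → ℤ) :
    alpha A j (x + y) = alpha A j x + alpha A j y := by
  simp [alpha, add_mul, Finset.sum_add_distrib]

theorem _root_.Weave.alpha_smul (j : Fin r) (c : ℤ) (x : Fin r → ℤ) :
    alpha A j (c • x) = c * alpha A j x := by
  simp [alpha, Finset.mul_sum, mul_assoc]

theorem _root_.Weave.alpha_sub (j : Fin r) (x y : Fin r → ℤ) :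
    alpha A j (x - y) = alpha A j x - alpha A j y := by
  simp [alpha, sub_mul, Finset.sum_sub_distrib]

theorem _root_.Weave.alpha_single (i j : Fin r) : alpha A j (Pi.single i 1) = A i j := by
  simp [alpha, Pi.single_apply]

theorem deg_add (x y : Fin r → ℤ) (a : Fin d) : R.deg (x + y) a = R.deg x a + R.deg y a := by
  simp [deg, add_mul, Finset.sum_add_distrib]

theorem deg_smul (c : ℤ) (x : Fin r → ℤ) (a : Fin d) : R.deg (c • x) a = c * R.deg x a := by
  simp [deg, Finset.mul_sum, mul_assoc]

theorem deg_sub (x y : Fin r → ℤ) (a : Fin d) : R.deg (x - y) a = R.deg x a - R.deg y a := by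
  simp [deg, sub_mul, Finset.sum_sub_distrib]

theorem deg_single (i : Fin r) (a : Fin d) : R.deg (Pi.single i 1) a = R.wt a i := by
  simp [deg, Pi.single_apply]

theorem op_deg (lam : Fin r → ℤ) (a : Fin d) : R.op.deg lam a = -R.deg lam a := by
  simp [deg, op]

/-- The cocharacter `lam` of the Cartan subalgebra. -/
def hx (lam : Fin r → ℤ) : Matrix (Fin d) (Fin d) ℂ := diagonal fun a => (R.deg lam a : ℂ)

theorem op_hx (lam : Fin r → ℤ) : R.op.hx lam = -R.hx lam := by
  rw [hx, hx, diagonal_neg]; congr 1; ext a; simp [op_deg]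

theorem hx_sub (x y : Fin r → ℤ) : R.hx (x - y) = R.hx x - R.hx y := by
  rw [hx, hx, hx, diagonal_sub]; simp [deg_sub]

theorem hx_smul (c : ℤ) (x : Fin r → ℤ) : R.hx (c • x) = (c : ℂ) • R.hx x := by
  rw [hx, hx, ← diagonal_smul]; congr 1; ext a; rw [deg_smul]; simp

/-- The (a, b) entry of the commutator with a diagonal matrix is the difference of the diagonal
entries times the entry of M. Degrees are thus eigenvalues of ad, and can be carried along by
conjugation. -/
theorem isHomog_iff {lam : Fin r → ℤ} {c : ℤ} {M : Matrix (Fin d) (Fin d) ℂ} :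
    IsHomog (R.deg lam) c M ↔ ⁅R.hx lam, M⁆ = (c : ℂ) • M := by
  have key : ∀ a b, ⁅R.hx lam, M⁆ a b = ((R.deg lam a : ℂ) - R.deg lam b) * M a b := by
    intro a b
    simp [Ring.lie_def, hx]; ring
  constructor
  · intro h
    ext a b
    rw [key]
    by_cases h0 : M a b = 0
    · simp [h0]
    · rw [h a b h0]; simp
  · intro h a b h0
    have := congrFun (congrFun h a) b
    rw [key, Matrix.smul_apply, smul_eq_mul] at this
    have := mul_right_cancel₀ h0 this
    have h2 : ((R.deg lam a : ℂ)) = ((R.deg lam b + c : ℤ) : ℂ) := by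
      push_cast; linear_combination this
    exact_mod_cast h2

theorem isHomog_e (lam : Fin r → ℤ) (j : Fin r) : IsHomog (R.deg lam) (alpha A j lam) (R.e j) := by
  have key : ∀ i a b, R.e j a b ≠ 0 → R.wt a i = R.wt b i + A i j := by
    intro i a b hab
    have h : IsHomog (R.deg (Pi.single i 1)) (A i j) (R.e j) := by
      rw [isHomog_iff, ← R.comm_he i j]
      simp [hx, deg_single]
    simpa [deg_single] using h a b hab
  intro a b hab
  simp only [deg, alpha, ← Finset.sum_add_distrib, ← mul_add]
  exact Finset.sum_congr rfl fun i _ => by rw [key i a b hab]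

theorem lie_hx_e (lam : Fin r → ℤ) (j : Fin r) :
    ⁅R.hx lam, R.e j⁆ = (alpha A j lam : ℂ) • R.e j :=
  R.isHomog_iff.mp (R.isHomog_e lam j)

theorem lie_e_f_self (i : Fin r) : ⁅R.e i, R.f i⁆ = R.hx (Pi.single i 1) := by
  rw [R.comm_ef i i, if_pos rfl]; simp [hx, deg_single]

theorem lie_e_f_of_ne {i j : Fin r} (h : i ≠ j) : ⁅R.e i, R.f j⁆ = 0 := by
  rw [R.comm_ef i j, if_neg h]

/-! ### One-parameter subgroups, at the level of matrices -/

/-- The matrix of `x_i(t)`. -/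
def xx (i : Fin r) (t : ℂ) : GL (Fin d) ℂ := expUnit (t • R.e i)

/-- The matrix of `y_i(t)`. -/
def yy (i : Fin r) (t : ℂ) : GL (Fin d) ℂ := expUnit (t • R.f i)

/-- The matrix of `ṡ_i`. -/
def ss (i : Fin r) : GL (Fin d) ℂ := R.xx i (-1) * R.yy i 1 * R.xx i (-1)

/-- Since `R.op` exchanges x_i and y_i by definition, each statement about x_i and U_+ yields its
mirror image for y_i and U_- without a second proof. -/
theorem op_xx (i : Fin r) (t : ℂ) : R.op.xx i t = R.yy i t := rfl

theorem op_yy (i : Fin r) (t : ℂ) : R.op.yy i t = R.xx i t := rfl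

theorem xx_add (i : Fin r) (s t : ℂ) : R.xx i (s + t) = R.xx i s * R.xx i t :=
  expUnit_add_smul _ s t

theorem xx_zero (i : Fin r) : R.xx i 0 = 1 := by rw [xx, zero_smul, expUnit_zero]

theorem xx_neg (i : Fin r) (t : ℂ) : R.xx i (-t) = (R.xx i t)⁻¹ := by
  rw [xx, neg_smul, expUnit_neg]; rfl

theorem yy_neg (i : Fin r) (t : ℂ) : R.yy i (-t) = (R.yy i t)⁻¹ := R.op.xx_neg i t

theorem commute_xx_yy {i j : Fin r} (h : i ≠ j) (s t : ℂ) : Commute (R.xx i s) (R.yy j t) := by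
  have h0 : Commute (R.e i) (R.f j) := sub_eq_zero.mp (R.lie_e_f_of_ne h)
  have h1 : Commute (s • R.e i) (t • R.f j) := (h0.smul_left s).smul_right t
  change _ * _ = _ * _
  rw [xx, yy, ← expUnit_add h1, add_comm, expUnit_add h1.symm]

theorem Ad_xx_e (i : Fin r) (t : ℂ) : Ad (R.xx i t) (R.e i) = R.e i := by
  rw [xx, Ad_expUnit_smul _ _ 1 (by simp [bracket_self])]; simp

theorem Ad_xx_hx (i : Fin r) (t : ℂ) (lam : Fin r → ℤ) :
    Ad (R.xx i t) (R.hx lam) = R.hx lam - (t * alpha A i lam) • R.e i := by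
  have h : ⁅R.e i, R.hx lam⁆ = -((alpha A i lam : ℂ) • R.e i) := by
    rw [bracket_swap, R.lie_hx_e]
  rw [xx, Ad_expUnit_smul _ _ 2 (by simp [h, bracket_neg, bracket_smul, bracket_self])]
  simp [Finset.sum_range_succ, h, mul_smul, sub_eq_add_neg]

theorem Ad_xx_f (i : Fin r) (hA : A i i = 2) (t : ℂ) :
    Ad (R.xx i t) (R.f i) = R.f i + t • R.hx (Pi.single i 1) - (t * t) • R.e i := by
  have h : ⁅R.e i, R.hx (Pi.single i 1)⁆ = -((2 : ℂ) • R.e i) := by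
    rw [bracket_swap, R.lie_hx_e, alpha_single, hA]; simp
  rw [xx, Ad_expUnit_smul _ _ 3 (by simp [h, R.lie_e_f_self, bracket_neg, bracket_smul, bracket_self])]
  simp [Finset.sum_range_succ, h, R.lie_e_f_self, smul_smul, sub_eq_add_neg, pow_two]

theorem Ad_xx_f_of_ne {i j : Fin r} (h : i ≠ j) (t : ℂ) : Ad (R.xx i t) (R.f j) = R.f j := by
  rw [xx, Ad_expUnit_smul _ _ 1 (by simp [R.lie_e_f_of_ne h])]; simp

theorem Ad_yy_f (i : Fin r) (t : ℂ) : Ad (R.yy i t) (R.f i) = R.f i := R.op.Ad_xx_e i t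

theorem Ad_yy_hx (i : Fin r) (t : ℂ) (lam : Fin r → ℤ) :
    Ad (R.yy i t) (R.hx lam) = R.hx lam + (t * alpha A i lam) • R.f i := by
  have h := R.op.Ad_xx_hx i t lam
  rw [op_hx, map_neg, op_xx] at h
  rw [← neg_inj, h, neg_add, sub_eq_add_neg]; rfl

theorem Ad_yy_e (i : Fin r) (hA : A i i = 2) (t : ℂ) :
    Ad (R.yy i t) (R.e i) = R.e i - t • R.hx (Pi.single i 1) - (t * t) • R.f i := by
  have h := R.op.Ad_xx_f i hA t
  rw [op_hx, smul_neg, ← sub_eq_add_neg] at h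
  exact h

theorem Ad_ss_hx (i : Fin r) (hA : A i i = 2) (lam : Fin r → ℤ) :
    Ad (R.ss i) (R.hx lam) = R.hx (simpleRefl A i lam) := by
  rw [simpleRefl_apply, hx_sub, hx_smul, ss, Ad_mul, Ad_mul, Ad_xx_hx, map_sub, map_smul, Ad_yy_hx,
    Ad_yy_e _ _ hA, map_sub, map_add, map_smul, map_smul, map_sub, map_sub, map_smul, map_smul,
    Ad_xx_hx, Ad_xx_hx, Ad_xx_f _ _ hA, Ad_xx_e, alpha_single, hA]
  push_cast
  module

theorem Ad_ss_e (i : Fin r) (hA : A i i = 2) : Ad (R.ss i) (R.e i) = -R.f i := by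
  rw [ss, Ad_mul, Ad_mul, Ad_xx_e, Ad_yy_e _ _ hA, map_sub, map_sub, map_smul, map_smul,
    Ad_xx_hx, Ad_xx_f _ _ hA, Ad_xx_e, alpha_single, hA]
  push_cast
  module

theorem Ad_ss_f (i : Fin r) (hA : A i i = 2) : Ad (R.ss i) (R.f i) = -R.e i := by
  rw [ss, Ad_mul, Ad_mul, Ad_xx_f _ _ hA, map_sub, map_add, map_smul, map_smul, Ad_yy_f,
    Ad_yy_hx, Ad_yy_e _ _ hA]
  simp only [map_sub, map_add, map_smul, Ad_xx_hx, Ad_xx_f _ _ hA, Ad_xx_e, alpha_single, hA]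
  push_cast
  module

theorem ss_conj_xx (i : Fin r) (hA : A i i = 2) (t : ℂ) :
    R.ss i * R.xx i t * (R.ss i)⁻¹ = R.yy i (-t) := by
  rw [xx, conj_expUnit, map_smul, R.Ad_ss_e i hA, smul_neg, ← neg_smul, yy]

theorem ss_conj_yy (i : Fin r) (hA : A i i = 2) (t : ℂ) :
    R.ss i * R.yy i t * (R.ss i)⁻¹ = R.xx i (-t) := by
  rw [yy, conj_expUnit, map_smul, R.Ad_ss_f i hA, smul_neg, ← neg_smul, xx]

/-- A rewriting of ṡ_i x_i(1) ṡ_i⁻¹ = y_i(-1). It lets ṡ_i be computed from either side and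
identifies the lift for `R.op` as the inverse of ṡ_i. -/
theorem ss_eq_yy_xx_yy (i : Fin r) (hA : A i i = 2) :
    R.ss i = R.yy i 1 * R.xx i (-1) * R.yy i 1 := by
  have h := R.ss_conj_xx i hA 1
  rw [mul_inv_eq_iff_eq_mul, yy_neg, eq_inv_mul_iff_mul_eq] at h
  have h1 : R.ss i * R.xx i 1 = R.xx i (-1) * R.yy i 1 := by
    rw [ss, mul_assoc, ← xx_add, neg_add_cancel, xx_zero, mul_one]
  rw [← h, h1, mul_assoc]

theorem op_ss (i : Fin r) (hA : A i i = 2) : R.op.ss i = (R.ss i)⁻¹ := by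
  rw [R.ss_eq_yy_xx_yy i hA, ss, _root_.mul_inv_rev, _root_.mul_inv_rev, op_xx, op_yy, ← yy_neg, ← xx_neg,
    _root_.neg_neg, mul_assoc]

/-! ### The torus -/

/-- The value at `t` of the cocharacter `lam`, as a matrix. -/
def tor (lam : Fin r → ℤ) (t : ℂˣ) : GL (Fin d) ℂ where
  val := diagonal fun a => ((t ^ R.deg lam a : ℂˣ) : ℂ)
  inv := diagonal fun a => ((t ^ (-R.deg lam a) : ℂˣ) : ℂ)
  val_inv := by
    rw [diagonal_mul_diagonal, ← diagonal_one]
    congr 1; ext a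
    rw [← Units.val_mul, ← _root_.zpow_add, add_neg_cancel, zpow_zero]; rfl
  inv_val := by
    rw [diagonal_mul_diagonal, ← diagonal_one]
    congr 1; ext a
    rw [← Units.val_mul, ← _root_.zpow_add, neg_add_cancel, zpow_zero]; rfl

theorem tor_val (lam : Fin r → ℤ) (t : ℂˣ) : (R.tor lam t : Matrix (Fin d) (Fin d) ℂ) =
    diagonal fun a => ((t ^ R.deg lam a : ℂˣ) : ℂ) := rfl

theorem tor_mul (lam : Fin r → ℤ) (s t : ℂˣ) : R.tor lam (s * t) = R.tor lam s * R.tor lam t := by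
  ext1
  simp [tor_val, mul_zpow]

theorem tor_add (lam mu : Fin r → ℤ) (t : ℂˣ) : R.tor (lam + mu) t = R.tor lam t * R.tor mu t := by
  ext1
  simp only [tor_val, Units.val_mul, diagonal_mul_diagonal, deg_add, _root_.zpow_add]

theorem tor_one (lam : Fin r → ℤ) : R.tor lam 1 = 1 := by
  ext1; simp [tor_val]

theorem tor_zero (t : ℂˣ) : R.tor 0 t = 1 := by
  ext1; simp [tor_val, deg]

theorem tor_smul (c : ℤ) (lam : Fin r → ℤ) (t : ℂˣ) : R.tor (c • lam) t = R.tor lam (t ^ c) := by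
  ext1; simp only [tor_val, deg_smul, _root_.zpow_mul]

theorem Ad_tor {lam : Fin r → ℤ} {c : ℤ} {M : Matrix (Fin d) (Fin d) ℂ}
    (h : IsHomog (R.deg lam) c M) (t : ℂˣ) : Ad (R.tor lam t) M = ((t ^ c : ℂˣ) : ℂ) • M := by
  rw [Ad_eq_iff]
  ext a b
  rw [smul_mul_assoc, Matrix.smul_apply, tor_val, diagonal_mul, mul_diagonal]
  by_cases h0 : M a b = 0
  · simp [h0]
  · rw [h a b h0, _root_.zpow_add, Units.val_mul, smul_eq_mul]; ring

theorem tor_conj_xx (lam : Fin r → ℤ) (t : ℂˣ) (j : Fin r) (s : ℂ) :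
    R.tor lam t * R.xx j s * (R.tor lam t)⁻¹ = R.xx j ((t ^ alpha A j lam : ℂˣ) * s) := by
  rw [xx, conj_expUnit, map_smul, R.Ad_tor (R.isHomog_e lam j), smul_smul, mul_comm, xx]

theorem deg_of_ss_apply_ne_zero (i : Fin r) (hA : A i i = 2) {a b : Fin d}
    (h : (R.ss i : Matrix (Fin d) (Fin d) ℂ) a b ≠ 0) (lam : Fin r → ℤ) :
    R.deg (simpleRefl A i lam) a = R.deg lam b := by
  have h1 := Ad_eq_iff.mp (R.Ad_ss_hx i hA lam)
  have h2 := congrFun (congrFun h1 a) b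
  rw [hx, hx, diagonal_mul, mul_diagonal, mul_comm] at h2
  exact_mod_cast (mul_right_cancel₀ h h2).symm

theorem ss_conj_tor (i : Fin r) (hA : A i i = 2) (lam : Fin r → ℤ) (t : ℂˣ) :
    R.ss i * R.tor lam t * (R.ss i)⁻¹ = R.tor (simpleRefl A i lam) t := by
  rw [mul_inv_eq_iff_eq_mul]
  ext a b
  rw [Units.val_mul, Units.val_mul, tor_val, tor_val, diagonal_mul, mul_diagonal, mul_comm]
  by_cases h0 : (R.ss i : Matrix (Fin d) (Fin d) ℂ) a b = 0
  · simp [h0]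
  · rw [R.deg_of_ss_apply_ne_zero i hA h0]

-- Both sides, multiplied by ṡ_i⁻¹ on the right, satisfy the linear equation t F' = hF on ℂ^×, where
-- h is the coroot, and they agree at t = 1. As h is diagonal with integer entries, the solutions
-- are given row by row by powers of t.
open scoped Matrix.Norms.Operator in
theorem xx_yy_xx (i : Fin r) (hA : A i i = 2) (t : ℂˣ) :
    R.xx i t * R.yy i (-((t⁻¹ : ℂˣ) : ℂ)) * R.xx i t * R.ss i = R.tor (Pi.single i 1) t := by
  set F : ℂ → Matrix (Fin d) (Fin d) ℂ := fun t =>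
    NormedSpace.exp (t • R.e i) * NormedSpace.exp ((-t⁻¹) • R.f i) * NormedSpace.exp (t • R.e i)
    with hF
  have hderiv : ∀ t : ℂ, t ≠ 0 → HasDerivAt F (t⁻¹ • (R.hx (Pi.single i 1) * F t)) t := by
    intro t ht
    have h1 := hasDerivAt_exp_smul_const' (𝕂 := ℂ) (R.e i) t
    have h2' := hasDerivAt_exp_smul_const' (𝕂 := ℂ) (R.f i) (-t⁻¹)
    have h2'' : HasDerivAt (fun t : ℂ => -t⁻¹) ((t ^ 2)⁻¹) t := by
      simpa using (hasDerivAt_inv ht).fun_neg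
    have h2 := HasDerivAt.scomp (h := fun t : ℂ => -t⁻¹) t h2' h2''
    refine ((h1.fun_mul h2).fun_mul h1).congr_deriv ?_
    have e1 := Ad_eq_iff.mp (R.Ad_xx_f i hA t)
    -- The derivatives of the three factors are moved to the far left by conjugation. This one, from
    -- the last factor, cancels the f_i produced by the middle factor.
    have e2 : Ad (R.xx i t * R.yy i (-t⁻¹)) (R.e i) = -((t ^ 2)⁻¹ • R.f i) := by
      rw [Ad_mul, R.Ad_yy_e i hA, map_sub, map_sub, map_smul, map_smul, R.Ad_xx_e, R.Ad_xx_hx,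
        R.Ad_xx_f i hA, alpha_single, hA]
      push_cast
      match_scalars <;> field_simp <;> ring
    have e2 := Ad_eq_iff.mp e2
    set X : Matrix (Fin d) (Fin d) ℂ := NormedSpace.exp (t • R.e i) with hX
    set Y : Matrix (Fin d) (Fin d) ℂ := NormedSpace.exp ((-t⁻¹) • R.f i) with hY
    replace e1 : X * R.f i = (R.f i + t • R.hx (Pi.single i 1) - (t * t) • R.e i) * X := e1
    replace e2 : X * Y * R.e i = -((t ^ 2)⁻¹ • R.f i) * (X * Y) := e2
    have e3 : X * Y * (R.e i * X) = -((t ^ 2)⁻¹ • R.f i) * (X * Y * X) := by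
      rw [← mul_assoc, e2, mul_assoc]
    have e4 : X * ((t ^ 2)⁻¹ • (R.f i * Y)) =
        (t ^ 2)⁻¹ • ((R.f i + t • R.hx (Pi.single i 1) - (t * t) • R.e i) * (X * Y)) := by
      rw [mul_smul_comm, ← mul_assoc, e1, mul_assoc]
    change (R.e i * X * Y + X * ((t ^ 2)⁻¹ • (R.f i * Y))) * X + X * Y * (R.e i * X) = _
    rw [e3, e4, hF]
    change _ = t⁻¹ • (R.hx (Pi.single i 1) * (X * Y * X))
    have e5 : (R.e i * X * Y + (t ^ 2)⁻¹ • ((R.f i + t • R.hx (Pi.single i 1) - (t * t) • R.e i) * (X * Y))) * X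
      + -((t ^ 2)⁻¹ • R.f i) * (X * Y * X) = (R.e i + (t ^ 2)⁻¹ • (R.f i + t • R.hx (Pi.single i 1) - (t * t) • R.e i) - (t ^ 2)⁻¹ • R.f i) * (X * Y * X) := by
      rw [← smul_mul_assoc]
      noncomm_ring
    rw [e5, ← smul_mul_assoc]
    congr 1
    match_scalars <;> field_simp <;> ring
  -- Dividing row a by the power of t given by its weight leaves a function with zero derivative on
  -- the punctured plane, which is connected.
  have hconst : ∀ t : ℂ, t ≠ 0 → ∀ a b, t ^ (-R.deg (Pi.single i 1) a) * F t a b = F 1 a b := by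
    intro t ht a b
    have hent : ∀ s : ℂ, s ≠ 0 → HasDerivAt (fun s => F s a b)
        (s⁻¹ * (R.deg (Pi.single i 1) a * F s a b)) s := by
      intro s hs
      have := ((Matrix.entryLinearMap ℂ ℂ a b).toContinuousLinearMap.hasFDerivAt
        (x := F s)).comp_hasDerivAt s (hderiv s hs)
      refine this.congr_deriv ?_
      change (s⁻¹ • (R.hx (Pi.single i 1) * F s)) a b = _
      rw [Matrix.smul_apply, hx, diagonal_mul, smul_eq_mul]
    have hd : ∀ s ∈ ({0}ᶜ : Set ℂ), HasDerivAt
        (fun s => s ^ (-R.deg (Pi.single i 1) a) * F s a b) 0 s := by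
      intro s hs
      have h1 := hasDerivAt_zpow (-R.deg (Pi.single i 1) a) s (Or.inl hs)
      refine (h1.fun_mul (hent s hs)).congr_deriv ?_
      have hs' : s ≠ 0 := hs
      rw [zpow_sub_one₀ hs']
      push_cast
      ring
    have := IsOpen.is_const_of_deriv_eq_zero (𝕜 := ℂ) (s := ({0}ᶜ : Set ℂ))
      isOpen_compl_singleton
      (isConnected_compl_singleton_of_one_lt_rank
        (by rw [Complex.rank_real_complex]; norm_num) (0 : ℂ)).isPreconnected
      (fun s hs => (hd s hs).differentiableAt.differentiableWithinAt)
      (fun s hs => (hd s hs).deriv) (x := t) (y := 1) ht one_ne_zero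
    simpa using this
  have hF1 : ∀ t : ℂˣ, ((R.xx i t * R.yy i (-((t⁻¹ : ℂˣ) : ℂ)) * R.xx i t : GL (Fin d) ℂ) :
      Matrix (Fin d) (Fin d) ℂ) = F t := by
    intro t
    rw [hF]
    simp [xx, yy, expUnit]
  have hs : (R.ss i)⁻¹ = R.xx i (1 : ℂˣ) * R.yy i (-((1⁻¹ : ℂˣ) : ℂ)) * R.xx i (1 : ℂˣ) := by
    rw [ss, _root_.mul_inv_rev, _root_.mul_inv_rev, ← xx_neg, ← yy_neg]
    simp [mul_assoc]
  rw [← eq_mul_inv_iff_mul_eq, hs]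
  ext a b
  rw [hF1, Units.val_mul, hF1, tor_val, diagonal_mul, Units.val_one, ← hconst t t.ne_zero a b]
  rw [← mul_assoc]
  push_cast
  rw [← zpow_add₀ t.ne_zero, add_neg_cancel, zpow_zero, one_mul]

end ChevalleyRep
end Weave

namespace Weave

/-! ## The invariant form and finite type -/

namespace ChevalleyRep

variable {r d : ℕ} {A : Matrix (Fin r) (Fin r) ℤ} (R : ChevalleyRep A d)

/-- This is where the weights spanning the whole weight lattice (simple connectedness) enter: the
dual lattice then acts faithfully. It makes the trace form definite and lets Weyl group elements be
read off from matrices. -/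
theorem eq_zero_of_deg_eq_zero {x : Fin r → ℤ} (h : ∀ a, R.deg x a = 0) : x = 0 := by
  let F : (Fin r → ℤ) →+ ℤ :=
    { toFun := fun mu => ∑ k, x k * mu k
      map_zero' := by simp
      map_add' := fun a b => by simp [mul_add, Finset.sum_add_distrib] }
  have hF : F = 0 := by
    refine AddMonoidHom.eq_of_eqOn_dense R.span_wt ?_
    rintro _ ⟨a, rfl⟩
    exact h a
  ext k
  have := DFunLike.congr_fun hF (Pi.single k 1)
  simpa [F, Pi.single_apply] using this

theorem deg_injective {x y : Fin r → ℤ} (h : ∀ a, R.deg x a = R.deg y a) : x = y :=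
  sub_eq_zero.mp (R.eq_zero_of_deg_eq_zero fun a => by rw [deg_sub, h, sub_self])

theorem hx_injective {x y : Fin r → ℤ} (h : R.hx x = R.hx y) : x = y :=
  R.deg_injective fun a => by
    have := congrFun (diagonal_injective h) a
    exact_mod_cast this

/-- The trace form on cocharacters. -/
def form (x y : Fin r → ℤ) : ℤ := ∑ a, R.deg x a * R.deg y a

theorem form_comm (x y : Fin r → ℤ) : R.form x y = R.form y x := by simp [form, mul_comm]

theorem form_add (x y z : Fin r → ℤ) : R.form x (y + z) = R.form x y + R.form x z := by
  simp [form, deg_add, mul_add, Finset.sum_add_distrib]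

theorem form_smul (c : ℤ) (x y : Fin r → ℤ) : R.form x (c • y) = c * R.form x y := by
  simp only [form, deg_smul, Finset.mul_sum]
  exact Finset.sum_congr rfl fun a _ => by ring

theorem form_pos {x : Fin r → ℤ} (h : x ≠ 0) : 0 < R.form x x := by
  obtain ⟨a, ha⟩ : ∃ a, R.deg x a ≠ 0 := by
    by_contra! h0
    exact h (R.eq_zero_of_deg_eq_zero h0)
  exact Finset.sum_pos' (fun a _ => mul_self_nonneg _) ⟨a, Finset.mem_univ _, mul_self_pos.mpr ha⟩

theorem trace_Ad (g : GL (Fin d) ℂ) (M : Matrix (Fin d) (Fin d) ℂ) : (Ad g M).trace = M.trace := by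
  rw [Ad_apply, Matrix.trace_mul_comm, ← mul_assoc, ← Units.val_mul, inv_mul_cancel, Units.val_one,
    one_mul]

theorem form_eq_trace (x y : Fin r → ℤ) : (R.form x y : ℂ) = (R.hx x * R.hx y).trace := by
  simp [form, hx, Matrix.trace]

/-- The reflection is realized by conjugation with ṡ_i, which preserves traces. -/
theorem form_simpleRefl (i : Fin r) (hA : A i i = 2) (x y : Fin r → ℤ) :
    R.form (simpleRefl A i x) (simpleRefl A i y) = R.form x y := by
  have : (R.form (simpleRefl A i x) (simpleRefl A i y) : ℂ) = R.form x y := by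
    rw [form_eq_trace, form_eq_trace, ← R.Ad_ss_hx i hA, ← R.Ad_ss_hx i hA, ← map_mul, trace_Ad]
  exact_mod_cast this

/-- Invariance of the form under s_i, evaluated on χ_i and x, expresses the root α_i through the
pairing with its coroot. -/
theorem two_mul_form_single (i : Fin r) (hA : A i i = 2) (x : Fin r → ℤ) :
    2 * R.form (Pi.single i 1) x =
      R.form (Pi.single i 1) (Pi.single i 1) * alpha A i x := by
  have h := R.form_simpleRefl i hA (Pi.single i 1) x
  have e : simpleRefl A i (Pi.single i 1) = (-1 : ℤ) • Pi.single i 1 := by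
    rw [simpleRefl_apply, alpha_single, hA]; module
  have e2 : simpleRefl A i x = x + (-alpha A i x) • Pi.single i 1 := by
    rw [simpleRefl_apply]; module
  rw [e, R.form_comm, form_smul, R.form_comm, e2, form_add, form_smul] at h
  linear_combination -h

include R in
theorem eq_zero_of_alpha_eq_zero (hA : IsCartan A) {x : Fin r → ℤ} (h : ∀ i, alpha A i x = 0) :
    x = 0 := by
  by_contra hx
  have h1 : ∀ i, R.form x (Pi.single i 1) = 0 := fun i => by
    have := R.two_mul_form_single i (hA.diag i) x
    rw [h i, R.form_comm] at this
    omega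
  let F : (Fin r → ℤ) →ₗ[ℤ] ℤ :=
    { toFun := R.form x
      map_add' := R.form_add x
      map_smul' := fun c y => R.form_smul c x y }
  have hF : F = 0 := by
    refine LinearMap.pi_ext' fun i => LinearMap.ext_ring ?_
    exact h1 i
  have := R.form_pos hx
  have h2 : R.form x x = 0 := DFunLike.congr_fun hF x
  omega

include R in
theorem det_ne_zero (hA : IsCartan A) : A.det ≠ 0 := by
  intro h
  obtain ⟨v, hv, h0⟩ := Matrix.exists_vecMul_eq_zero_iff.mpr h
  exact hv (R.eq_zero_of_alpha_eq_zero hA fun i => congrFun h0 i)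

include R in
theorem cartan_mul_lt (hA : IsCartan A) {i j : Fin r} (hij : i ≠ j) : A i j * A j i < 4 := by
  have h1 := R.two_mul_form_single i (hA.diag i) (Pi.single j 1)
  have h2 := R.two_mul_form_single j (hA.diag j) (Pi.single i 1)
  rw [alpha_single] at h1 h2
  rw [R.form_comm] at h2
  have hi : 0 < R.form (Pi.single i 1) (Pi.single i 1) := R.form_pos (by simp)
  -- This vector is twice the component of χ_i orthogonal to χ_j; its square length is 4 - a_ij a_ji
  -- times that of χ_i.
  have hne : (2 : ℤ) • (Pi.single i 1 : Fin r → ℤ) + (-A i j) • Pi.single j 1 ≠ 0 := by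
    intro h
    have := congrFun h i
    simp [hij] at this
  have h3 := R.form_pos hne
  rw [form_add, form_smul, form_smul, R.form_comm _ (Pi.single i 1),
    R.form_comm _ (Pi.single j 1), form_add, form_smul, form_smul, form_add, form_smul, form_smul,
    R.form_comm (Pi.single j 1) (Pi.single i 1)] at h3
  generalize R.form (Pi.single i 1) (Pi.single i 1) = a at *
  generalize R.form (Pi.single j 1) (Pi.single j 1) = b at *
  generalize R.form (Pi.single i 1) (Pi.single j 1) = c at *
  by_contra! h4
  have e1 : A i j * (b * A i j) = A i j * (2 * c) := by rw [h2]
  have e2 : A i j * (2 * c) = a * (A i j * A j i) := by rw [h1]; ring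
  nlinarith [mul_le_mul_of_nonneg_left h4 hi.le]

/-- A positive multiple of the `k`-th fundamental coweight. -/
def _root_.Weave.coweight (A : Matrix (Fin r) (Fin r) ℤ) (k : Fin r) : Fin r → ℤ :=
  A.det • A.adjugate k

/-- The extra factor det A in `coweight` makes the value a square, hence positive whatever the sign
of the determinant. The grading by `rho` is then strictly positive on every simple root. -/
theorem _root_.Weave.alpha_coweight (j k : Fin r) :
    alpha A j (coweight A k) = if j = k then A.det ^ 2 else 0 := by
  have := congrFun (congrFun (Matrix.adjugate_mul A) k) j
  rw [Matrix.mul_apply] at this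
  rw [coweight, alpha_smul, alpha, this, Matrix.smul_apply, Matrix.one_apply]
  by_cases h : j = k
  · subst h; simp [pow_two]
  · simp [h, Ne.symm h]

/-- A multiple of the half-sum of the positive coroots. -/
def _root_.Weave.rho (A : Matrix (Fin r) (Fin r) ℤ) : Fin r → ℤ := ∑ k, coweight A k

theorem _root_.Weave.alpha_rho (j : Fin r) : alpha A j (rho A) = A.det ^ 2 := by
  have : alpha A j (rho A) = ∑ k, alpha A j (coweight A k) := by
    simp only [alpha, rho, Finset.sum_apply, Finset.sum_mul]
    exact Finset.sum_comm
  simp [this, alpha_coweight]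

include R in
theorem det_sq_pos (hA : IsCartan A) : 0 < A.det ^ 2 :=
  by have := R.det_ne_zero hA; positivity

end ChevalleyRep
end Weave

namespace Weave

/-! ## Rank two -/

section TwoStep

variable {S : Type*} [Ring S] [Algebra ℂ S]

/-- The model is x = e_i and v_k = (ad e_i)^k e_j with a_ji = -1, where ⁅v0, v1⁆ = 0 is a Serre
relation. All other relations follow by applying ad x and the Jacobi identity. -/
theorem string_bracket {x v0 v1 v2 v3 : S} (h1 : ⁅x, v0⁆ = v1) (h2 : ⁅x, v1⁆ = v2)
    (h3 : ⁅x, v2⁆ = v3) (h4 : ⁅x, v3⁆ = 0) (h01 : ⁅v0, v1⁆ = 0) :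
    ⁅v0, v2⁆ = 0 ∧ ⁅v0, v3⁆ = -⁅v1, v2⁆ ∧ ⁅v1, v3⁆ = 0 ∧ ⁅v2, v3⁆ = 0 := by
  have e1 : ⁅v0, v2⁆ = 0 := by
    have := bracket_bracket x v0 v1
    rwa [h01, bracket_zero, h1, h2, bracket_self, zero_add, eq_comm] at this
  have e2 : ⁅v1, v2⁆ + ⁅v0, v3⁆ = 0 := by
    have := bracket_bracket x v0 v2
    rwa [e1, bracket_zero, h1, h3, eq_comm] at this
  -- Applying ad x to ⁅v1, v2⁆ and to ⁅v0, v3⁆ gives ⁅v1, v3⁆ both times, while the sum of the two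
  -- brackets vanishes.
  have e3 : ⁅v1, v3⁆ = 0 := by
    have a1 := bracket_bracket x v1 v2
    have a2 := bracket_bracket x v0 v3
    rw [h2, h3, bracket_self, zero_add] at a1
    rw [h1, h4, bracket_zero, add_zero] at a2
    have a3 : ⁅v1, v3⁆ + ⁅v1, v3⁆ = 0 := by
      rw [← a1, ← add_zero ⁅x, ⁅v1, v2⁆⁆, a1, add_zero]
      nth_rw 2 [← a2]
      rw [← a1, ← bracket_add, e2, bracket_zero]
    have : (2 : ℂ) • ⁅v1, v3⁆ = 0 := by rw [two_smul, a3]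
    simpa using this
  have e4 : ⁅v2, v3⁆ = 0 := by
    have := bracket_bracket x v1 v3
    rwa [e3, bracket_zero, h2, h4, bracket_zero, add_zero, eq_comm] at this
  exact ⟨e1, by rw [eq_neg_iff_add_eq_zero, add_comm]; exact e2, e3, e4⟩

/-- Up to sign the only bracket that can survive is ⁅v 1, v 2⁆ = -⁅v 0, v 3⁆, and it commutes with
every v a. The exact two-term exponential formula then applies to the whole string, type G_2
included. -/
theorem string_two_step {x : S} (v : Fin 4 → S) (h1 : ⁅x, v 0⁆ = v 1) (h2 : ⁅x, v 1⁆ = v 2)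
    (h3 : ⁅x, v 2⁆ = v 3) (h4 : ⁅x, v 3⁆ = 0) (h01 : ⁅v 0, v 1⁆ = 0) (a b c : Fin 4) :
    ⁅v a, ⁅v b, v c⁆⁆ = 0 := by
  obtain ⟨h02, h03, h13, h23⟩ := string_bracket h1 h2 h3 h4 h01
  have z0 : ⁅v 0, ⁅v 1, v 2⁆⁆ = 0 := by
    rw [bracket_bracket, h01, h02, zero_bracket, bracket_zero, add_zero]
  have z1 : ⁅v 1, ⁅v 1, v 2⁆⁆ = 0 := by
    rw [← neg_inj, ← bracket_neg, ← h03, bracket_bracket, bracket_swap, bracket_swap (v 1), h01, h13]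
    simp [bracket_zero]
  have z2 : ⁅v 2, ⁅v 1, v 2⁆⁆ = 0 := by
    rw [← neg_inj, ← bracket_neg, ← h03, bracket_bracket, bracket_swap, bracket_swap (v 2), h02, h23]
    simp [bracket_zero]
  have z3 : ⁅v 3, ⁅v 1, v 2⁆⁆ = 0 := by
    rw [bracket_bracket, bracket_swap (v 3), bracket_swap (v 3), h13, h23]
    simp [bracket_zero, zero_bracket]
  have z : ∀ a, ⁅v a, ⁅v 1, v 2⁆⁆ = 0 := by
    intro a; fin_cases a
    exacts [z0, z1, z2, z3]
  have h10 : ⁅v 1, v 0⁆ = 0 := by rw [bracket_swap, h01, neg_zero]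
  have h20 : ⁅v 2, v 0⁆ = 0 := by rw [bracket_swap, h02, neg_zero]
  have h30 : ⁅v 3, v 0⁆ = ⁅v 1, v 2⁆ := by rw [bracket_swap, h03, neg_neg]
  have h21 : ⁅v 2, v 1⁆ = -⁅v 1, v 2⁆ := by rw [bracket_swap]
  have h31 : ⁅v 3, v 1⁆ = 0 := by rw [bracket_swap, h13, neg_zero]
  have h32 : ⁅v 3, v 2⁆ = 0 := by rw [bracket_swap, h23, neg_zero]
  fin_cases b <;> fin_cases c <;>
    simp [bracket_self, h01, h02, h03, h13, h23, h10, h20, h30, h21, h31, h32, bracket_zero,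
      bracket_neg, z]

theorem span_two_step {ι : Type*} (v : ι → S) (h : ∀ a b c, ⁅v a, ⁅v b, v c⁆⁆ = 0)
    {x y z : S} (hx : x ∈ Submodule.span ℂ (Set.range v)) (hy : y ∈ Submodule.span ℂ (Set.range v))
    (hz : z ∈ Submodule.span ℂ (Set.range v)) : ⁅x, ⁅y, z⁆⁆ = 0 := by
  induction hx using Submodule.span_induction with
  | zero => rw [zero_bracket]
  | add a b _ _ ha hb => rw [add_bracket, ha, hb, add_zero]
  | smul t a _ ha => rw [smul_bracket, ha, smul_zero]
  | mem x hx =>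
  obtain ⟨a, rfl⟩ := hx
  induction hy using Submodule.span_induction with
  | zero => rw [zero_bracket, bracket_zero]
  | add a b _ _ ha hb => rw [add_bracket, bracket_add, ha, hb, add_zero]
  | smul t a _ ha => rw [smul_bracket, bracket_smul, ha, smul_zero]
  | mem y hy =>
  obtain ⟨b, rfl⟩ := hy
  induction hz using Submodule.span_induction with
  | zero => rw [bracket_zero, bracket_zero]
  | add a b _ _ ha hb => rw [bracket_add, bracket_add, ha, hb, add_zero]
  | smul t a _ ha => rw [bracket_smul, bracket_smul, ha, smul_zero]
  | mem z hz =>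
  obtain ⟨c, rfl⟩ := hz
  exact h a b c

variable {d : ℕ} {V : Submodule ℂ (Matrix (Fin d) (Fin d) ℂ)}

theorem expUnit_add_of_two_step (hV : ∀ x ∈ V, ∀ y ∈ V, ∀ z ∈ V, ⁅x, ⁅y, z⁆⁆ = 0)
    {x y : Matrix (Fin d) (Fin d) ℂ} (hx : x ∈ V) (hy : y ∈ V) :
    expUnit (x + y) = expUnit x * expUnit y * expUnit (-((2⁻¹ : ℂ) • ⁅x, y⁆)) := by
  ext1
  exact Matrix.exp_add_of_two_step x y (hV x hx x hx y hy) (hV y hy x hx y hy)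

/-- Comparing the formulas for exp(x+y) and exp(y+x) exhibits exp⁅x, y⁆ as the group commutator of
exp x and exp y. -/
theorem expUnit_bracket_mem (hV : ∀ x ∈ V, ∀ y ∈ V, ∀ z ∈ V, ⁅x, ⁅y, z⁆⁆ = 0)
    (U : Subgroup (GL (Fin d) ℂ)) {x y : Matrix (Fin d) (Fin d) ℂ} (hx : x ∈ V) (hy : y ∈ V)
    (hxU : expUnit x ∈ U) (hyU : expUnit y ∈ U) : expUnit ⁅x, y⁆ ∈ U := by
  have h1 := expUnit_add_of_two_step hV hx hy
  have h2 := expUnit_add_of_two_step hV hy hx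
  rw [bracket_swap y x, smul_neg, _root_.neg_neg, add_comm, h1] at h2
  have h3 : expUnit ⁅x, y⁆ =
      expUnit ((2⁻¹ : ℂ) • ⁅x, y⁆) * (expUnit (-((2⁻¹ : ℂ) • ⁅x, y⁆)))⁻¹ := by
    rw [← expUnit_neg, _root_.neg_neg, ← expUnit_add_smul]
    norm_num
  have h4 : expUnit ⁅x, y⁆ = (expUnit y * expUnit x)⁻¹ * (expUnit x * expUnit y) := by
    rw [h3, mul_inv_eq_iff_eq_mul, mul_assoc, eq_inv_mul_iff_mul_eq, h2]
  rw [h4]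
  exact U.mul_mem (U.inv_mem (U.mul_mem hyU hxU)) (U.mul_mem hxU hyU)

/-- In a two-step nilpotent space, the elements with one-parameter group in `U` form a subspace. -/
def oneParam (hV : ∀ x ∈ V, ∀ y ∈ V, ∀ z ∈ V, ⁅x, ⁅y, z⁆⁆ = 0) (U : Subgroup (GL (Fin d) ℂ)) :
    Submodule ℂ (Matrix (Fin d) (Fin d) ℂ) where
  carrier := {x | x ∈ V ∧ ∀ t : ℂ, expUnit (t • x) ∈ U}
  zero_mem' := ⟨V.zero_mem, fun t => by rw [smul_zero, expUnit_zero]; exact U.one_mem⟩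
  smul_mem' := by
    rintro c x ⟨hx, h⟩
    exact ⟨V.smul_mem c hx, fun t => by rw [smul_smul]; exact h _⟩
  add_mem' := by
    rintro x y ⟨hx, hxU⟩ ⟨hy, hyU⟩
    refine ⟨V.add_mem hx hy, fun t => ?_⟩
    rw [smul_add, expUnit_add_of_two_step hV (V.smul_mem t hx) (V.smul_mem t hy)]
    refine U.mul_mem (U.mul_mem (hxU t) (hyU t)) ?_
    have := expUnit_bracket_mem hV U (V.smul_mem (-(2⁻¹ * t * t)) hx) hy (hxU _)
      (by simpa using hyU 1)
    convert this using 2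
    rw [smul_bracket, smul_bracket, bracket_smul, smul_smul, smul_smul, neg_smul]

end TwoStep

/-! ### The group U_+, root strings and conjugation by simple lifts -/

namespace ChevalleyRep

variable {r d : ℕ} {A : Matrix (Fin r) (Fin r) ℤ} (R : ChevalleyRep A d)

/-- The group of the matrices of elements of `U_+`. -/
def UU : Subgroup (GL (Fin d) ℂ) := Subgroup.closure {g | ∃ i t, g = R.xx i t}

theorem xx_mem_UU (i : Fin r) (t : ℂ) : R.xx i t ∈ R.UU := Subgroup.subset_closure ⟨i, t, rfl⟩

theorem yy_mem_op_UU (i : Fin r) (t : ℂ) : R.yy i t ∈ R.op.UU := R.op.xx_mem_UU i t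

/-- The vector `(ad e_i)^k e_j`. -/
def str (i j : Fin r) (k : ℕ) : Matrix (Fin d) (Fin d) ℂ := (fun N => ⁅R.e i, N⁆)^[k] (R.e j)

theorem str_zero (i j : Fin r) : R.str i j 0 = R.e j := rfl

theorem str_succ (i j : Fin r) (k : ℕ) : R.str i j (k + 1) = ⁅R.e i, R.str i j k⁆ :=
  Function.iterate_succ_apply' _ _ _

theorem str_one (i j : Fin r) : R.str i j 1 = ⁅R.e i, R.e j⁆ := rfl

theorem str_eq_zero {i j : Fin r} (hij : i ≠ j) {m k : ℕ} (hm : A i j = -m) (hk : m < k) :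
    R.str i j k = 0 := by
  obtain ⟨l, rfl⟩ := Nat.exists_eq_add_of_le (Nat.succ_le_of_lt hk)
  have h := R.serre_e i j hij
  have e : (1 - A i j).toNat = m.succ := by rw [hm]; omega
  rw [e] at h
  rw [str, add_comm, Function.iterate_add_apply, h]
  exact Function.iterate_fixed (bracket_zero _) l

theorem lie_e_str_one {i j : Fin r} (hij : i ≠ j) (hji : A j i = -1) :
    ⁅R.e j, R.str i j 1⁆ = 0 := by
  have h := R.str_eq_zero hij.symm (m := 1) (k := 2) (by simpa using hji) (by norm_num)
  rw [str_succ, str_one, bracket_swap (R.e j) (R.e i), bracket_neg, neg_eq_zero] at h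
  exact h

/-- Conjugating x_j by x_i(s) shows that ∑ s^k/k! · (ad e_i)^k e_j has its one-parameter group in
U_+, for every s. Such vectors form a linear space (`oneParam`), so the values s = 0, ±1, ±2 suffice
to separate the four terms. -/
theorem exp_str_mem {i j : Fin r} (hij : i ≠ j) (h4 : R.str i j 4 = 0) (hji : A j i = -1)
    (k : Fin 4) (t : ℂ) : expUnit (t • R.str i j k) ∈ R.UU := by
  set v : Fin 4 → Matrix (Fin d) (Fin d) ℂ := fun k => R.str i j k with hv
  have hstep : ∀ a b c, ⁅v a, ⁅v b, v c⁆⁆ = 0 :=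
    string_two_step (x := R.e i) v rfl (by simp [hv, str]) (by simp [hv, str])
      (by rw [← h4]; simp [hv, str]) (R.lie_e_str_one hij hji)
  set V := Submodule.span ℂ (Set.range v)
  have hV : ∀ x ∈ V, ∀ y ∈ V, ∀ z ∈ V, ⁅x, ⁅y, z⁆⁆ = 0 := fun x hx y hy z hz =>
    span_two_step v hstep hx hy hz
  set L := oneParam hV R.UU
  have hvV : ∀ k, v k ∈ V := fun k => Submodule.subset_span ⟨k, rfl⟩
  have hw : ∀ s : ℂ, v 0 + s • v 1 + (s ^ 2 * 2⁻¹) • v 2 + (s ^ 3 * 6⁻¹) • v 3 ∈ L := by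
    intro s
    refine ⟨?_, fun t => ?_⟩
    · exact V.add_mem (V.add_mem (V.add_mem (hvV _) (V.smul_mem _ (hvV _)))
        (V.smul_mem _ (hvV _))) (V.smul_mem _ (hvV _))
    · have e : Ad (R.xx i s) (R.e j) =
          v 0 + s • v 1 + (s ^ 2 * 2⁻¹) • v 2 + (s ^ 3 * 6⁻¹) • v 3 := by
        rw [xx, Ad_expUnit_smul _ _ 4 h4]
        simp [Finset.sum_range_succ, hv, str, Nat.factorial]
      rw [← e, ← map_smul, ← conj_expUnit]
      exact R.UU.mul_mem (R.UU.mul_mem (R.xx_mem_UU i s) (R.xx_mem_UU j t))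
        (R.UU.inv_mem (R.xx_mem_UU i s))
  have h0 : v 0 ∈ L := by simpa using hw 0
  have h2 : v 2 ∈ L := by
    have := L.sub_mem (L.add_mem (hw 1) (hw (-1))) (L.add_mem h0 h0)
    convert this using 1
    module
  have h3 : v 3 ∈ L := by
    have := L.sub_mem (L.sub_mem (hw 2) (hw (-2))) (L.smul_mem 2 (L.sub_mem (hw 1) (hw (-1))))
    have := L.smul_mem (2⁻¹ : ℂ) this
    convert this using 1
    module
  have h1 : v 1 ∈ L := by
    have := L.sub_mem (L.sub_mem (hw 1) (hw (-1))) (L.smul_mem (3⁻¹ : ℂ) h3)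
    have := L.smul_mem (2⁻¹ : ℂ) this
    convert this using 1
    module
  have : v k ∈ L := by
    fin_cases k
    exacts [h0, h1, h2, h3]
  exact this.2 t

theorem isHomog_str (lam : Fin r → ℤ) (i j : Fin r) (k : ℕ) :
    ⁅R.hx lam, R.str i j k⁆ = ((k * alpha A i lam + alpha A j lam : ℤ) : ℂ) • R.str i j k := by
  induction k with
  | zero => simpa [str_zero] using R.lie_hx_e lam j
  | succ k ih =>
    rw [str_succ, bracket_bracket, ih, R.lie_hx_e, smul_bracket, bracket_smul, ← add_smul]
    congr 1; push_cast; ring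

theorem lie_f_str (i j : Fin r) (hA : A i i = 2) (hij : i ≠ j) (k : ℕ) :
    ⁅R.f i, R.str i j (k + 1)⁆ = ((-(k + 1) * (A i j + k) : ℤ) : ℂ) • R.str i j k := by
  induction k with
  | zero =>
    rw [str_succ, str_zero, bracket_bracket, bracket_swap (R.f i), R.lie_e_f_self,
      bracket_swap (R.f i), R.lie_e_f_of_ne hij.symm, neg_bracket, R.lie_hx_e, alpha_single]
    simp [bracket_zero]
  | succ k ih =>
    rw [str_succ, bracket_bracket, ih, bracket_swap (R.f i), R.lie_e_f_self, neg_bracket,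
      isHomog_str, alpha_single, alpha_single, hA, bracket_smul, ← str_succ, ← neg_smul, ← add_smul]
    congr 1; push_cast; ring

theorem lie_f_e_of_ne {i j : Fin r} (hij : i ≠ j) : ⁅R.f i, R.e j⁆ = 0 := by
  rw [bracket_swap, R.lie_e_f_of_ne hij.symm, neg_zero]

theorem Ad_yy_one (i : Fin r) (N : Matrix (Fin d) (Fin d) ℂ) (n : ℕ)
    (h : (fun N => ⁅R.f i, N⁆)^[n] N = 0) : Ad (R.yy i 1) N =
      ∑ k ∈ Finset.range n, ((k.factorial : ℂ)⁻¹) • (fun N => ⁅R.f i, N⁆)^[k] N := by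
  rw [yy, Ad_expUnit_smul _ _ n h]
  simp only [one_pow, one_mul]

theorem Ad_yy_string {i : Fin r} {v0 v1 v2 v3 : Matrix (Fin d) (Fin d) ℂ} {m : ℂ}
    (h00 : ⁅R.f i, v0⁆ = 0) (h01 : ⁅R.f i, v1⁆ = m • v0) (h12 : ⁅R.f i, v2⁆ = (2 * (m - 1)) • v1)
    (h23 : ⁅R.f i, v3⁆ = (3 * (m - 2)) • v2) :
    Ad (R.yy i 1) v0 = v0 ∧ Ad (R.yy i 1) v1 = v1 + m • v0 ∧
    Ad (R.yy i 1) v2 = v2 + (2 * (m - 1)) • v1 + (m * (m - 1)) • v0 ∧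
    Ad (R.yy i 1) v3 = v3 + (3 * (m - 2)) • v2 + (3 * (m - 2) * (m - 1)) • v1
      + ((m - 2) * (m - 1) * m) • v0 := by
  refine ⟨?_, ?_, ?_, ?_⟩
  · rw [R.Ad_yy_one i _ 1 (by simp [h00])]
    simp
  · rw [R.Ad_yy_one i _ 2 (by simp [h01, bracket_smul, h00])]
    simp [Finset.sum_range_succ, h01]
  · rw [R.Ad_yy_one i _ 3 (by simp [h01, h12, bracket_smul, h00])]
    simp [Finset.sum_range_succ, h01, h12, bracket_smul, smul_smul]
    module
  · rw [R.Ad_yy_one i _ 4 (by simp [h01, h12, h23, bracket_smul, h00])]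
    simp [Finset.sum_range_succ, h01, h12, h23, bracket_smul, smul_smul, Nat.factorial]
    module

/-- With ṡ_i written as y_i x_i y_i, the first y_i fixes e_j and x_i spreads it over the whole
string. By the binomial coefficients in `Ad_yy_string`, the last y_i then cancels everything but the
top vector. -/
theorem Ad_ss_e_of_ne {i j : Fin r} (hA : A i i = 2) (hij : i ≠ j) {m : ℕ} (hm : A i j = -m)
    (hm3 : m ≤ 3) :
    Ad (R.ss i) (R.e j) = ((-1) ^ m * (m.factorial : ℂ)⁻¹) • R.str i j m := by
  have hy : Ad (R.yy i 1) (R.e j) = R.e j := R.op.Ad_xx_f_of_ne hij 1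
  have hx : Ad (R.xx i (-1)) (R.e j) = ∑ k ∈ Finset.range (m + 1),
      ((-1) ^ k * (k.factorial : ℂ)⁻¹) • R.str i j k :=
    Ad_expUnit_smul _ _ _ (R.str_eq_zero hij hm (Nat.lt_succ_self m)) _
  have hf := R.lie_f_str i j hA hij
  have h01 : ⁅R.f i, R.str i j 1⁆ = (m : ℂ) • R.str i j 0 := by
    rw [hf 0, hm]; congr 1; push_cast; ring
  have h12 : ⁅R.f i, R.str i j 2⁆ = (2 * (m - 1) : ℂ) • R.str i j 1 := by
    rw [hf 1, hm]; congr 1; push_cast; ring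
  have h23 : ⁅R.f i, R.str i j 3⁆ = (3 * (m - 2) : ℂ) • R.str i j 2 := by
    rw [hf 2, hm]; congr 1; push_cast; ring
  rw [R.ss_eq_yy_xx_yy i hA, Ad_mul, Ad_mul, hy, hx]
  obtain ⟨a0, a1, a2, a3⟩ := R.Ad_yy_string (v0 := R.str i j 0) (R.lie_f_e_of_ne hij)
    h01 h12 h23
  clear hf h01 h12 h23 hx hy hm
  generalize R.str i j = v at *
  interval_cases m
  · simp [a0]
  · simp [Finset.sum_range_succ, a0, a1]
  · simp [Finset.sum_range_succ, a0, a1, a2]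
    module
  · simp [Finset.sum_range_succ, a0, a1, a2, a3, Nat.factorial]
    module

include R in
theorem exists_cartan_eq_neg (hA : IsCartan A) {i j : Fin r} (hij : i ≠ j) :
    ∃ m : ℕ, A i j = -m ∧ m ≤ 3 := by
  have h1 := hA.nonpos i j hij
  have h2 := hA.nonpos j i hij.symm
  have h3 := R.cartan_mul_lt hA hij
  refine ⟨(-A i j).toNat, by omega, ?_⟩
  by_cases h0 : A j i = 0
  · rw [hA.zero j i h0]; simp
  · have : -3 ≤ A i j := by
      have : A j i ≤ -1 := by omega
      nlinarith
    omega

/-- The image is the top vector of the i-string through j. As a_ij a_ji < 4, one of the two Cartan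
integers is -1 unless both vanish, so `exp_str_mem` applies to one of the two strings. -/
theorem ss_conj_xx_mem (hA : IsCartan A) {i j : Fin r} (hij : i ≠ j) (t : ℂ) :
    R.ss i * R.xx j t * (R.ss i)⁻¹ ∈ R.UU := by
  obtain ⟨m, hm, hm3⟩ := R.exists_cartan_eq_neg hA hij
  obtain ⟨m', hm', hm3'⟩ := R.exists_cartan_eq_neg hA hij.symm
  rw [xx, conj_expUnit, map_smul, R.Ad_ss_e_of_ne (hA.diag i) hij hm hm3, smul_smul]
  have h3 := R.cartan_mul_lt hA hij
  by_cases h0 : m = 0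
  · subst h0
    exact R.xx_mem_UU j _
  have h0' : m' ≠ 0 := by
    rintro rfl
    have := hA.zero j i (by simpa using hm')
    omega
  by_cases h1 : m' = 1
  · have := R.exp_str_mem hij (R.str_eq_zero hij hm (by omega)) (by rw [hm', h1]; rfl)
      ⟨m, by omega⟩
    exact this _
  -- Here a_ji ≤ -2 forces a_ij = -1, and the top vector ⁅e_i, e_j⁆ is also, up to sign, a vector of
  -- the j-string through i.
  · have h1 : m = 1 := by
      rw [hm, hm'] at h3
      have h4 : m * m' < 4 := by zify; linarith
      have : 2 ≤ m' := by omega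
      nlinarith [Nat.pos_of_ne_zero h0]
    subst h1
    have e : R.str i j 1 = (-1 : ℂ) • R.str j i 1 := by
      rw [str_one, str_one, bracket_swap]; simp
    rw [e, smul_smul]
    exact R.exp_str_mem hij.symm (R.str_eq_zero hij.symm hm' (by omega)) (by simpa using hm) 1 _

/-! ### Braid relations -/

theorem Ad_ss_of_commute {i : Fin r} {M : Matrix (Fin d) (Fin d) ℂ} (he : ⁅R.e i, M⁆ = 0)
    (hf : ⁅R.f i, M⁆ = 0) : Ad (R.ss i) M = M := by
  have hx : ∀ t, Ad (R.xx i t) M = M := fun t => by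
    rw [xx, Ad_expUnit_smul _ _ 1 (by simpa using he)]; simp
  have hy : ∀ t, Ad (R.yy i t) M = M := fun t => by
    rw [yy, Ad_expUnit_smul _ _ 1 (by simpa using hf)]; simp
  rw [ss, Ad_mul, Ad_mul, hx, hy, hx]

/-- A braid relation of length m says that the alternating product of m - 1 simple lifts conjugates
one simple lift to another. This reduces it to the action of that product on e_i and f_i. -/
theorem conj_ss {g : GL (Fin d) ℂ} {i j : Fin r} (he : Ad g (R.e i) = R.e j)
    (hf : Ad g (R.f i) = R.f j) : g * R.ss i = R.ss j * g := by
  have hx : ∀ t, g * R.xx i t * g⁻¹ = R.xx j t := fun t => by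
    rw [xx, conj_expUnit, map_smul, he, xx]
  have hy : ∀ t, g * R.yy i t * g⁻¹ = R.yy j t := fun t => by
    rw [yy, conj_expUnit, map_smul, hf, yy]
  rw [← mul_inv_eq_iff_eq_mul, ss, ss, ← hx, ← hy]
  group

theorem Ad_ss_e_of_eq_neg_one (hA : IsCartan A) {i j : Fin r} (hij : i ≠ j) (hji : A j i = -1) :
    Ad (R.ss j) (R.e i) = R.str i j 1 := by
  rw [R.Ad_ss_e_of_ne (hA.diag j) hij.symm (m := 1) (by simpa using hji) (by norm_num), str_one,
    str_one, bracket_swap]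
  simp

theorem Ad_ss_str_one (hA : IsCartan A) {i j : Fin r} (hij : i ≠ j) (hji : A j i = -1) :
    Ad (R.ss j) (R.str i j 1) = -R.e i := by
  have h := R.lie_f_str j i (hA.diag j) hij.symm 0
  rw [str_one, Ad_lie, R.Ad_ss_e_of_eq_neg_one hA hij hji, R.Ad_ss_e j (hA.diag j), bracket_neg,
    ← bracket_swap, str_one, bracket_swap (R.e i), bracket_neg]
  rw [str_zero, str_one, hji] at h
  rw [h]; simp

theorem Ad_ss_ss (hA : IsCartan A) {i j : Fin r} (hij : i ≠ j) (h1 : A i j = -1)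
    (h2 : A j i = -1) : Ad (R.ss i * R.ss j) (R.e i) = R.e j := by
  have h := R.lie_f_str i j (hA.diag i) hij 0
  rw [Ad_mul, R.Ad_ss_e_of_eq_neg_one hA hij h2, str_one, Ad_lie, R.Ad_ss_e i (hA.diag i),
    R.Ad_ss_e_of_ne (hA.diag i) hij (m := 1) (by simpa using h1) (by norm_num)]
  rw [h1] at h
  simp only [neg_bracket, bracket_smul, h]
  simp [str_zero]

theorem Ad_ss_ss_ss (hA : IsCartan A) {i j : Fin r} (hij : i ≠ j) (h1 : A i j = -2)
    (h2 : A j i = -1) : Ad (R.ss j * R.ss i * R.ss j) (R.e i) = R.e i := by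
  have h := R.lie_f_str i j (hA.diag i) hij 1
  have hs : Ad (R.ss i) (R.str i j 1) = -R.str i j 1 := by
    rw [str_one, Ad_lie, R.Ad_ss_e i (hA.diag i),
      R.Ad_ss_e_of_ne (hA.diag i) hij (m := 2) (by simpa using h1) (by norm_num)]
    rw [h1] at h
    simp only [neg_bracket, bracket_smul, h]
    simp [str_one, smul_smul]
  rw [Ad_mul, Ad_mul, R.Ad_ss_e_of_eq_neg_one hA hij h2, hs, map_neg, R.Ad_ss_str_one hA hij h2,
    _root_.neg_neg]

theorem Ad_ss_ss_ss_ss_ss (hA : IsCartan A) {i j : Fin r} (hij : i ≠ j) (h1 : A i j = -3)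
    (h2 : A j i = -1) :
    Ad (R.ss j * R.ss i * R.ss j * R.ss i * R.ss j) (R.e i) = R.e i := by
  have hf1 := R.lie_f_str i j (hA.diag i) hij 1
  have hf2 := R.lie_f_str i j (hA.diag i) hij 2
  rw [h1] at hf1 hf2
  have e1 : Ad (R.ss i) (R.str i j 1) = (2⁻¹ : ℂ) • R.str i j 2 := by
    rw [str_one, Ad_lie, R.Ad_ss_e i (hA.diag i),
      R.Ad_ss_e_of_ne (hA.diag i) hij (m := 3) (by simpa using h1) (by norm_num)]
    simp only [neg_bracket, bracket_smul, hf2, Nat.factorial]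
    push_cast
    module
  have e2 : Ad (R.ss i) (R.str i j 2) = (-2 : ℂ) • R.str i j 1 := by
    rw [str_succ, Ad_lie, R.Ad_ss_e i (hA.diag i), e1]
    simp only [neg_bracket, bracket_smul, hf1]
    push_cast
    module
  -- The root 2α_i + α_j pairs to zero with α_j^∨, and e_j and f_j both commute with its root
  -- vector.
  have e3 : Ad (R.ss j) (R.str i j 2) = R.str i j 2 := by
    refine R.Ad_ss_of_commute ?_ ?_
    · have := bracket_bracket (R.e i) (R.e j) (R.str i j 1)
      rw [R.lie_e_str_one hij h2, bracket_zero, ← str_one, bracket_self, zero_add, ← str_succ,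
        eq_comm] at this
      exact this
    · have a1 : ⁅R.f j, R.str i j 1⁆ = (A j i : ℂ) • R.e i := by
        rw [str_one, bracket_bracket, R.lie_f_e_of_ne hij.symm, zero_bracket, zero_add,
          bracket_swap (R.f j), R.lie_e_f_self, bracket_neg, bracket_swap, R.lie_hx_e, alpha_single,
          _root_.neg_neg]
      rw [str_succ, bracket_bracket, R.lie_f_e_of_ne hij.symm, zero_bracket, zero_add, a1,
        bracket_smul, bracket_self, smul_zero]
  rw [Ad_mul, Ad_mul, Ad_mul, Ad_mul, R.Ad_ss_e_of_eq_neg_one hA hij h2, e1, map_smul, e3, map_smul,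
    e2, map_smul, map_smul, R.Ad_ss_str_one hA hij h2]
  module

theorem ss_braid_two {i j : Fin r} (hij : i ≠ j) (h1 : A i j = 0) :
    R.ss i * R.ss j = R.ss j * R.ss i := by
  refine R.conj_ss (R.Ad_ss_of_commute ?_ ?_) (R.Ad_ss_of_commute ?_ ?_)
  · exact R.str_eq_zero hij (m := 0) (k := 1) (by simpa using h1) (by norm_num)
  · exact R.lie_f_e_of_ne hij
  · exact R.lie_e_f_of_ne hij
  · exact R.op.str_eq_zero hij (m := 0) (k := 1) (by simpa using h1) (by norm_num)

theorem ss_braid_three (hA : IsCartan A) {i j : Fin r} (hij : i ≠ j) (h1 : A i j = -1)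
    (h2 : A j i = -1) : R.ss i * R.ss j * R.ss i = R.ss j * R.ss i * R.ss j := by
  -- The condition on f_i is the statement about e for `R.op` with i and j exchanged. The lifts
  -- there are inverse to those here, so the product appears inverted. The longer braid relations
  -- use the same device.
  have h := R.op.Ad_ss_ss hA hij.symm h2 h1
  rw [R.op_ss i (hA.diag i), R.op_ss j (hA.diag j), ← _root_.mul_inv_rev] at h
  rw [R.conj_ss (R.Ad_ss_ss hA hij h1 h2) ?_, mul_assoc]
  change Ad _ (R.op.e i) = R.op.e j
  rw [← h, ← Ad_mul, mul_inv_cancel, Ad_one]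

theorem ss_braid_four (hA : IsCartan A) {i j : Fin r} (hij : i ≠ j) (h1 : A i j = -2)
    (h2 : A j i = -1) :
    R.ss i * R.ss j * R.ss i * R.ss j = R.ss j * R.ss i * R.ss j * R.ss i := by
  have h := R.op.Ad_ss_ss_ss hA hij h1 h2
  rw [R.op_ss i (hA.diag i), R.op_ss j (hA.diag j), ← _root_.mul_inv_rev, ← _root_.mul_inv_rev,
    ← mul_assoc] at h
  rw [R.conj_ss (R.Ad_ss_ss_ss hA hij h1 h2) ?_]
  · simp only [mul_assoc]
  change Ad _ (R.op.e i) = R.op.e i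
  nth_rw 1 [← h]
  rw [← Ad_mul, mul_inv_cancel, Ad_one]

theorem ss_braid_six (hA : IsCartan A) {i j : Fin r} (hij : i ≠ j) (h1 : A i j = -3)
    (h2 : A j i = -1) : R.ss i * R.ss j * R.ss i * R.ss j * R.ss i * R.ss j =
      R.ss j * R.ss i * R.ss j * R.ss i * R.ss j * R.ss i := by
  have h := R.op.Ad_ss_ss_ss_ss_ss hA hij h1 h2
  rw [R.op_ss i (hA.diag i), R.op_ss j (hA.diag j)] at h
  simp only [← _root_.mul_inv_rev] at h
  rw [R.conj_ss (R.Ad_ss_ss_ss_ss_ss hA hij h1 h2) ?_]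
  · simp only [mul_assoc]
  change Ad _ (R.op.e i) = R.op.e i
  nth_rw 1 [← h]
  rw [← Ad_mul]
  simp only [mul_assoc, mul_inv_cancel, Ad_one]

end ChevalleyRep
end Weave

namespace Weave

open scoped Matrix.Norms.Operator in
theorem Matrix.eq_zero_of_exp_smul_eq_one {d : ℕ} {M : Matrix (Fin d) (Fin d) ℂ}
    (h : ∀ t : ℂ, NormedSpace.exp (t • M) = 1) : M = 0 := by
  have h1 := hasDerivAt_exp_smul_const (𝕂 := ℂ) M 0
  have h2 : HasDerivAt (fun _ : ℂ => (1 : Matrix (Fin d) (Fin d) ℂ))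
      (NormedSpace.exp ((0 : ℂ) • M) * M) 0 :=
    h1.congr_of_eventuallyEq (Filter.Eventually.of_forall fun t => (h t).symm)
  rw [h 0, one_mul] at h2
  exact h2.unique (hasDerivAt_const _ _)

/-! ## Weyl group elements of words -/

section Weyl

variable {r : ℕ} {A : Matrix (Fin r) (Fin r) ℤ}

theorem weyl_nil : weyl A [] = 1 := rfl

theorem weyl_cons (i : Fin r) (j : List (Fin r)) : weyl A (i :: j) = simpleRefl A i * weyl A j := by
  simp [weyl]

theorem weyl_append (j k : List (Fin r)) : weyl A (j ++ k) = weyl A j * weyl A k := by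
  simp [weyl]

theorem weyl_singleton (i : Fin r) : weyl A [i] = simpleRefl A i := by simp [weyl]

theorem alpha_simpleRefl (i j : Fin r) (lam : Fin r → ℤ) :
    alpha A j (simpleRefl A i lam) = alpha A j lam - alpha A i lam * A i j := by
  rw [simpleRefl_apply, alpha_sub, alpha_smul, alpha_single]

theorem simpleRefl_mul_self (hA : IsCartan A) (i : Fin r) :
    simpleRefl A i * simpleRefl A i = 1 := by
  refine LinearMap.ext fun lam => ?_
  change simpleRefl A i (simpleRefl A i lam) = lam
  rw [simpleRefl_apply i (simpleRefl A i lam), alpha_simpleRefl, hA.diag, simpleRefl_apply]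
  module

theorem simpleRefl_mul_cancel (hA : IsCartan A) (i : Fin r) (w : Module.End ℤ (Fin r → ℤ)) :
    simpleRefl A i * (simpleRefl A i * w) = w := by
  rw [← mul_assoc, simpleRefl_mul_self hA, one_mul]

theorem mul_simpleRefl_cancel (hA : IsCartan A) (i : Fin r) (w : Module.End ℤ (Fin r → ℤ)) :
    w * simpleRefl A i * simpleRefl A i = w := by
  rw [mul_assoc, simpleRefl_mul_self hA, mul_one]

theorem weyl_mul_weyl_reverse (hA : IsCartan A) (j : List (Fin r)) :
    weyl A j * weyl A j.reverse = 1 := by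
  induction j with
  | nil => rfl
  | cons i j ih =>
    rw [weyl_cons, List.reverse_cons, weyl_append, weyl_singleton, mul_assoc, ← mul_assoc (weyl A j),
      ih, one_mul, simpleRefl_mul_self hA]

theorem IsReduced.of_append_left {j k : List (Fin r)} (h : IsReduced A (j ++ k)) :
    IsReduced A j := fun l hl => by
  have := h (l ++ k) (by rw [weyl_append, weyl_append, hl])
  simpa using this

theorem IsReduced.of_append_right {j k : List (Fin r)} (h : IsReduced A (j ++ k)) :
    IsReduced A k := fun l hl => by
  have := h (j ++ l) (by rw [weyl_append, weyl_append, hl])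
  simpa using this

theorem IsReduced.of_cons {i : Fin r} {j : List (Fin r)} (h : IsReduced A (i :: j)) :
    IsReduced A j := IsReduced.of_append_right (j := [i]) h

theorem IsReduced.length_eq {j k : List (Fin r)} (hj : IsReduced A j) (hk : IsReduced A k)
    (h : weyl A j = weyl A k) : j.length = k.length :=
  le_antisymm (hj k h.symm) (hk j h)

theorem IsReduced.congr {j k : List (Fin r)} (hj : IsReduced A j) (h : weyl A k = weyl A j)
    (hl : k.length = j.length) : IsReduced A k := fun l hl' => by
  rw [hl]; exact hj l (hl'.trans h)

theorem length_altWord (n : ℕ) (i j : Fin r) : (altWord n i j).length = n := by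
  induction n generalizing i j with
  | zero => rfl
  | succ n ih => simp [altWord, ih]

theorem take_altWord {k n : ℕ} (h : k ≤ n) (i j : Fin r) :
    (altWord n i j).take k = altWord k i j := by
  induction k generalizing n i j with
  | zero => simp [altWord]
  | succ k ih =>
    obtain ⟨n, rfl⟩ : ∃ n', n = n' + 1 := ⟨n - 1, by omega⟩
    simp [altWord, ih (Nat.le_of_succ_le_succ h)]

theorem coxOrder_comm (i j : Fin r) : coxOrder A i j = coxOrder A j i := by
  simp only [coxOrder, mul_comm]

end Weyl

namespace ChevalleyRep

variable {r d : ℕ} {A : Matrix (Fin r) (Fin r) ℤ} (R : ChevalleyRep A d)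

theorem form_weyl (hA : IsCartan A) (j : List (Fin r)) (x y : Fin r → ℤ) :
    R.form (weyl A j x) (weyl A j y) = R.form x y := by
  induction j with
  | nil => rfl
  | cons i j ih =>
    rw [weyl_cons, ← ih]
    exact R.form_simpleRefl i (hA.diag i) _ _

-- The hypothesis compares roots, while the reflections also involve coroots. By invariance of the
-- form, w χ_i is proportional to χ_k, and the value 2 of a root on its coroot makes the ratio 1.
include R in
theorem mul_weyl_of_alpha (hA : IsCartan A) {j : List (Fin r)} {i k : Fin r}
    (h : ∀ lam, alpha A k (weyl A j lam) = alpha A i lam) :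
    simpleRefl A k * weyl A j = weyl A j * simpleRefl A i := by
  have h1 : ∀ y, R.form (Pi.single i 1) (Pi.single i 1) * R.form y (Pi.single k 1) =
      R.form (Pi.single k 1) (Pi.single k 1) * R.form y (weyl A j (Pi.single i 1)) := by
    intro y
    obtain ⟨x, rfl⟩ : ∃ x, weyl A j x = y :=
      ⟨weyl A j.reverse y, DFunLike.congr_fun (weyl_mul_weyl_reverse hA j) y⟩
    rw [R.form_weyl hA, R.form_comm _ (Pi.single k 1), R.form_comm x]
    have e1 := R.two_mul_form_single k (hA.diag k) (weyl A j x)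
    have e2 := R.two_mul_form_single i (hA.diag i) x
    rw [h] at e1
    have : (2 : ℤ) ≠ 0 := by norm_num
    apply mul_left_cancel₀ this
    linear_combination R.form (Pi.single i 1) (Pi.single i 1) * e1 -
      R.form (Pi.single k 1) (Pi.single k 1) * e2
  have hi : 0 < R.form (Pi.single i 1) (Pi.single i 1) := R.form_pos (by simp)
  have hk : 0 < R.form (Pi.single k 1) (Pi.single k 1) := R.form_pos (by simp)
  generalize R.form (Pi.single i 1) (Pi.single i 1) = a at *
  generalize R.form (Pi.single k 1) (Pi.single k 1) = b at *
  have h2 : a • (Pi.single k 1 : Fin r → ℤ) + (-b) • weyl A j (Pi.single i 1) = 0 := by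
    by_contra h0
    have := R.form_pos h0
    have h3 := h1 (a • (Pi.single k 1 : Fin r → ℤ) + (-b) • weyl A j (Pi.single i 1))
    rw [form_add, form_smul, form_smul, h3] at this
    linarith
  have h3 := congrArg (alpha A k) h2
  rw [alpha_add, alpha_smul, alpha_smul, h, alpha_single, alpha_single, hA.diag, hA.diag] at h3
  have hab : a = b := by
    have : alpha A k (0 : Fin r → ℤ) = 0 := by simp [alpha]
    omega
  subst hab
  have h4 : weyl A j (Pi.single i 1) = Pi.single k 1 := by
    have : a • ((Pi.single k 1 : Fin r → ℤ) - weyl A j (Pi.single i 1)) = 0 := by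
      rw [← h2]; module
    rw [smul_eq_zero, sub_eq_zero] at this
    exact (this.resolve_left hi.ne').symm
  refine LinearMap.ext fun lam => ?_
  change simpleRefl A k (weyl A j lam) = weyl A j (simpleRefl A i lam)
  rw [simpleRefl_apply, simpleRefl_apply, map_sub, map_smul, h4, h]

/-! ## The torus and the unipotent radicals -/

/-- The group of the matrices of elements of `H`. -/
def HH : Subgroup (GL (Fin d) ℂ) := Subgroup.closure {g | ∃ lam t, g = R.tor lam t}

theorem tor_mem_HH (lam : Fin r → ℤ) (t : ℂˣ) : R.tor lam t ∈ R.HH :=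
  Subgroup.subset_closure ⟨lam, t, rfl⟩

theorem tor_inv (lam : Fin r → ℤ) (t : ℂˣ) : (R.tor lam t)⁻¹ = R.tor lam t⁻¹ := by
  rw [inv_eq_iff_mul_eq_one, ← tor_mul, mul_inv_cancel, tor_one]

theorem conj_mem_of_closure {G : Type*} [Group G] {S : Set G} {K : Subgroup G} {g : G}
    (h : ∀ u ∈ S, g * u * g⁻¹ ∈ K) {u : G} (hu : u ∈ Subgroup.closure S) : g * u * g⁻¹ ∈ K := by
  have : Subgroup.closure S ≤ K.comap (MulAut.conj g).toMonoidHom := by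
    rw [Subgroup.closure_le]
    intro u hu
    exact h u hu
  exact this hu

theorem HH_conj_UU {h u : GL (Fin d) ℂ} (hh : h ∈ R.HH) (hu : u ∈ R.UU) : h * u * h⁻¹ ∈ R.UU := by
  have : R.HH ≤ Subgroup.normalizer (R.UU : Set (GL (Fin d) ℂ)) := by
    rw [HH, Subgroup.closure_le]
    rintro _ ⟨lam, t, rfl⟩
    have key : ∀ t u, u ∈ R.UU → R.tor lam t * u * (R.tor lam t)⁻¹ ∈ R.UU := fun t u hu =>
      conj_mem_of_closure (by
        rintro _ ⟨i, s, rfl⟩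
        rw [tor_conj_xx]; exact R.xx_mem_UU _ _) hu
    rw [SetLike.mem_coe, Subgroup.mem_normalizer_iff]
    intro u
    refine ⟨key t u, fun hu => ?_⟩
    have := key t⁻¹ _ hu
    rw [← tor_inv] at this
    simpa [mul_assoc] using this
  exact (Subgroup.mem_normalizer_iff.mp (this hh) u).mp hu

theorem HH_val {h : GL (Fin d) ℂ} (hh : h ∈ R.HH) :
    ∃ v : Fin d → ℂ, (h : Matrix (Fin d) (Fin d) ℂ) = diagonal v := by
  induction hh using Subgroup.closure_induction'' with
  | mem x hx => obtain ⟨lam, t, rfl⟩ := hx; exact ⟨_, rfl⟩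
  | inv_mem x hx => obtain ⟨lam, t, rfl⟩ := hx; rw [tor_inv]; exact ⟨_, rfl⟩
  | one => exact ⟨1, by simp⟩
  | mul x y _ _ hx hy =>
    obtain ⟨v, hv⟩ := hx
    obtain ⟨w, hw⟩ := hy
    exact ⟨fun a => v a * w a, by rw [Units.val_mul, hv, hw, diagonal_mul_diagonal]⟩

theorem ss_conj_HH (hA : IsCartan A) (i : Fin r) {h : GL (Fin d) ℂ} (hh : h ∈ R.HH) :
    R.ss i * h * (R.ss i)⁻¹ ∈ R.HH :=
  conj_mem_of_closure (by
    rintro _ ⟨lam, t, rfl⟩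
    rw [R.ss_conj_tor i (hA.diag i)]; exact R.tor_mem_HH _ _) hh

theorem ss_inv_conj_tor (hA : IsCartan A) (i : Fin r) (lam : Fin r → ℤ) (t : ℂˣ) :
    (R.ss i)⁻¹ * R.tor lam t * R.ss i = R.tor (simpleRefl A i lam) t := by
  have h := R.ss_conj_tor i (hA.diag i) (simpleRefl A i lam) t
  have e : simpleRefl A i (simpleRefl A i lam) = lam :=
    DFunLike.congr_fun (simpleRefl_mul_self hA i) lam
  rw [e] at h
  rw [← h]; group

theorem ss_inv_conj_HH (hA : IsCartan A) (i : Fin r) {h : GL (Fin d) ℂ} (hh : h ∈ R.HH) :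
    (R.ss i)⁻¹ * h * R.ss i ∈ R.HH := by
  have := conj_mem_of_closure (K := R.HH) (g := (R.ss i)⁻¹) (by
    rintro _ ⟨lam, t, rfl⟩
    rw [inv_inv, R.ss_inv_conj_tor hA]; exact R.tor_mem_HH _ _) hh
  rwa [inv_inv] at this

/-- `g` is unipotent with respect to the degree `φ`. -/
def unipotent (φ : Fin d → ℤ) : Subgroup (GL (Fin d) ℂ) where
  -- The condition is imposed on the inverse as well, which makes closure under inversion immediate.
  carrier := {g | ∀ a b, φ a ≤ φ b →
    (g : Matrix (Fin d) (Fin d) ℂ) a b = (1 : Matrix (Fin d) (Fin d) ℂ) a b ∧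
    ((g⁻¹ : GL (Fin d) ℂ) : Matrix (Fin d) (Fin d) ℂ) a b = (1 : Matrix (Fin d) (Fin d) ℂ) a b}
  one_mem' := by intro a b _; simp
  inv_mem' := by
    intro g hg a b hab
    rw [inv_inv]
    exact (hg a b hab).symm
  mul_mem' := by
    have key : ∀ M N : Matrix (Fin d) (Fin d) ℂ,
        (∀ a b, φ a ≤ φ b → M a b = (1 : Matrix (Fin d) (Fin d) ℂ) a b) →
        (∀ a b, φ a ≤ φ b → N a b = (1 : Matrix (Fin d) (Fin d) ℂ) a b) →
        ∀ a b, φ a ≤ φ b → (M * N) a b = (1 : Matrix (Fin d) (Fin d) ℂ) a b := by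
      intro M N hM hN a b hab
      rw [Matrix.mul_apply, Finset.sum_eq_single a]
      · rw [hM a a le_rfl, Matrix.one_apply_eq, one_mul, hN a b hab]
      · intro c _ hc
        by_cases h : φ a ≤ φ c
        · rw [hM a c h, Matrix.one_apply_ne hc.symm, zero_mul]
        · rw [hN c b (by omega)]
          by_cases hcb : c = b
          · subst hcb; exact absurd hab h
          · rw [Matrix.one_apply_ne hcb, mul_zero]
      · simp
    intro g g' hg hg' a b hab
    rw [_root_.mul_inv_rev, Units.val_mul, Units.val_mul]
    exact ⟨key _ _ (fun a b h => (hg a b h).1) (fun a b h => (hg' a b h).1) a b hab,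
      key _ _ (fun a b h => (hg' a b h).2) (fun a b h => (hg a b h).2) a b hab⟩

theorem expUnit_mem_unipotent {φ : Fin d → ℤ} {c : ℤ} {M : Matrix (Fin d) (Fin d) ℂ}
    (h : IsHomog φ c M) (hc : 0 < c) : expUnit M ∈ unipotent φ := by
  have key : ∀ N : Matrix (Fin d) (Fin d) ℂ, IsHomog φ c N → ∀ a b, φ a ≤ φ b →
      NormedSpace.exp N a b = (1 : Matrix (Fin d) (Fin d) ℂ) a b := by
    intro N hN a b hab
    by_cases heq : φ a = φ b
    · rw [hN.exp_apply hc.ne' (n := 0) (by simpa using heq)]; simp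
    · rw [Matrix.one_apply_ne (fun h => heq (by rw [h]))]
      by_contra h0
      obtain ⟨n, hn⟩ := hN.exists_of_exp_apply_ne_zero h0
      have : 0 ≤ (n : ℤ) * c := by positivity
      omega
  intro a b hab
  refine ⟨key M h a b hab, ?_⟩
  rw [← expUnit_neg]
  exact key (-M) (by simpa using h.smul (-1)) a b hab

theorem UU_le_unipotent (hA : IsCartan A) : R.UU ≤ unipotent (R.deg (rho A)) := by
  rw [UU, Subgroup.closure_le]
  rintro _ ⟨i, t, rfl⟩
  refine expUnit_mem_unipotent ((R.isHomog_e (rho A) i).smul t) ?_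
  rw [alpha_rho]; exact R.det_sq_pos hA

theorem op_UU_apply (hA : IsCartan A) {g : GL (Fin d) ℂ} (hg : g ∈ R.op.UU) {a b : Fin d}
    (hab : R.deg (rho A) b ≤ R.deg (rho A) a) :
    (g : Matrix (Fin d) (Fin d) ℂ) a b = (1 : Matrix (Fin d) (Fin d) ℂ) a b := by
  refine (R.op.UU_le_unipotent hA hg a b ?_).1
  rw [op_deg, op_deg]; omega

/-- For the grading by `rho`, one group is unitriangular upwards and the other downwards, and
between them they determine every entry. -/
theorem UU_inf_op_UU (hA : IsCartan A) {g : GL (Fin d) ℂ} (h : g ∈ R.UU) (h' : g ∈ R.op.UU) :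
    g = 1 := by
  ext a b
  rcases le_total (R.deg (rho A) a) (R.deg (rho A) b) with hab | hab
  · exact (R.UU_le_unipotent hA h a b hab).1
  · exact R.op_UU_apply hA h' hab

/-- In negative degree c the linear term of exp M would be a visible entry in a position where
elements of U_+ agree with 1. In degree 0, exp(tM) would be 1 for all t, forcing M = 0. -/
theorem degree_pos_of_mem_UU (hA : IsCartan A) {M : Matrix (Fin d) (Fin d) ℂ} {c : ℤ}
    (hM : M ≠ 0) (h : IsHomog (R.deg (rho A)) c M) (hU : ∀ t : ℂ, expUnit (t • M) ∈ R.UU) :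
    0 < c := by
  by_contra hc
  have h1 := fun t => R.UU_le_unipotent hA (hU t)
  rcases (not_lt.mp hc).lt_or_eq with hc | rfl
  · obtain ⟨a, b, hab⟩ : ∃ a b, M a b ≠ 0 := by
      by_contra! h0
      exact hM (Matrix.ext h0)
    have hd := h a b hab
    have := (h1 1 a b (by omega)).1
    rw [one_smul] at this
    change NormedSpace.exp M a b = _ at this
    rw [h.exp_apply hc.ne (n := 1) (by simpa using hd),
      Matrix.one_apply_ne (by rintro rfl; omega)] at this
    simp at this
    exact hab this
  · refine hM (Matrix.eq_zero_of_exp_smul_eq_one fun t => ?_)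
    ext a b
    by_cases hab : R.deg (rho A) a = R.deg (rho A) b
    · exact (h1 t a b hab.le).1
    · rw [Matrix.one_apply_ne (by rintro rfl; exact hab rfl)]
      by_contra h0
      obtain ⟨n, hn⟩ := (h.smul t).exists_of_exp_apply_ne_zero h0
      simp at hn
      exact hab hn

/-- The unipotent radical of the `i`-th minimal parabolic subgroup. -/
def NN (i : Fin r) : Subgroup (GL (Fin d) ℂ) :=
  Subgroup.closure {g | ∃ j, j ≠ i ∧ ∃ s t, g = R.xx i s * R.xx j t * (R.xx i s)⁻¹}

theorem xx_conj_NN (i : Fin r) (a : ℂ) {n : GL (Fin d) ℂ} (hn : n ∈ R.NN i) :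
    R.xx i a * n * (R.xx i a)⁻¹ ∈ R.NN i :=
  conj_mem_of_closure (by
    rintro _ ⟨j, hj, s, t, rfl⟩
    refine Subgroup.subset_closure ⟨j, hj, a + s, t, ?_⟩
    rw [xx_add]; group) hn

theorem tor_conj_NN (i : Fin r) (lam : Fin r → ℤ) (t : ℂˣ) {n : GL (Fin d) ℂ} (hn : n ∈ R.NN i) :
    R.tor lam t * n * (R.tor lam t)⁻¹ ∈ R.NN i :=
  conj_mem_of_closure (by
    rintro _ ⟨j, hj, s, u, rfl⟩
    refine Subgroup.subset_closure ⟨j, hj, (t ^ alpha A i lam : ℂˣ) * s,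
      (t ^ alpha A j lam : ℂˣ) * u, ?_⟩
    rw [← R.tor_conj_xx lam t i, ← R.tor_conj_xx lam t j]; group) hn

theorem exists_eq_xx_mul (i : Fin r) {u : GL (Fin d) ℂ} (hu : u ∈ R.UU) :
    ∃ a, ∃ n ∈ R.NN i, u = R.xx i a * n := by
  induction hu using Subgroup.closure_induction with
  | mem x hx =>
    obtain ⟨j, t, rfl⟩ := hx
    by_cases h : j = i
    · subst h
      exact ⟨t, 1, Subgroup.one_mem _, by rw [mul_one]⟩
    · exact ⟨0, R.xx j t, Subgroup.subset_closure ⟨j, h, 0, t, by simp [xx_zero]⟩,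
        by rw [xx_zero, one_mul]⟩
  | one => exact ⟨0, 1, Subgroup.one_mem _, by rw [xx_zero, mul_one]⟩
  | mul x y _ _ hx hy =>
    obtain ⟨a, n, hn, rfl⟩ := hx
    obtain ⟨b, m, hm, rfl⟩ := hy
    refine ⟨a + b, _, Subgroup.mul_mem _ (R.xx_conj_NN i (-b) hn) hm, ?_⟩
    rw [xx_add, xx_neg]; group
  | inv x _ hx =>
    obtain ⟨a, n, hn, rfl⟩ := hx
    refine ⟨-a, _, R.xx_conj_NN i a (Subgroup.inv_mem _ hn), ?_⟩
    rw [xx_neg]; group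

theorem ss_mul_self (hA : IsCartan A) (i : Fin r) :
    R.ss i * R.ss i = R.tor (Pi.single i 1) (-1) := by
  rw [← R.xx_yy_xx i (hA.diag i) (-1)]
  simp [ss]

theorem ss_mul_xx (hA : IsCartan A) (i : Fin r) (s : ℂˣ) :
    R.ss i * R.xx i s =
      R.xx i (-((s⁻¹ : ℂˣ) : ℂ)) * R.tor (Pi.single i 1) s⁻¹ * R.yy i ((s⁻¹ : ℂˣ) : ℂ) := by
  have h1 := R.ss_conj_xx i (hA.diag i) s
  have h2 := R.ss_conj_yy i (hA.diag i) ((s⁻¹ : ℂˣ) : ℂ)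
  have h3 := R.xx_yy_xx i (hA.diag i) s⁻¹
  rw [inv_inv] at h3
  rw [mul_inv_eq_iff_eq_mul] at h1 h2
  rw [← h3, h1, xx_neg]
  rw [xx_neg] at h2
  simp only [mul_assoc]
  rw [h2]; group

/-- For a generator x_i(s) x_j(t) x_i(s)⁻¹ with s ≠ 0, `ss_mul_xx` rewrites ṡ_i x_i(s) as a product
ending in y_i. The factor y_i commutes with x_j and disappears. The case s = 0 is `ss_conj_xx_mem`.
-/
theorem ss_conj_NN (hA : IsCartan A) (i : Fin r) {n : GL (Fin d) ℂ} (hn : n ∈ R.NN i) :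
    R.ss i * n * (R.ss i)⁻¹ ∈ R.UU :=
  conj_mem_of_closure (by
    rintro _ ⟨j, hj, s, t, rfl⟩
    by_cases hs : s = 0
    · subst hs
      simpa [xx_zero] using R.ss_conj_xx_mem hA hj.symm t
    · lift s to ℂˣ using (isUnit_iff_ne_zero.mpr hs)
      have e : R.ss i * (R.xx i s * R.xx j t * (R.xx i s)⁻¹) * (R.ss i)⁻¹ =
          (R.ss i * R.xx i s) * R.xx j t * (R.ss i * R.xx i s)⁻¹ := by group
      have hc := R.commute_xx_yy hj t ((s⁻¹ : ℂˣ) : ℂ)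
      have e2 : (R.ss i * R.xx i s) * R.xx j t * (R.ss i * R.xx i s)⁻¹ =
          R.xx i (-((s⁻¹ : ℂˣ) : ℂ)) * (R.tor (Pi.single i 1) s⁻¹ * R.xx j t *
            (R.tor (Pi.single i 1) s⁻¹)⁻¹) * (R.xx i (-((s⁻¹ : ℂˣ) : ℂ)))⁻¹ := by
        rw [R.ss_mul_xx hA, mul_assoc _ (R.yy i _), ← hc.eq]; group
      rw [e, e2, tor_conj_xx]
      exact R.UU.mul_mem (R.UU.mul_mem (R.xx_mem_UU _ _) (R.xx_mem_UU _ _))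
        (R.UU.inv_mem (R.xx_mem_UU _ _))) hn

theorem ss_inv_conj_NN (hA : IsCartan A) (i : Fin r) {n : GL (Fin d) ℂ} (hn : n ∈ R.NN i) :
    (R.ss i)⁻¹ * n * R.ss i ∈ R.UU := by
  have h := R.ss_conj_NN hA i (R.tor_conj_NN i (Pi.single i 1) (-1)⁻¹ hn)
  rw [← tor_inv, ← R.ss_mul_self hA i] at h
  convert h using 1
  group

theorem NN_le_unipotent (hA : IsCartan A) (i : Fin r) :
    R.NN i ≤ unipotent (R.deg (rho A - coweight A i)) := by
  -- This coweight vanishes on α_i and is positive on the other simple roots: x_i preserves the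
  -- grading while the other x_j raise it.
  have hdeg : ∀ j, alpha A j (rho A - coweight A i) = if j = i then 0 else A.det ^ 2 := by
    intro j
    rw [alpha_sub, alpha_rho, alpha_coweight]
    split_ifs <;> simp
  set φ := R.deg (rho A - coweight A i)
  have hxi : ∀ s a b, (R.xx i s : Matrix (Fin d) (Fin d) ℂ) a b ≠ 0 → φ a = φ b := by
    intro s a b hab
    have h : IsHomog φ 0 (s • R.e i) := by
      have := (R.isHomog_e (rho A - coweight A i) i).smul s
      rwa [hdeg, if_pos rfl] at this
    obtain ⟨n, hn⟩ := h.exists_of_exp_apply_ne_zero hab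
    simpa using hn
  have key : ∀ (s : ℂ) (g : GL (Fin d) ℂ), (∀ a b, φ a ≤ φ b →
      (g : Matrix (Fin d) (Fin d) ℂ) a b = (1 : Matrix (Fin d) (Fin d) ℂ) a b) →
      ∀ a b, φ a ≤ φ b → ((R.xx i s * g * (R.xx i s)⁻¹ : GL (Fin d) ℂ) :
        Matrix (Fin d) (Fin d) ℂ) a b = (1 : Matrix (Fin d) (Fin d) ℂ) a b := by
    intro s g hg a b hab
    have e : ((R.xx i s * g * (R.xx i s)⁻¹ : GL (Fin d) ℂ) : Matrix (Fin d) (Fin d) ℂ) a b -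
        (1 : Matrix (Fin d) (Fin d) ℂ) a b = ((R.xx i s : Matrix (Fin d) (Fin d) ℂ) *
          ((g : Matrix (Fin d) (Fin d) ℂ) - 1) * (R.xx i (-s) : Matrix (Fin d) (Fin d) ℂ)) a b := by
      rw [← Matrix.sub_apply, mul_sub, sub_mul, mul_one, ← Units.val_mul (R.xx i s) (R.xx i (-s)),
        xx_neg, mul_inv_cancel, Units.val_mul, Units.val_mul, Units.val_one]
    rw [← sub_eq_zero, e]
    by_contra h0
    rw [Matrix.mul_apply] at h0
    obtain ⟨c, -, hc⟩ := Finset.exists_ne_zero_of_sum_ne_zero h0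
    have h1 := hxi _ _ _ (right_ne_zero_of_mul hc)
    have hc' := left_ne_zero_of_mul hc
    rw [Matrix.mul_apply] at hc'
    obtain ⟨c', -, hc''⟩ := Finset.exists_ne_zero_of_sum_ne_zero hc'
    have h2 := hxi _ _ _ (left_ne_zero_of_mul hc'')
    refine right_ne_zero_of_mul hc'' ?_
    rw [Matrix.sub_apply, hg _ _ (by omega), sub_self]
  rw [NN, Subgroup.closure_le]
  rintro _ ⟨j, hj, s, t, rfl⟩
  have hxj : R.xx j t ∈ unipotent φ := by
    refine expUnit_mem_unipotent ((R.isHomog_e (rho A - coweight A i) j).smul t) ?_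
    rw [hdeg, if_neg hj]; exact R.det_sq_pos hA
  intro a b hab
  refine ⟨key s _ (fun a b h => (hxj a b h).1) a b hab, ?_⟩
  have e : (R.xx i s * R.xx j t * (R.xx i s)⁻¹)⁻¹ = R.xx i s * (R.xx j t)⁻¹ * (R.xx i s)⁻¹ := by
    group
  rw [e]
  exact key s _ (fun a b h => (hxj a b h).2) a b hab

/-- A root subgroup in `U_+` either lies in the radical `NN i` or is `x_i`. -/
theorem mem_NN_or_eq_xx (hA : IsCartan A) (i : Fin r) {M : Matrix (Fin d) (Fin d) ℂ}
    {β : (Fin r → ℤ) → ℤ} (hM : ∀ lam, IsHomog (R.deg lam) (β lam) M)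
    (hU : ∀ t : ℂ, expUnit (t • M) ∈ R.UU) :
    (∀ t : ℂ, expUnit (t • M) ∈ R.NN i) ∨ ∀ t : ℂ, ∃ a, expUnit (t • M) = R.xx i a := by
  set ph := rho A - coweight A i
  have hi : alpha A i ph = 0 := by
    rw [alpha_sub, alpha_rho, alpha_coweight, if_pos rfl, sub_self]
  have hxi : ∀ s a b, (R.xx i s : Matrix (Fin d) (Fin d) ℂ) a b ≠ 0 → R.deg ph a = R.deg ph b := by
    intro s a b hab
    have h : IsHomog (R.deg ph) 0 (s • R.e i) := by
      have := (R.isHomog_e ph i).smul s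
      rwa [hi] at this
    obtain ⟨n, hn⟩ := h.exists_of_exp_apply_ne_zero hab
    simpa using hn
  have hlevel : ∀ s, ∀ n ∈ R.NN i, ∀ a b, R.deg ph a = R.deg ph b →
      ((R.xx i s * n : GL (Fin d) ℂ) : Matrix (Fin d) (Fin d) ℂ) a b =
        (R.xx i s : Matrix (Fin d) (Fin d) ℂ) a b := by
    intro s n hn a b hab
    rw [Units.val_mul, Matrix.mul_apply, Finset.sum_eq_single b]
    · rw [(R.NN_le_unipotent hA i hn b b le_rfl).1, Matrix.one_apply_eq, mul_one]
    · intro c _ hc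
      by_cases h0 : (R.xx i s : Matrix (Fin d) (Fin d) ℂ) a c = 0
      · rw [h0, zero_mul]
      · rw [(R.NN_le_unipotent hA i hn c b (by rw [← hab, hxi s a c h0])).1,
          Matrix.one_apply_ne hc, mul_zero]
    · simp
  -- If M preserves the grading, exp(tM) has only its degree-preserving entries, and these are those
  -- of x_i(s). Otherwise those entries are trivial, so x_i(s) = 1 and only the factor in N_i
  -- remains.
  by_cases hb : β ph = 0
  · right
    intro t
    obtain ⟨s, n, hn, h⟩ := R.exists_eq_xx_mul i (hU t)
    refine ⟨s, ?_⟩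
    ext a b
    by_cases hab : R.deg ph a = R.deg ph b
    · rw [h, hlevel s n hn a b hab]
    · have h1 : (R.xx i s : Matrix (Fin d) (Fin d) ℂ) a b = 0 := by
        by_contra h0
        exact hab (hxi s a b h0)
      rw [h1]
      by_contra h0
      obtain ⟨m, hm⟩ := ((hM ph).smul t).exists_of_exp_apply_ne_zero h0
      rw [hb] at hm
      exact hab (by simpa using hm)
  · left
    intro t
    obtain ⟨s, n, hn, h⟩ := R.exists_eq_xx_mul i (hU t)
    have : R.xx i s = 1 := by
      ext a b
      by_cases hab : R.deg ph a = R.deg ph b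
      · rw [← hlevel s n hn a b hab, ← h]
        change NormedSpace.exp (t • M) a b = _
        rw [((hM ph).smul t).exp_apply hb (n := 0) (by simpa using hab)]
        simp
      · rw [Units.val_one, Matrix.one_apply_ne (by rintro rfl; exact hab rfl)]
        by_contra h0
        exact hab (hxi s a b h0)
    rw [h, this, one_mul]
    exact hn

end ChevalleyRep
end Weave

namespace Weave

namespace ChevalleyRep

variable {r d : ℕ} {A : Matrix (Fin r) (Fin r) ℤ} (R : ChevalleyRep A d)

/-! ## Roots are positive or negative; the exchange condition -/

/-- `g` is a product of elements `ṡ_i^{±1}` along the word `j`. -/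
inductive IsLift : List (Fin r) → GL (Fin d) ℂ → Prop
  | nil : IsLift [] 1
  | snoc {j : List (Fin r)} {g : GL (Fin d) ℂ} (i : Fin r) (p : GL (Fin d) ℂ) (h : IsLift j g)
      (hp : p = R.ss i ∨ p = (R.ss i)⁻¹) : IsLift (j ++ [i]) (g * p)

theorem isLift_prod (j : List (Fin r)) : R.IsLift j (j.map R.ss).prod := by
  induction j using List.reverseRecOn with
  | nil => exact IsLift.nil
  | append_singleton j i ih =>
    rw [List.map_append, List.prod_append]
    simpa using IsLift.snoc i _ ih (Or.inl rfl)

/-- Both signs are allowed in `IsLift` for this purpose: passing to `R.op` inverts every ṡ_i. -/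
theorem IsLift.op (hA : IsCartan A) {j : List (Fin r)} {g : GL (Fin d) ℂ} (h : R.IsLift j g) :
    R.op.IsLift j g := by
  induction h with
  | nil => exact IsLift.nil
  | snoc i p _ hp ih =>
    refine IsLift.snoc i p ih ?_
    rw [R.op_ss i (hA.diag i), inv_inv]
    exact hp.symm

theorem Ad_ss_inv_hx (hA : IsCartan A) (i : Fin r) (lam : Fin r → ℤ) :
    Ad (R.ss i)⁻¹ (R.hx lam) = R.hx (simpleRefl A i lam) := by
  have e : simpleRefl A i (simpleRefl A i lam) = lam :=
    DFunLike.congr_fun (simpleRefl_mul_self hA i) lam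
  rw [← congrArg R.hx e, ← R.Ad_ss_hx i (hA.diag i), Ad_inv_Ad]

theorem IsLift.Ad_hx {R : ChevalleyRep A d} (hA : IsCartan A) {j : List (Fin r)}
    {g : GL (Fin d) ℂ} (h : R.IsLift j g)
    (lam : Fin r → ℤ) : Ad g (R.hx lam) = R.hx (weyl A j lam) := by
  induction h generalizing lam with
  | nil => rw [Ad_one]; rfl
  | snoc i p _ hp ih =>
    have : Ad p (R.hx lam) = R.hx (simpleRefl A i lam) := by
      rcases hp with rfl | rfl
      · exact R.Ad_ss_hx i (hA.diag i) lam
      · exact R.Ad_ss_inv_hx hA i lam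
    rw [Ad_mul, this, ih, weyl_append, weyl_singleton]; rfl

theorem IsLift.isHomog {R : ChevalleyRep A d} (hA : IsCartan A) {j : List (Fin r)}
    {g : GL (Fin d) ℂ} (h : R.IsLift j g)
    (k : Fin r) (lam : Fin r → ℤ) :
    IsHomog (R.deg lam) (alpha A k (weyl A j lam)) (Ad g⁻¹ (R.e k)) := by
  rw [isHomog_iff, ← Ad_inv_Ad g (R.hx lam), ← Ad_lie, h.Ad_hx hA, R.lie_hx_e, map_smul]

theorem e_ne_zero (k : Fin r) : R.e k ≠ 0 := by
  intro h
  have h1 := R.lie_e_f_self k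
  rw [h, zero_bracket] at h1
  have h2 : R.hx (Pi.single k 1) = R.hx 0 := by
    rw [← h1]; simp [hx, deg]
  have := congrFun (R.hx_injective h2) k
  simp at this

/-- A simple reflection changes the sign of no positive root other than its own: a root subgroup in
N_i stays in U_+, and x_i goes to y_i. -/
theorem conj_root_subgroup (hA : IsCartan A) (i : Fin r) {M : Matrix (Fin d) (Fin d) ℂ}
    {β : (Fin r → ℤ) → ℤ} (hM : ∀ lam, IsHomog (R.deg lam) (β lam) M)
    (hU : ∀ t : ℂ, expUnit (t • M) ∈ R.UU) {p : GL (Fin d) ℂ}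
    (hp : p = R.ss i ∨ p = (R.ss i)⁻¹) :
    (∀ t : ℂ, p⁻¹ * expUnit (t • M) * p ∈ R.UU) ∨
    ((∀ t : ℂ, p⁻¹ * expUnit (t • M) * p ∈ R.op.UU) ∧ ∀ t : ℂ, ∃ a, expUnit (t • M) = R.xx i a) := by
  rcases R.mem_NN_or_eq_xx hA i hM hU with h | h
  · left
    intro t
    rcases hp with rfl | rfl
    · exact R.ss_inv_conj_NN hA i (h t)
    · rw [inv_inv]; exact R.ss_conj_NN hA i (h t)
  · refine Or.inr ⟨fun t => ?_, h⟩
    obtain ⟨a, ha⟩ := h t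
    rw [ha]
    rcases hp with rfl | rfl
    · have := R.ss_conj_yy i (hA.diag i) (-a)
      rw [_root_.neg_neg] at this
      rw [← this]
      convert R.yy_mem_op_UU i (-a) using 1
      group
    · rw [inv_inv, R.ss_conj_xx i (hA.diag i)]; exact R.yy_mem_op_UU i (-a)

theorem IsLift.root_subgroup {R : ChevalleyRep A d} (hA : IsCartan A) {j : List (Fin r)}
    {g : GL (Fin d) ℂ} (h : R.IsLift j g) (k : Fin r) :
    (∀ t : ℂ, expUnit (t • Ad g⁻¹ (R.e k)) ∈ R.UU) ∨
    (∀ t : ℂ, expUnit (t • Ad g⁻¹ (R.e k)) ∈ R.op.UU) := by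
  induction h with
  | nil => left; intro t; rw [inv_one, Ad_one]; exact R.xx_mem_UU k t
  | @snoc j g i p h hp ih =>
    have e : ∀ t : ℂ, expUnit (t • Ad (g * p)⁻¹ (R.e k)) =
        p⁻¹ * expUnit (t • Ad g⁻¹ (R.e k)) * p := by
      intro t
      rw [_root_.mul_inv_rev, Ad_mul, ← map_smul, ← conj_expUnit, inv_inv]
    simp only [e]
    rcases ih with ih | ih
    · rcases R.conj_root_subgroup hA i (h.isHomog hA k) ih hp with h | h
      exacts [Or.inl h, Or.inr h.1]
    · have hp' : p = R.op.ss i ∨ p = (R.op.ss i)⁻¹ := by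
        rw [R.op_ss i (hA.diag i), inv_inv]; exact hp.symm
      have hM : ∀ lam, IsHomog (R.op.deg lam) (-alpha A k (weyl A j lam)) (Ad g⁻¹ (R.e k)) := by
        intro lam a b hab
        rw [op_deg, op_deg, h.isHomog hA k lam a b hab]; ring
      rcases R.op.conj_root_subgroup hA i hM ih hp' with h | h
      exacts [Or.inr h, Or.inl h.1]

theorem Ad_e_ne_zero (g : GL (Fin d) ℂ) (k : Fin r) : Ad g (R.e k) ≠ 0 := by
  intro h
  have := Ad_inv_Ad g (R.e k)
  rw [h, map_zero] at this
  exact R.e_ne_zero k this.symm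

/-- Following the root subgroup of α_k through the word, one letter at a time, keeps it in U_+ or in
U_-. The degree for `rho` tells which, so the sign of a number decides a question about groups. -/
theorem IsLift.pos_or_neg {R : ChevalleyRep A d} (hA : IsCartan A) {j : List (Fin r)}
    {g : GL (Fin d) ℂ} (h : R.IsLift j g) (k : Fin r) :
    (0 < alpha A k (weyl A j (rho A)) ∧ ∀ t : ℂ, g⁻¹ * R.xx k t * g ∈ R.UU) ∨
    (alpha A k (weyl A j (rho A)) < 0 ∧ ∀ t : ℂ, g⁻¹ * R.xx k t * g ∈ R.op.UU) := by
  have e : ∀ t : ℂ, g⁻¹ * R.xx k t * g = expUnit (t • Ad g⁻¹ (R.e k)) := by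
    intro t
    rw [← map_smul, ← conj_expUnit, inv_inv, xx]
  simp only [e]
  have hM := h.isHomog hA k (rho A)
  rcases h.root_subgroup hA k with h1 | h1
  · exact Or.inl ⟨R.degree_pos_of_mem_UU hA (R.Ad_e_ne_zero _ k) hM h1, h1⟩
  · refine Or.inr ⟨?_, h1⟩
    have := R.op.degree_pos_of_mem_UU hA (R.Ad_e_ne_zero g⁻¹ k)
      (c := -alpha A k (weyl A j (rho A))) (by
        intro a b hab
        rw [op_deg, op_deg, hM a b hab]; ring) h1
    omega

theorem alpha_eq_of_exp_eq_xx (hA : IsCartan A) {i : Fin r} {M : Matrix (Fin d) (Fin d) ℂ}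
    {β : (Fin r → ℤ) → ℤ} (hM : ∀ lam, IsHomog (R.deg lam) (β lam) M) (hM0 : M ≠ 0)
    (hpos : 0 < β (rho A)) {a : ℂ} (h : expUnit M = R.xx i a) (lam : Fin r → ℤ) :
    β lam = alpha A i lam := by
  -- A nonzero entry of M is an entry of exp M, hence of exp N, so some power of N has it as well;
  -- comparing degrees makes β a multiple of γ. Used in both directions, the two multipliers have
  -- product 1.
  have key : ∀ {M N : Matrix (Fin d) (Fin d) ℂ} {β γ : (Fin r → ℤ) → ℤ},
      (∀ lam, IsHomog (R.deg lam) (β lam) M) → (∀ lam, IsHomog (R.deg lam) (γ lam) N) →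
      M ≠ 0 → 0 < β (rho A) → NormedSpace.exp M = NormedSpace.exp N →
      ∃ n : ℕ, ∀ lam, β lam = n * γ lam := by
    intro M N β γ hM hN hM0 hpos h
    obtain ⟨p, q, hpq⟩ : ∃ p q, M p q ≠ 0 := by
      by_contra! h0
      exact hM0 (Matrix.ext h0)
    have h1 : NormedSpace.exp M p q = M p q := by
      rw [(hM (rho A)).exp_apply hpos.ne' (n := 1) (by simpa using hM (rho A) p q hpq)]; simp
    rw [h] at h1
    obtain ⟨n, hn⟩ : ∃ n : ℕ, (N ^ n) p q ≠ 0 := by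
      by_contra! h0
      refine hpq (h1.symm.trans ((Matrix.hasSum_exp_apply N p q).unique ?_))
      simp only [h0, mul_zero]
      exact hasSum_zero
    refine ⟨n, fun lam => ?_⟩
    have e1 := (hN lam).pow n p q hn
    have e2 := hM lam p q hpq
    omega
  have hN : ∀ lam, IsHomog (R.deg lam) (alpha A i lam) (a • R.e i) := fun lam =>
    (R.isHomog_e lam i).smul a
  have hexp : NormedSpace.exp M = NormedSpace.exp (a • R.e i) := congrArg Units.val h
  have hrho : 0 < alpha A i (rho A) := by rw [alpha_rho]; exact R.det_sq_pos hA
  obtain ⟨n, hn⟩ := key hM hN hM0 hpos hexp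
  have ha : a • R.e i ≠ 0 := by
    intro h0
    rw [h0] at hexp
    have hz : ∀ lam, IsHomog (R.deg lam) ((fun _ => 0 : (Fin r → ℤ) → ℤ) lam)
        (0 : Matrix (Fin d) (Fin d) ℂ) := fun lam a b hab => absurd rfl hab
    obtain ⟨m, hm⟩ := key hM hz hM0 hpos hexp
    rw [hm] at hpos
    simp at hpos
  obtain ⟨m, hm⟩ := key hN hM ha hrho hexp.symm
  have h1 := hn (rho A)
  rw [hm (rho A), ← mul_assoc] at h1
  have h2 : (n : ℤ) * m = 1 := by
    have : ((n : ℤ) * m - 1) * β (rho A) = 0 := by linear_combination -h1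
    rcases mul_eq_zero.mp this with h | h <;> omega
  have h3 : n = 1 := by
    have : n * m = 1 := by exact_mod_cast h2
    exact Nat.eq_one_of_mul_eq_one_right this
  rw [hn lam, h3]; simp

-- Between the empty prefix and the whole word, the root α_k∘w changes sign at some letter i. Just
-- before that letter it must equal α_i, so s_k can be moved there and cancels the letter. The
-- negativity of the prefix is recorded to locate the deleted letter later.
include R in
theorem exchange (hA : IsCartan A) (j : List (Fin r)) (k : Fin r)
    (hneg : alpha A k (weyl A j (rho A)) < 0) : ∃ n < j.length,
      alpha A k (weyl A (j.take (n + 1)) (rho A)) < 0 ∧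
      simpleRefl A k * weyl A j = weyl A (j.eraseIdx n) := by
  induction j using List.reverseRecOn with
  | nil =>
    rw [weyl_nil, Module.End.one_apply, alpha_rho] at hneg
    exact absurd hneg (R.det_sq_pos hA).not_gt
  | append_singleton j i ih =>
    have hl := R.isLift_prod j
    rcases hl.pos_or_neg hA k with ⟨hpos, hU⟩ | ⟨hn, -⟩
    · refine ⟨j.length, by simp, ?_, ?_⟩
      · rwa [List.take_of_length_le (by simp)]
      · set g := (j.map R.ss).prod
        have e : ∀ t : ℂ, g⁻¹ * R.xx k t * g = expUnit (t • Ad g⁻¹ (R.e k)) := by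
          intro t
          rw [← map_smul, ← conj_expUnit, inv_inv, xx]
        simp only [e] at hU
        have hM := hl.isHomog hA k
        -- If the root subgroup lay in N_i, it would still be in U_+ after conjugation by ṡ_i,
        -- contradicting the negative sign.
        have hx : ∃ a, expUnit (Ad g⁻¹ (R.e k)) = R.xx i a := by
          rcases R.conj_root_subgroup hA i hM hU (Or.inl rfl) with h | h
          · exfalso
            have hg : R.IsLift (j ++ [i]) (g * R.ss i) := IsLift.snoc i _ hl (Or.inl rfl)
            have := R.degree_pos_of_mem_UU hA (R.Ad_e_ne_zero _ k) (hg.isHomog hA k (rho A)) (by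
              intro t
              rw [_root_.mul_inv_rev, Ad_mul, ← map_smul, ← conj_expUnit, inv_inv]
              exact h t)
            omega
          · simpa using h.2 1
        obtain ⟨a, ha⟩ := hx
        have hα := R.alpha_eq_of_exp_eq_xx hA hM (R.Ad_e_ne_zero _ k) hpos ha
        have := R.mul_weyl_of_alpha hA hα
        rw [weyl_append, weyl_singleton, ← mul_assoc, this, mul_simpleRefl_cancel hA,
          List.eraseIdx_append_of_length_le le_rfl]
        simp
    · obtain ⟨n, hn, h1, h2⟩ := ih hn
      refine ⟨n, by simp; omega, ?_, ?_⟩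
      · rwa [List.take_append_of_le_length (by omega)]
      · rw [weyl_append, ← mul_assoc, h2, List.eraseIdx_append_of_lt_length hn, weyl_append]

include R in
theorem alpha_pos_of_isReduced (hA : IsCartan A) {k : Fin r} {j : List (Fin r)}
    (h : IsReduced A (k :: j)) : 0 < alpha A k (weyl A j (rho A)) := by
  rcases (R.isLift_prod j).pos_or_neg hA k with ⟨hpos, -⟩ | ⟨hneg, -⟩
  · exact hpos
  · obtain ⟨n, hn, -, h2⟩ := R.exchange hA j k hneg
    have := h (j.eraseIdx n) (by rw [weyl_cons, h2])
    rw [List.length_eraseIdx_of_lt hn, List.length_cons] at this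
    omega

/-! ## Lifts of Weyl group elements do not depend on the reduced word -/

include R in
theorem coxOrder_cases (hA : IsCartan A) {i j : Fin r} (hij : i ≠ j) :
    (coxOrder A i j = 2 ∧ A i j = 0 ∧ A j i = 0) ∨ (coxOrder A i j = 3 ∧ A i j = -1 ∧ A j i = -1) ∨
    (coxOrder A i j = 4 ∧ A i j = -2 ∧ A j i = -1) ∨ (coxOrder A i j = 4 ∧ A i j = -1 ∧ A j i = -2) ∨
    (coxOrder A i j = 6 ∧ A i j = -3 ∧ A j i = -1) ∨
    (coxOrder A i j = 6 ∧ A i j = -1 ∧ A j i = -3) := by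
  obtain ⟨m, hm, hm3⟩ := R.exists_cartan_eq_neg hA hij
  obtain ⟨n, hn, hn3⟩ := R.exists_cartan_eq_neg hA hij.symm
  have h := R.cartan_mul_lt hA hij
  have h1 := hA.zero i j
  have h2 := hA.zero j i
  rw [coxOrder]
  rw [hm, hn] at *
  interval_cases m <;> interval_cases n <;> simp_all

theorem ss_braid (hA : IsCartan A) {i j : Fin r} (hij : i ≠ j) :
    ((altWord (coxOrder A i j) i j).map R.ss).prod =
      ((altWord (coxOrder A i j) j i).map R.ss).prod := by
  rcases R.coxOrder_cases hA hij with ⟨h, h1, h2⟩ | ⟨h, h1, h2⟩ | ⟨h, h1, h2⟩ | ⟨h, h1, h2⟩ |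
    ⟨h, h1, h2⟩ | ⟨h, h1, h2⟩ <;> rw [h] <;>
    simp only [altWord, List.map_cons, List.map_nil, List.prod_cons, List.prod_nil, mul_one,
      ← mul_assoc]
  · exact R.ss_braid_two hij h1
  · exact R.ss_braid_three hA hij h1 h2
  · exact R.ss_braid_four hA hij h1 h2
  · exact (R.ss_braid_four hA hij.symm h2 h1).symm
  · exact R.ss_braid_six hA hij h1 h2
  · exact (R.ss_braid_six hA hij.symm h2 h1).symm

theorem weyl_eq_of_prod_eq (hA : IsCartan A) {j k : List (Fin r)}
    (h : (j.map R.ss).prod = (k.map R.ss).prod) : weyl A j = weyl A k := by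
  refine LinearMap.ext fun lam => R.hx_injective ?_
  rw [← (R.isLift_prod j).Ad_hx hA, ← (R.isLift_prod k).Ad_hx hA, h]

include R in
theorem weyl_braid (hA : IsCartan A) {i j : Fin r} (hij : i ≠ j) :
    weyl A (altWord (coxOrder A i j) i j) = weyl A (altWord (coxOrder A i j) j i) :=
  R.weyl_eq_of_prod_eq hA (R.ss_braid hA hij)

-- An explicit evaluation in each rank two type; it rules out deletions inside an alternating prefix
-- that is shorter than the Coxeter order.
include R in
theorem alpha_altWord_pos (hA : IsCartan A) {i j : Fin r} (hij : i ≠ j) {n : ℕ}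
    (hn : n < coxOrder A i j) : 0 < alpha A j (weyl A (altWord n i j) (rho A)) := by
  have hN := R.det_sq_pos hA
  have hi := hA.diag i
  have hj := hA.diag j
  rcases R.coxOrder_cases hA hij with ⟨h, h1, h2⟩ | ⟨h, h1, h2⟩ | ⟨h, h1, h2⟩ | ⟨h, h1, h2⟩ |
    ⟨h, h1, h2⟩ | ⟨h, h1, h2⟩ <;> rw [h] at hn <;> interval_cases n <;>
    simp only [altWord, weyl_cons, weyl_nil, Module.End.mul_apply, Module.End.one_apply,
      alpha_simpleRefl, alpha_rho, hi, hj, h1, h2] <;> linarith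

-- If i and j are both left descents, exchange prepends their letters alternately. The deleted
-- letter is never in the alternating prefix, by `alpha_altWord_pos`, so the prefix grows until it
-- has length m_ij.
include R in
theorem exists_altWord_append (hA : IsCartan A) {u : List (Fin r)} {i j : Fin r}
    (hij : i ≠ j) (hi : alpha A i (weyl A u (rho A)) < 0) (hj : alpha A j (weyl A u (rho A)) < 0)
    {n : ℕ} (hn : n ≤ coxOrder A i j) :
    ∃ x y v, ((x = i ∧ y = j) ∨ (x = j ∧ y = i)) ∧ weyl A (altWord n x y ++ v) = weyl A u ∧
      (altWord n x y ++ v).length = u.length := by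
  induction n with
  | zero => exact ⟨i, j, u, Or.inl ⟨rfl, rfl⟩, rfl, rfl⟩
  | succ n ih =>
    obtain ⟨x, y, v, hxy, hw, hl⟩ := ih (by omega)
    have hy : alpha A y (weyl A (altWord n x y ++ v) (rho A)) < 0 := by
      rw [hw]; rcases hxy with ⟨-, rfl⟩ | ⟨-, rfl⟩ <;> assumption
    have hne : x ≠ y := by
      rcases hxy with ⟨rfl, rfl⟩ | ⟨rfl, rfl⟩
      exacts [hij, hij.symm]
    have hm : n < coxOrder A x y := by
      rcases hxy with ⟨rfl, rfl⟩ | ⟨rfl, rfl⟩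
      exacts [by omega, by rw [coxOrder_comm]; omega]
    obtain ⟨k, hk, h1, h2⟩ := R.exchange hA _ _ hy
    have hnk : n ≤ k := by
      by_contra! hlt
      rw [List.take_append_of_le_length (by rw [length_altWord]; omega),
        take_altWord (by omega)] at h1
      exact absurd h1 (R.alpha_altWord_pos hA hne (by omega)).not_gt
    rw [List.eraseIdx_append_of_length_le (by rw [length_altWord]; omega), length_altWord] at h2
    refine ⟨y, x, v.eraseIdx (k - n), hxy.symm.imp And.symm And.symm, ?_, ?_⟩
    · rw [altWord, List.cons_append, weyl_cons, ← h2, simpleRefl_mul_cancel hA, hw]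
    · rw [List.length_append, length_altWord] at hk hl ⊢
      rw [List.length_eraseIdx_of_lt (by omega)]
      omega

/-- The theorem of Matsumoto and Tits, by induction on the length. Words with the same first letter
reduce to their tails. Words starting with a ≠ b are linked through two words starting with the
alternating words in a and b, which a braid relation identifies. -/
theorem prod_ss_eq (hA : IsCartan A) : ∀ {u v : List (Fin r)}, IsReduced A u → IsReduced A v →
    weyl A u = weyl A v → (u.map R.ss).prod = (v.map R.ss).prod := by
  have main : ∀ (n : ℕ) (u v : List (Fin r)), u.length = n → IsReduced A u → IsReduced A v →
      weyl A u = weyl A v → (u.map R.ss).prod = (v.map R.ss).prod := by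
    intro n
    induction n with
    | zero =>
      intro u v hn hu hv h
      have hl := hu.length_eq hv h
      rw [List.length_eq_zero_iff.mp hn, List.length_eq_zero_iff.mp (hl.symm.trans hn)]
    | succ n ih =>
      have hcons : ∀ (a : Fin r) (u v : List (Fin r)), (a :: u).length = n + 1 →
          IsReduced A (a :: u) → IsReduced A (a :: v) → weyl A (a :: u) = weyl A (a :: v) →
          ((a :: u).map R.ss).prod = ((a :: v).map R.ss).prod := by
        intro a u v hn hu hv h
        rw [List.map_cons, List.map_cons, List.prod_cons, List.prod_cons]
        congr 1
        refine ih u v (by simpa using hn) hu.of_cons hv.of_cons ?_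
        rw [weyl_cons, weyl_cons] at h
        rw [← simpleRefl_mul_cancel hA a (weyl A u), h, simpleRefl_mul_cancel hA]
      have hdesc : ∀ (a : Fin r) (u : List (Fin r)), IsReduced A (a :: u) →
          alpha A a (weyl A (a :: u) (rho A)) < 0 := by
        intro a u hu
        have := R.alpha_pos_of_isReduced hA hu
        rw [weyl_cons, Module.End.mul_apply, alpha_simpleRefl, hA.diag]
        omega
      intro u v hn hu hv h
      have hl := hu.length_eq hv h
      rcases u with _ | ⟨a, u⟩
      · simp at hn
      rcases v with _ | ⟨b, v⟩
      · simp at hl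
      by_cases hab : a = b
      · subst hab; exact hcons a u v hn hu hv h
      · obtain ⟨x, y, w, hxy, hw, hwl⟩ := R.exists_altWord_append hA hab (hdesc a u hu)
          (by rw [h]; exact hdesc b v hv) le_rfl
        have hw' : weyl A (altWord (coxOrder A a b) y x ++ w) = weyl A (a :: u) := by
          rw [← hw, weyl_append, weyl_append]
          rcases hxy with ⟨rfl, rfl⟩ | ⟨rfl, rfl⟩
          · rw [R.weyl_braid hA hab]
          · rw [R.weyl_braid hA hab]
        have hp : ((altWord (coxOrder A a b) a b ++ w).map R.ss).prod =
            ((altWord (coxOrder A a b) b a ++ w).map R.ss).prod := by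
          rw [List.map_append, List.map_append, List.prod_append, List.prod_append,
            R.ss_braid hA hab]
        have hwab : weyl A (altWord (coxOrder A a b) a b ++ w) = weyl A (a :: u) := by
          rcases hxy with ⟨rfl, rfl⟩ | ⟨rfl, rfl⟩ <;> assumption
        have hwba : weyl A (altWord (coxOrder A a b) b a ++ w) = weyl A (a :: u) := by
          rcases hxy with ⟨rfl, rfl⟩ | ⟨rfl, rfl⟩ <;> assumption
        have hlen : coxOrder A a b + w.length = (a :: u).length := by
          rw [← hwl, List.length_append, length_altWord]
        obtain ⟨m, hm⟩ : ∃ m, coxOrder A a b = m + 1 := by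
          rcases R.coxOrder_cases hA hab with h | h | h | h | h | h <;> exact ⟨_, h.1⟩
        rw [hm] at hp hwab hwba hlen
        rw [altWord, List.cons_append] at hwab
        rw [altWord, List.cons_append] at hwba
        rw [altWord, altWord, List.cons_append, List.cons_append] at hp
        have hla : (a :: (altWord m b a ++ w)).length = (a :: u).length := by
          rw [← hlen, List.length_cons, List.length_append, length_altWord]; omega
        have hlb : (b :: (altWord m a b ++ w)).length = (a :: u).length := by
          rw [← hlen, List.length_cons, List.length_append, length_altWord]; omega
        have hra := hu.congr hwab hla
        have hrb := hu.congr hwba hlb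
        rw [hcons a u _ hn hu hra hwab.symm, hp,
          hcons b _ v (hlb.trans hn) hrb hv (hwba.trans h)]
  intro u v hu hv h
  exact main _ u v rfl hu hv h

end ChevalleyRep
end Weave

namespace Weave

namespace ChevalleyRep

variable {r d : ℕ} {A : Matrix (Fin r) (Fin r) ℤ} (R : ChevalleyRep A d)

/-! ## Products of braid matrices -/

/-- The matrix of `B_i(z)`. -/
def bb (i : Fin r) (z : ℂ) : GL (Fin d) ℂ := R.xx i z * R.ss i

/-- The product of the braid matrices `B_i(z)`. -/
def bprod (l : List (Fin r × ℂ)) : GL (Fin d) ℂ := (l.map fun p => R.bb p.1 p.2).prod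

theorem bprod_nil : R.bprod [] = 1 := rfl

theorem bprod_cons (p : Fin r × ℂ) (l : List (Fin r × ℂ)) :
    R.bprod (p :: l) = R.bb p.1 p.2 * R.bprod l := by simp [bprod]

/-- The product of the lifts of the simple reflections of a word. -/
def wdot (j : List (Fin r)) : GL (Fin d) ℂ := (j.map R.ss).prod

theorem wdot_cons (i : Fin r) (j : List (Fin r)) : R.wdot (i :: j) = R.ss i * R.wdot j := by
  simp [wdot]

theorem isLift_wdot (j : List (Fin r)) : R.IsLift j (R.wdot j) := R.isLift_prod j

/-- By U_+ = x_i(ℂ)·N_i, the part of t x_i(z) outside N_i is absorbed in a new parameter, and the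
part in N_i passes through ṡ_i while staying in U_+. -/
theorem mul_bb (hA : IsCartan A) (i : Fin r) (z : ℂ) {t : GL (Fin d) ℂ} (ht : t ∈ R.UU) :
    ∃ f, ∃ t₁ ∈ R.UU, t * R.bb i z = R.bb i f * t₁ := by
  obtain ⟨a, n, hn, h⟩ := R.exists_eq_xx_mul i (R.UU.mul_mem ht (R.xx_mem_UU i z))
  refine ⟨a, _, R.ss_inv_conj_NN hA i hn, ?_⟩
  rw [bb, ← mul_assoc, h, bb]; group

theorem mul_bprod (hA : IsCartan A) (l : List (Fin r × ℂ)) {t : GL (Fin d) ℂ} (ht : t ∈ R.UU) :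
    ∃ l' : List (Fin r × ℂ), l'.map Prod.fst = l.map Prod.fst ∧
      ∃ t₁ ∈ R.UU, t * R.bprod l = R.bprod l' * t₁ := by
  induction l generalizing t with
  | nil => exact ⟨[], rfl, t, ht, by simp [bprod_nil]⟩
  | cons p l ih =>
    obtain ⟨f, t₁, ht₁, h⟩ := R.mul_bb hA p.1 p.2 ht
    obtain ⟨l', hl', t₂, ht₂, h'⟩ := ih ht₁
    refine ⟨(p.1, f) :: l', by simp [hl'], t₂, ht₂, ?_⟩
    rw [bprod_cons, bprod_cons, ← mul_assoc, h, mul_assoc, h', mul_assoc]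

theorem wdot_eq_bprod (j : List (Fin r)) : R.wdot j = R.bprod (j.map fun i => (i, 0)) := by
  rw [wdot, bprod, List.map_map]
  congr 1
  refine List.map_congr_left fun i _ => ?_
  simp [bb, xx_zero]

theorem mul_wdot (hA : IsCartan A) (j : List (Fin r)) {t : GL (Fin d) ℂ} (ht : t ∈ R.UU) :
    ∃ l : List (Fin r × ℂ), l.map Prod.fst = j ∧ ∃ t₁ ∈ R.UU, t * R.wdot j = R.bprod l * t₁ := by
  obtain ⟨l, hl, h⟩ := R.mul_bprod hA (j.map fun i => (i, 0)) ht
  refine ⟨l, by simpa [Function.comp_def] using hl, ?_⟩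
  rwa [wdot_eq_bprod]

theorem wdot_conj_xx (hA : IsCartan A) {i : Fin r} {j : List (Fin r)} (h : IsReduced A (i :: j))
    (t : ℂ) : (R.wdot j)⁻¹ * R.xx i t * R.wdot j ∈ R.UU := by
  have hpos := R.alpha_pos_of_isReduced hA h
  rcases (R.isLift_wdot j).pos_or_neg hA i with ⟨-, h1⟩ | ⟨h1, -⟩
  · exact h1 t
  · omega

theorem wdot_conj_yy (hA : IsCartan A) {i : Fin r} {j : List (Fin r)} (h : IsReduced A (i :: j))
    (t : ℂ) : (R.wdot j)⁻¹ * R.yy i t * R.wdot j ∈ R.op.UU := by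
  have hpos := R.alpha_pos_of_isReduced hA h
  rcases (IsLift.op R hA (R.isLift_wdot j)).pos_or_neg hA i with ⟨-, h1⟩ | ⟨h1, -⟩
  · exact h1 t
  · omega

/-- Passing through its own ṡ_i turns x_i(z) into an element y_i, which the rest of a reduced word
conjugates into U_-. Together with `bprod_eq_mul_wdot_mul` this places the product in ẇU_- and in
U_+ẇU_+. -/
theorem bprod_eq_wdot_mul (hA : IsCartan A) {l : List (Fin r × ℂ)} {j : List (Fin r)}
    (hl : l.map Prod.fst = j) (hj : IsReduced A j) : ∃ n ∈ R.op.UU, R.bprod l = R.wdot j * n := by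
  induction l generalizing j with
  | nil => subst hl; exact ⟨1, Subgroup.one_mem _, by simp [bprod_nil, wdot]⟩
  | cons p l ih =>
    subst hl
    obtain ⟨n, hn, h⟩ := ih rfl hj.of_cons
    refine ⟨_, Subgroup.mul_mem _ (R.wdot_conj_yy hA hj (-p.2)) hn, ?_⟩
    have h1 := R.ss_conj_yy p.1 (hA.diag _) (-p.2)
    rw [_root_.neg_neg] at h1
    rw [bprod_cons, h, bb, ← h1, List.map_cons, wdot_cons]
    group

theorem bprod_eq_mul_wdot_mul (hA : IsCartan A) {l : List (Fin r × ℂ)} {j : List (Fin r)}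
    (hl : l.map Prod.fst = j) (hj : IsReduced A j) :
    ∃ u ∈ R.UU, ∃ u' ∈ R.UU, R.bprod l = u * R.wdot j * u' := by
  induction l generalizing j with
  | nil => subst hl; exact ⟨1, Subgroup.one_mem _, 1, Subgroup.one_mem _, by simp [bprod_nil, wdot]⟩
  | cons p l ih =>
    subst hl
    obtain ⟨u, hu, u', hu', h⟩ := ih rfl hj.of_cons
    obtain ⟨a, n, hn, rfl⟩ := R.exists_eq_xx_mul p.1 hu
    have h1 := R.ss_conj_NN hA p.1 (R.xx_conj_NN p.1 a hn)
    refine ⟨_, R.UU.mul_mem (R.xx_mem_UU p.1 p.2) h1, _,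
      R.UU.mul_mem (R.wdot_conj_xx hA hj a) hu', ?_⟩
    rw [bprod_cons, h, bb, List.map_cons, wdot_cons]
    group

/-- The product is u ẇ u' with u, u' in U_+; moving u through the second word gives its parameters
and leaves an element of U_+. Both products lie in ẇU_-, so that element is also in U_- and is 1. -/
theorem exists_bprod_eq (hA : IsCartan A) {j k : List (Fin r)} (hj : IsReduced A j)
    (hk : IsReduced A k) (h : R.wdot j = R.wdot k) {l : List (Fin r × ℂ)}
    (hl : l.map Prod.fst = j) :
    ∃ l' : List (Fin r × ℂ), l'.map Prod.fst = k ∧ R.bprod l = R.bprod l' := by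
  obtain ⟨u, hu, u', hu', h1⟩ := R.bprod_eq_mul_wdot_mul hA hl hj
  obtain ⟨l', hl', t, ht, h2⟩ := R.mul_wdot hA k hu
  refine ⟨l', hl', ?_⟩
  obtain ⟨n, hn, h3⟩ := R.bprod_eq_wdot_mul hA hl hj
  obtain ⟨n', hn', h4⟩ := R.bprod_eq_wdot_mul hA hl' hk
  have h5 : R.bprod l = R.bprod l' * (t * u') := by rw [h1, h, h2, mul_assoc]
  have h6 : t * u' = n'⁻¹ * n := by
    rw [h3, h4, h, mul_assoc, mul_right_inj] at h5
    rw [h5]; group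
  have h7 : t * u' = 1 := R.UU_inf_op_UU hA (R.UU.mul_mem ht hu')
    (by rw [h6]; exact Subgroup.mul_mem _ (Subgroup.inv_mem _ hn') hn)
  rw [h5, h7, mul_one]

/-! ## The Bruhat cells are disjoint -/

theorem HH_Ad_hx {h : GL (Fin d) ℂ} (hh : h ∈ R.HH) (lam : Fin r → ℤ) :
    Ad h (R.hx lam) = R.hx lam := by
  obtain ⟨v, hv⟩ := R.HH_val hh
  rw [Ad_eq_iff, hv, hx, diagonal_mul_diagonal, diagonal_mul_diagonal]
  simp only [mul_comm]

theorem sum_deg_eq {g : GL (Fin d) ℂ} {lam mu : Fin r → ℤ} (h : Ad g (R.hx lam) = R.hx mu) :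
    ∑ a, R.deg lam a = ∑ a, R.deg mu a := by
  have h1 := trace_Ad g (R.hx lam)
  rw [h, hx, hx, Matrix.trace_diagonal, Matrix.trace_diagonal] at h1
  exact_mod_cast h1.symm

/-- A monomial matrix in the big cell `U_- H U_+` is diagonal. -/
theorem eq_of_monomial (hA : IsCartan A) {v n h u : GL (Fin d) ℂ} {lam : Fin r → ℤ}
    (hv : Ad v (R.hx lam) = R.hx (rho A)) (hn : n ∈ R.op.UU) (hh : h ∈ R.HH) (hu : u ∈ R.UU)
    (e : v = n * h * u) : v = h := by
  obtain ⟨c, hc⟩ := R.HH_val hh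
  have hsupp : ∀ a b, (v : Matrix (Fin d) (Fin d) ℂ) a b ≠ 0 → R.deg (rho A) a = R.deg lam b := by
    intro a b hab
    have h2 := congrFun (congrFun (Ad_eq_iff.mp hv) a) b
    rw [hx, hx, diagonal_mul, mul_diagonal, mul_comm] at h2
    exact_mod_cast (mul_right_cancel₀ hab h2).symm
  have hcell : n⁻¹ * v = h * u := by rw [e]; group
  -- The nonzero entries of a column of v lie in rows of one degree. There n⁻¹ acts as the identity,
  -- so the entry of h u is that of v.
  have hentry : ∀ a b, (v : Matrix (Fin d) (Fin d) ℂ) a b ≠ 0 →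
      (v : Matrix (Fin d) (Fin d) ℂ) a b = c a * (u : Matrix (Fin d) (Fin d) ℂ) a b := by
    intro a b hab
    have h1 := congrArg (fun g : GL (Fin d) ℂ => (g : Matrix (Fin d) (Fin d) ℂ) a b) hcell
    simp only [Units.val_mul] at h1
    rw [hc, diagonal_mul, Matrix.mul_apply, Finset.sum_eq_single a] at h1
    · rwa [R.op_UU_apply hA (Subgroup.inv_mem _ hn) le_rfl, Matrix.one_apply_eq, one_mul] at h1
    · intro k _ hk
      by_cases h0 : (v : Matrix (Fin d) (Fin d) ℂ) k b = 0
      · rw [h0, mul_zero]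
      · rw [R.op_UU_apply hA (Subgroup.inv_mem _ hn) (by rw [hsupp a b hab, hsupp k b h0]),
          Matrix.one_apply_ne hk.symm, zero_mul]
    · simp
  have hcol : ∀ b, ∃ a, (v : Matrix (Fin d) (Fin d) ℂ) a b ≠ 0 := by
    intro b
    by_contra! h0
    have : ((v⁻¹ * v : GL (Fin d) ℂ) : Matrix (Fin d) (Fin d) ℂ) b b = 0 := by
      rw [Units.val_mul, Matrix.mul_apply]
      exact Finset.sum_eq_zero fun a _ => by rw [h0, mul_zero]
    rw [inv_mul_cancel] at this
    simp at this
  have hle : ∀ b, R.deg (rho A) b ≤ R.deg lam b := by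
    intro b
    obtain ⟨a, ha⟩ := hcol b
    by_contra! hlt
    rw [← hsupp a b ha] at hlt
    have := hentry a b ha
    rw [(R.UU_le_unipotent hA hu a b hlt.le).1, Matrix.one_apply_ne (by rintro rfl; omega),
      mul_zero] at this
    exact ha this
  -- Conjugate matrices have equal traces, so the two degree functions have the same sum and the
  -- inequality is an equality everywhere.
  have heq : ∀ b, R.deg (rho A) b = R.deg lam b := fun b =>
    (Finset.sum_eq_sum_iff_of_le fun b _ => hle b).mp (R.sum_deg_eq hv).symm b (Finset.mem_univ b)
  have hdiag : ∀ a b, (v : Matrix (Fin d) (Fin d) ℂ) a b ≠ 0 → a = b := by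
    intro a b hab
    by_contra hne
    have := hentry a b hab
    rw [(R.UU_le_unipotent hA hu a b (by rw [heq b, hsupp a b hab])).1, Matrix.one_apply_ne hne,
      mul_zero] at this
    exact hab this
  ext a b
  rw [hc]
  by_cases hab : a = b
  · subst hab
    obtain ⟨k, hk⟩ := hcol a
    have := hdiag k a hk
    subst this
    rw [hentry k k hk, (R.UU_le_unipotent hA hu k k le_rfl).1, Matrix.one_apply_eq, mul_one,
      diagonal_apply_eq]
  · rw [diagonal_apply_ne _ hab]
    by_contra h0
    exact hab (hdiag a b h0)

/-- Moving u through ẇ_j shows that ẇ_j⁻¹ẇ_k h' lies in U_- H U_+. Being monomial, it equals its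
torus part h. Besides disjointness of the cells this determines the torus factor, hence the
uniqueness of h^+. -/
theorem bruhat_disjoint (hA : IsCartan A) {j k : List (Fin r)} (hj : IsReduced A j)
    {h h' u u' : GL (Fin d) ℂ} (hh : h ∈ R.HH) (hh' : h' ∈ R.HH) (hu : u ∈ R.UU) (hu' : u' ∈ R.UU)
    (e : R.wdot k * h' = u * (R.wdot j * h) * u') :
    R.wdot k * h' = R.wdot j * h ∧ weyl A k = weyl A j := by
  obtain ⟨l, hl, t, ht, h1⟩ := R.mul_wdot hA j hu
  obtain ⟨n, hn, h2⟩ := R.bprod_eq_wdot_mul hA hl hj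
  have ht' : h⁻¹ * t * h ∈ R.UU := by
    have := R.HH_conj_UU (R.HH.inv_mem hh) ht
    rwa [inv_inv] at this
  set v := (R.wdot j)⁻¹ * (R.wdot k * h') with hvdef
  have hv : v = n * h * ((h⁻¹ * t * h) * u') := by
    rw [hvdef, e, ← mul_assoc u, h1, h2]; group
  obtain ⟨lam, hlam⟩ : ∃ lam, weyl A k lam = weyl A j (rho A) :=
    ⟨weyl A k.reverse (weyl A j (rho A)), DFunLike.congr_fun (weyl_mul_weyl_reverse hA k) _⟩
  have hAd : Ad v (R.hx lam) = R.hx (rho A) := by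
    rw [hvdef, Ad_mul, Ad_mul, R.HH_Ad_hx hh', (R.isLift_wdot k).Ad_hx hA, hlam,
      ← (R.isLift_wdot j).Ad_hx hA]
    exact Ad_inv_Ad _ _
  have hvh := R.eq_of_monomial hA hAd hn hh (R.UU.mul_mem ht' hu') hv
  have h3 : R.wdot k * h' = R.wdot j * h := by
    rw [← hvh, hvdef, mul_inv_cancel_left]
  refine ⟨h3, LinearMap.ext fun mu => R.hx_injective ?_⟩
  have h4 := congrArg (fun g => Ad g (R.hx mu)) h3
  simp only [Ad_mul, R.HH_Ad_hx hh, R.HH_Ad_hx hh'] at h4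
  rwa [← (R.isLift_wdot j).Ad_hx hA, ← (R.isLift_wdot k).Ad_hx hA]

/-! ## Moving the torus through braid matrices -/

theorem tor_mul_bb (hA : IsCartan A) (lam : Fin r → ℤ) (t : ℂˣ) (i : Fin r) (z : ℂ) :
    R.tor lam t * R.bb i z =
      R.bb i ((t ^ alpha A i lam : ℂˣ) * z) * R.tor (simpleRefl A i lam) t := by
  rw [bb, bb, ← tor_conj_xx, ← R.ss_inv_conj_tor hA]; group

/-- The cocharacter obtained by moving `lam` through the word `j`. -/
def moved (A : Matrix (Fin r) (Fin r) ℤ) (lam : Fin r → ℤ) (j : List (Fin r)) : Fin r → ℤ :=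
  j.foldl (fun lam k => simpleRefl A k lam) lam

theorem tor_mul_bprod (hA : IsCartan A) (lam : Fin r → ℤ) (t : ℂˣ) (l : List (Fin r × ℂ)) :
    ∃ l' : List (Fin r × ℂ), l'.map Prod.fst = l.map Prod.fst ∧
      R.tor lam t * R.bprod l = R.bprod l' * R.tor (moved A lam (l.map Prod.fst)) t := by
  induction l generalizing lam with
  | nil => exact ⟨[], rfl, by simp [bprod_nil, moved]⟩
  | cons p l ih =>
    obtain ⟨l', hl', h⟩ := ih (simpleRefl A p.1 lam)
    refine ⟨(p.1, (t ^ alpha A p.1 lam : ℂˣ) * p.2) :: l', by simp [hl'], ?_⟩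
    rw [bprod_cons, bprod_cons, ← mul_assoc, R.tor_mul_bb hA, mul_assoc, h, mul_assoc]; rfl

theorem bprod_mul_tor (hA : IsCartan A) (lam : Fin r → ℤ) (t : ℂˣ) (l : List (Fin r × ℂ)) :
    ∃ l' : List (Fin r × ℂ), l'.map Prod.fst = l.map Prod.fst ∧
      R.bprod l * R.tor (moved A lam (l.map Prod.fst)) t = R.tor lam t * R.bprod l' := by
  obtain ⟨l', hl', h⟩ := R.tor_mul_bprod hA lam t⁻¹ l
  refine ⟨l', hl', ?_⟩
  rw [← tor_inv, ← tor_inv, inv_mul_eq_iff_eq_mul] at h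
  rw [h]; group

end ChevalleyRep
end Weave

namespace Weave

/-! ## The tropical Lusztig rules preserve the weight -/

section Tropical

variable {r : ℕ} {A : Matrix (Fin r) (Fin r) ℤ}

/-- The cocharacter `∑ a_p χ^j_p`. -/
def inversionSum (A : Matrix (Fin r) (Fin r) ℤ) (j : List (Fin r)) (a : List ℤ) : Fin r → ℤ :=
  (List.zipWith (fun lam n => n • lam) (inversions A j) a).sum

theorem simpleRefl_comb (hA : IsCartan A) (i j : Fin r) (p q : ℤ) :
    simpleRefl A i (p • Pi.single i 1 + q • Pi.single j 1) =
      (-p - q * A j i) • Pi.single i 1 + q • Pi.single j 1 := by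
  rw [simpleRefl_apply, alpha_add, alpha_smul, alpha_smul, alpha_single, alpha_single, hA.diag]
  module

theorem simpleRefl_comb' (hA : IsCartan A) (i j : Fin r) (p q : ℤ) :
    simpleRefl A j (p • Pi.single i 1 + q • Pi.single j 1) =
      p • Pi.single i 1 + (-q - p * A i j) • Pi.single j 1 := by
  rw [add_comm, simpleRefl_comb hA, add_comm]

theorem simpleRefl_single (i j : Fin r) :
    simpleRefl A i (Pi.single j 1) = (- A j i) • Pi.single i 1 + (1 : ℤ) • Pi.single j 1 := by
  rw [simpleRefl_apply, alpha_single]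
  module

theorem simpleRefl_single' (i j : Fin r) :
    simpleRefl A j (Pi.single i 1) = (1 : ℤ) • Pi.single i 1 + (- A i j) • Pi.single j 1 := by
  rw [simpleRefl_single, add_comm]

theorem length_tropLusztig (i j : Fin r) (a : List ℤ)
    (ha : a.length = 2 ∨ a.length = 3 ∨ a.length = 4 ∨ a.length = 6) :
    (tropLusztig A i j a).length = a.length := by
  have h : ∀ b : List ℤ, (b.length = 2 ∨ b.length = 3 ∨ b.length = 4 ∨ b.length = 6) →
      (tropStd b).length = b.length := by
    rintro (_ | ⟨a₁, _ | ⟨a₂, _ | ⟨a₃, _ | ⟨a₄, _ | ⟨a₅, _ | ⟨a₆, _ | ⟨a₇, b⟩⟩⟩⟩⟩⟩⟩) <;>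
      simp [tropStd]
  unfold tropLusztig
  split
  · exact h a ha
  · rw [List.length_reverse, h _ (by simpa using ha), List.length_reverse]

end Tropical

namespace ChevalleyRep

variable {r d : ℕ} {A : Matrix (Fin r) (Fin r) ℤ} (R : ChevalleyRep A d)

include R in
theorem tropLusztig_zero (hA : IsCartan A) {i j : Fin r} (hij : i ≠ j) :
    tropLusztig A i j (List.replicate (coxOrder A i j) 0) = List.replicate (coxOrder A i j) 0 := by
  rcases R.coxOrder_cases hA hij with h | h | h | h | h | h <;> obtain ⟨hm, h1, h2⟩ := h <;>
    rw [hm] <;> simp [tropLusztig, h1, h2, tropStd, List.replicate]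

-- In each rank two type the terms with minima cancel in the weighted sum, so the identity is linear
-- in the a_p with the minima as opaque constants, and no case distinction on them is needed.
set_option linter.unusedSimpArgs false in
include R in
theorem inversionSum_tropLusztig (hA : IsCartan A) {i j : Fin r} (hij : i ≠ j) {a : List ℤ}
    (ha : a.length = coxOrder A i j) :
    inversionSum A (altWord (coxOrder A i j) i j) a =
      inversionSum A (altWord (coxOrder A i j) j i) (tropLusztig A i j a) := by
  rcases R.coxOrder_cases hA hij with h | h | h | h | h | h <;> obtain ⟨hm, h1, h2⟩ := h <;>
    rw [hm] at ha ⊢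
  · match a, ha with
    | [a₁, a₂], _ =>
      simp only [inversionSum, inversions, altWord, tropLusztig, tropStd, List.foldl_cons,
        List.foldl_nil, List.zipWith_cons_cons, List.zipWith_nil_left, List.sum_cons, List.sum_nil,
        simpleRefl_single i j, simpleRefl_single' i j, simpleRefl_comb hA i j,
        simpleRefl_comb' hA i j, h1, h2, Int.reduceNeg, Int.reduceLE, if_true, if_false,
        List.reverse_cons, List.reverse_nil, List.nil_append, List.cons_append]
      module
  · match a, ha with
    | [a₁, a₂, a₃], _ =>
      simp only [inversionSum, inversions, altWord, tropLusztig, tropStd, List.foldl_cons,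
        List.foldl_nil, List.zipWith_cons_cons, List.zipWith_nil_left, List.sum_cons, List.sum_nil,
        simpleRefl_single i j, simpleRefl_single' i j, simpleRefl_comb hA i j,
        simpleRefl_comb' hA i j, h1, h2, Int.reduceNeg, Int.reduceLE, if_true, if_false,
        List.reverse_cons, List.reverse_nil, List.nil_append, List.cons_append]
      module
  · match a, ha with
    | [a₁, a₂, a₃, a₄], _ =>
      simp only [inversionSum, inversions, altWord, tropLusztig, tropStd, List.foldl_cons,
        List.foldl_nil, List.zipWith_cons_cons, List.zipWith_nil_left, List.sum_cons, List.sum_nil,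
        simpleRefl_single i j, simpleRefl_single' i j, simpleRefl_comb hA i j,
        simpleRefl_comb' hA i j, h1, h2, Int.reduceNeg, Int.reduceLE, if_true, if_false,
        List.reverse_cons, List.reverse_nil, List.nil_append, List.cons_append]
      module
  · match a, ha with
    | [a₁, a₂, a₃, a₄], _ =>
      simp only [inversionSum, inversions, altWord, tropLusztig, tropStd, List.foldl_cons,
        List.foldl_nil, List.zipWith_cons_cons, List.zipWith_nil_left, List.sum_cons, List.sum_nil,
        simpleRefl_single i j, simpleRefl_single' i j, simpleRefl_comb hA i j,
        simpleRefl_comb' hA i j, h1, h2, Int.reduceNeg, Int.reduceLE, if_true, if_false,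
        List.reverse_cons, List.reverse_nil, List.nil_append, List.cons_append]
      module
  · match a, ha with
    | [a₁, a₂, a₃, a₄, a₅, a₆], _ =>
      simp only [inversionSum, inversions, altWord, tropLusztig, tropStd, List.foldl_cons,
        List.foldl_nil, List.zipWith_cons_cons, List.zipWith_nil_left, List.sum_cons, List.sum_nil,
        simpleRefl_single i j, simpleRefl_single' i j, simpleRefl_comb hA i j,
        simpleRefl_comb' hA i j, h1, h2, Int.reduceNeg, Int.reduceLE, if_true, if_false,
        List.reverse_cons, List.reverse_nil, List.nil_append, List.cons_append]
      module
  · match a, ha with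
    | [a₁, a₂, a₃, a₄, a₅, a₆], _ =>
      simp only [inversionSum, inversions, altWord, tropLusztig, tropStd, List.foldl_cons,
        List.foldl_nil, List.zipWith_cons_cons, List.zipWith_nil_left, List.sum_cons, List.sum_nil,
        simpleRefl_single i j, simpleRefl_single' i j, simpleRefl_comb hA i j,
        simpleRefl_comb' hA i j, h1, h2, Int.reduceNeg, Int.reduceLE, if_true, if_false,
        List.reverse_cons, List.reverse_nil, List.nil_append, List.cons_append]
      module

end ChevalleyRep
end Weave

namespace Weave

namespace ChevalleyRep

variable {r d : ℕ} {A : Matrix (Fin r) (Fin r) ℤ} (R : ChevalleyRep A d)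

/-! ## Comparison of `G` and its subgroups with their matrices -/

theorem coe_braidMatrix (i : Fin r) (z : ℂ) : (R.braidMatrix i z : GL (Fin d) ℂ) = R.bb i z := rfl

theorem coe_chi (hA : IsCartan A) (i : Fin r) (t : ℂˣ) :
    (R.chi i t : GL (Fin d) ℂ) = R.tor (Pi.single i 1) t := R.xx_yy_xx i (hA.diag i) t

theorem coe_list_prod (l : List R.G) : (l.prod : GL (Fin d) ℂ) = (l.map Subtype.val).prod :=
  map_list_prod R.G.subtype l

theorem coe_cochar (hA : IsCartan A) (lam : Fin r → ℤ) (t : ℂˣ) :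
    (R.cochar lam t : GL (Fin d) ℂ) = R.tor lam t := by
  have h : ((List.finRange r).map fun i => lam i • (Pi.single i 1 : Fin r → ℤ)).sum = lam := by
    rw [← List.ofFn_eq_map, List.sum_ofFn]
    ext k
    simp [Finset.sum_apply, Pi.single_apply]
  have h1 : ∀ l : List (Fin r), ((l.map fun i => R.chi i (t ^ lam i)).prod : R.G).val =
      R.tor (l.map fun i => lam i • (Pi.single i 1 : Fin r → ℤ)).sum t := by
    intro l
    induction l with
    | nil => exact (R.tor_zero t).symm
    | cons i l ih =>
      rw [List.map_cons, List.prod_cons, List.map_cons, List.sum_cons, tor_add, ← ih, tor_smul,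
        ← R.coe_chi hA]
      rfl
  rw [cochar, List.ofFn_eq_map, h1, h]

theorem map_U : R.U.map R.G.subtype = R.UU := by
  rw [U, MonoidHom.map_closure, UU]
  congr 1
  ext g
  constructor
  · rintro ⟨_, ⟨i, t, rfl⟩, rfl⟩; exact ⟨i, t, rfl⟩
  · rintro ⟨i, t, rfl⟩; exact ⟨_, ⟨i, t, rfl⟩, rfl⟩

theorem coe_mem_UU {g : R.G} : (g : GL (Fin d) ℂ) ∈ R.UU ↔ g ∈ R.U := by
  rw [← map_U]
  constructor
  · rintro ⟨u, hu, h⟩; rwa [← Subtype.ext h]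
  · intro h; exact ⟨g, h, rfl⟩

theorem exists_coe_eq_of_mem_UU {g : GL (Fin d) ℂ} (h : g ∈ R.UU) : ∃ u ∈ R.U, (u : GL (Fin d) ℂ) = g := by
  rw [← map_U] at h
  exact h

theorem coe_mem_HH (hA : IsCartan A) {g : R.G} (h : g ∈ R.H) : (g : GL (Fin d) ℂ) ∈ R.HH := by
  have : R.H ≤ R.HH.comap R.G.subtype := by
    rw [H, Subgroup.closure_le]
    rintro _ ⟨i, t, rfl⟩
    change (R.chi i t : GL (Fin d) ℂ) ∈ R.HH
    rw [R.coe_chi hA]; exact R.tor_mem_HH _ _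
  exact this h

theorem cochar_mem_H (lam : Fin r → ℤ) (t : ℂˣ) : R.cochar lam t ∈ R.H := by
  refine Subgroup.list_prod_mem _ fun g hg => ?_
  obtain ⟨i, rfl⟩ := (List.mem_ofFn' _ _).mp hg
  exact Subgroup.subset_closure ⟨i, _, rfl⟩

theorem exists_mul_of_mem_B (hA : IsCartan A) {g : R.G} (h : g ∈ R.B) :
    ∃ a ∈ R.HH, ∃ u ∈ R.UU, (g : GL (Fin d) ℂ) = a * u := by
  have key : R.B ≤ (R.HH ⊔ R.UU).comap R.G.subtype := by
    refine sup_le ?_ ?_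
    · exact fun g hg => Subgroup.mem_sup_left (R.coe_mem_HH hA hg)
    · exact fun g hg => Subgroup.mem_sup_right (R.coe_mem_UU.mpr hg)
  have h1 : (g : GL (Fin d) ℂ) ∈ R.HH ⊔ R.UU := key h
  have h2 : R.HH ≤ Subgroup.normalizer (R.UU : Set (GL (Fin d) ℂ)) := by
    intro a ha
    rw [Subgroup.mem_normalizer_iff]
    refine fun u => ⟨fun hu => R.HH_conj_UU ha hu, fun hu => ?_⟩
    have := R.HH_conj_UU (R.HH.inv_mem ha) hu
    simpa [mul_assoc] using this
  rw [← SetLike.mem_coe, Subgroup.coe_mul_of_left_le_normalizer_right _ _ h2] at h1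
  obtain ⟨a, ha, u, hu, e⟩ := h1
  exact ⟨a, ha, u, hu, e.symm⟩

/-- The definition of `lift` picks some reduced word; by `prod_ss_eq` any other one serves. -/
theorem coe_lift (hA : IsCartan A) {j : List (Fin r)} {w : Module.End ℤ (Fin r → ℤ)}
    (h : IsReducedExpr A j w) : (R.lift w : GL (Fin d) ℂ) = R.wdot j := by
  have hex : ∃ j, IsReducedExpr A j w := ⟨j, h⟩
  have hc := Classical.choose_spec hex
  rw [lift, dif_pos hex, ← Subgroup.coe_subtype, map_list_prod, List.map_map]
  exact R.prod_ss_eq hA hc.1 h.1 (hc.2.trans h.2.symm)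

/-! ## Bruhat cells -/

/-- `g` lies in the Bruhat cell `B ẇ B` of the word `j`. -/
def InCell (j : List (Fin r)) (g : GL (Fin d) ℂ) : Prop :=
  ∃ h ∈ R.HH, ∃ u ∈ R.UU, ∃ u' ∈ R.UU, g = u * (R.wdot j * h) * u'

variable {R}

theorem InCell.weyl_eq (hA : IsCartan A) {j k : List (Fin r)} {g : GL (Fin d) ℂ}
    (hj : IsReduced A j) (h : R.InCell j g) (h' : R.InCell k g) : weyl A k = weyl A j := by
  obtain ⟨a, ha, u, hu, u', hu', rfl⟩ := h
  obtain ⟨b, hb, v, hv, v', hv', e⟩ := h'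
  refine (R.bruhat_disjoint hA hj ha hb (R.UU.mul_mem (R.UU.inv_mem hv) hu)
    (R.UU.mul_mem hu' (R.UU.inv_mem hv')) ?_).2
  have h1 : R.wdot k * b = v⁻¹ * (v * (R.wdot k * b) * v') * v'⁻¹ := by group
  rw [h1, ← e]; group

theorem InCell.mul_right_UU {j : List (Fin r)} {g u : GL (Fin d) ℂ} (h : R.InCell j g)
    (hu : u ∈ R.UU) : R.InCell j (g * u) := by
  obtain ⟨a, ha, v, hv, v', hv', rfl⟩ := h
  exact ⟨a, ha, v, hv, _, R.UU.mul_mem hv' hu, by group⟩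

theorem InCell.mul_left_UU {j : List (Fin r)} {g u : GL (Fin d) ℂ} (h : R.InCell j g)
    (hu : u ∈ R.UU) : R.InCell j (u * g) := by
  obtain ⟨a, ha, v, hv, v', hv', rfl⟩ := h
  exact ⟨a, ha, _, R.UU.mul_mem hu hv, v', hv', by group⟩

theorem inv_HH_conj_UU {h u : GL (Fin d) ℂ} (hh : h ∈ R.HH) (hu : u ∈ R.UU) :
    h⁻¹ * u * h ∈ R.UU := by
  simpa using R.HH_conj_UU (R.HH.inv_mem hh) hu

theorem InCell.mul_right_HH {j : List (Fin r)} {g h : GL (Fin d) ℂ} (hg : R.InCell j g)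
    (hh : h ∈ R.HH) : R.InCell j (g * h) := by
  obtain ⟨a, ha, v, hv, v', hv', rfl⟩ := hg
  exact ⟨_, R.HH.mul_mem ha hh, v, hv, _, inv_HH_conj_UU hh hv', by group⟩

theorem wdot_inv_conj_HH (hA : IsCartan A) (j : List (Fin r)) {h : GL (Fin d) ℂ} (hh : h ∈ R.HH) :
    (R.wdot j)⁻¹ * h * R.wdot j ∈ R.HH := by
  induction j generalizing h with
  | nil => simpa [wdot] using hh
  | cons i j ih =>
    have := ih (R.ss_inv_conj_HH hA i hh)
    rw [wdot_cons, _root_.mul_inv_rev]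
    simpa only [mul_assoc] using this

theorem InCell.mul_left_HH (hA : IsCartan A) {j : List (Fin r)} {g h : GL (Fin d) ℂ}
    (hg : R.InCell j g) (hh : h ∈ R.HH) : R.InCell j (h * g) := by
  obtain ⟨a, ha, v, hv, v', hv', rfl⟩ := hg
  exact ⟨_, R.HH.mul_mem (wdot_inv_conj_HH hA j hh) ha, _, R.HH_conj_UU hh hv, v', hv', by group⟩

variable (R)

theorem inCell_bprod (hA : IsCartan A) {l : List (Fin r × ℂ)} {j : List (Fin r)}
    (hl : l.map Prod.fst = j) (hj : IsReduced A j) : R.InCell j (R.bprod l) := by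
  obtain ⟨u, hu, u', hu', h⟩ := R.bprod_eq_mul_wdot_mul hA hl hj
  exact ⟨1, R.HH.one_mem, u, hu, u', hu', by rw [h, mul_one]⟩

/-! ## Trivalent vertices -/

/-- The SL_2 identity behind the trivalent vertex. The left side is y_i(-b)ṡ_i², and y_i(-b) is
rewritten with `xx_yy_xx` at b⁻¹, which needs b ≠ 0; ṡ_i² is the central element of this SL_2. -/
theorem ss_xx_ss (hA : IsCartan A) (i : Fin r) (b : ℂˣ) :
    R.ss i * R.xx i b * R.ss i = R.xx i (-((b⁻¹ : ℂˣ) : ℂ)) * R.ss i * R.tor (Pi.single i 1) b *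
      R.xx i (-((b⁻¹ : ℂˣ) : ℂ)) := by
  have h1 := R.xx_yy_xx i (hA.diag i) b⁻¹
  have h2 := R.ss_conj_xx i (hA.diag i) b
  have h3 := R.ss_inv_conj_tor hA i (Pi.single i 1) b⁻¹
  have h4 := R.tor_conj_xx (Pi.single i 1) (-1) i (-((b⁻¹ : ℂˣ) : ℂ))
  have hs := R.ss_mul_self hA i
  have e1 : simpleRefl A i (Pi.single i 1) = - Pi.single i 1 := by
    rw [simpleRefl_apply, alpha_single, hA.diag]; module
  have e2 : R.tor (-Pi.single i 1) b⁻¹ = R.tor (Pi.single i 1) b := by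
    rw [← neg_one_smul ℤ, tor_smul]; simp
  rw [alpha_single, hA.diag] at h4
  simp only [even_two, Even.neg_zpow, _root_.one_zpow, Units.val_one, one_mul] at h4
  rw [e1, e2] at h3
  rw [inv_inv] at h1
  rw [xx_neg] at h4 ⊢
  rw [mul_inv_eq_iff_eq_mul] at h4
  set X := R.xx i ((b⁻¹ : ℂˣ) : ℂ)
  have h5 : R.yy i (-b) = X⁻¹ * R.tor (Pi.single i 1) b⁻¹ * (R.ss i)⁻¹ * X⁻¹ := by
    rw [← h1]; group
  calc R.ss i * R.xx i b * R.ss i = R.yy i (-b) * (R.ss i * R.ss i) := by rw [← h2]; group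
    _ = X⁻¹ * R.tor (Pi.single i 1) b⁻¹ * (R.ss i)⁻¹ * (X⁻¹ * (R.ss i * R.ss i)) := by
      rw [h5]; simp only [mul_assoc]
    _ = X⁻¹ * R.tor (Pi.single i 1) b⁻¹ * (R.ss i)⁻¹ * (R.ss i * R.ss i * X⁻¹) := by rw [hs, h4]
    _ = X⁻¹ * R.ss i * R.tor (Pi.single i 1) b * X⁻¹ := by rw [← h3]; group

theorem bb_mul_bb (hA : IsCartan A) (i : Fin r) (a : ℂ) (b u v : ℂˣ) :
    ∃ f, ∃ t ∈ R.UU, R.bb i a * R.tor (Pi.single i 1) u * (R.bb i b * R.tor (Pi.single i 1) v) =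
      R.bb i f * R.tor (Pi.single i 1) (u * b * v) * t := by
  have h1 := R.tor_conj_xx (Pi.single i 1) u i b
  have h2 := R.ss_conj_tor i (hA.diag i) (Pi.single i 1) u⁻¹
  have e1 : simpleRefl A i (Pi.single i 1) = - Pi.single i 1 := by
    rw [simpleRefl_apply, alpha_single, hA.diag]; module
  have e2 : R.tor (-Pi.single i 1) u⁻¹ = R.tor (Pi.single i 1) u := by
    rw [← neg_one_smul ℤ, tor_smul]; simp
  rw [alpha_single, hA.diag, mul_inv_eq_iff_eq_mul, ← Units.val_mul] at h1
  rw [e1, e2, mul_inv_eq_iff_eq_mul] at h2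
  -- Moving χ_i(u) past x_i(b) rescales b by u², and past ṡ_i it inverts u. The resulting torus
  -- value c u⁻¹ v is u b v.
  set c : ℂˣ := u ^ (2 : ℤ) * b with hc
  set X := R.xx i (-((c⁻¹ : ℂˣ) : ℂ)) with hX
  refine ⟨a + -((c⁻¹ : ℂˣ) : ℂ), _, inv_HH_conj_UU (R.tor_mem_HH (Pi.single i 1) (u⁻¹ * v))
    (R.xx_mem_UU i (-((c⁻¹ : ℂˣ) : ℂ))), ?_⟩
  have h3 : u * b * v = c * (u⁻¹ * v) := by
    rw [hc, zpow_two, mul_assoc, mul_assoc, mul_assoc, mul_left_comm b, mul_inv_cancel_left]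
  rw [h3, R.tor_mul _ c, bb, bb, bb, xx_add, ← hX]
  calc R.xx i a * R.ss i * R.tor (Pi.single i 1) u *
        (R.xx i b * R.ss i * R.tor (Pi.single i 1) v)
      = R.xx i a * R.ss i * (R.tor (Pi.single i 1) u * R.xx i b) * R.ss i *
        R.tor (Pi.single i 1) v := by group
    _ = R.xx i a * R.ss i * R.xx i c * (R.tor (Pi.single i 1) u * R.ss i) *
        R.tor (Pi.single i 1) v := by rw [h1]; group
    _ = R.xx i a * (R.ss i * R.xx i c * R.ss i) * R.tor (Pi.single i 1) (u⁻¹ * v) := by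
      rw [← h2, R.tor_mul]; group
    _ = _ := by rw [ss_xx_ss R hA, ← hX]; group

end ChevalleyRep
end Weave

namespace Weave

/-! ## Monomials in the cluster variables -/

/-- The monomial `∏ x_e ^ ν_e`. -/
def monomial (x : ℕ → ℂˣ) (ν : ℕ →₀ ℤ) : ℂˣ := ν.prod fun e n => x e ^ n

theorem monomial_zero (x : ℕ → ℂˣ) : monomial x 0 = 1 := Finsupp.prod_zero_index

theorem monomial_single (x : ℕ → ℂˣ) (e : ℕ) : monomial x (Finsupp.single e 1) = x e := by
  simp [monomial, Finsupp.prod_single_index]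

theorem monomial_eq_prod (x : ℕ → ℂˣ) {ν : ℕ →₀ ℤ} {S : Finset ℕ} (h : ν.support ⊆ S) :
    monomial x ν = ∏ e ∈ S, x e ^ ν e :=
  Finsupp.prod_of_support_subset _ h _ fun _ _ => zpow_zero _

theorem monomial_congr {x x' : ℕ → ℂˣ} {ν : ℕ →₀ ℤ} {n : ℕ} (hν : ∀ e, n ≤ e → ν e = 0)
    (h : ∀ e < n, x e = x' e) : monomial x ν = monomial x' ν := by
  refine Finset.prod_congr rfl fun e he => ?_
  rcases lt_or_ge e n with hlt | hge
  · simp only [h e hlt]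
  · exact absurd (hν e hge) (Finsupp.mem_support_iff.mp he)

/-- The tropical rules prescribe the exponents separately for each cluster variable; this assembles
them into one finitely supported exponent vector per edge. -/
theorem exists_finsupp_list {m : ℕ} (F : ℕ → List ℤ) (hm : ∀ e, (F e).length = m) (S : Finset ℕ)
    (hS : ∀ e ∉ S, F e = List.replicate m 0) :
    ∃ νs : List (ℕ →₀ ℤ), νs.length = m ∧ ∀ e, νs.map (· e) = F e := by
  refine ⟨List.ofFn fun k : Fin m => Finsupp.onFinset S (fun e => (F e)[k]'(by rw [hm]; exact k.2))
    (fun e he => ?_), by simp, fun e => ?_⟩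
  · by_contra h
    simp [hS e h] at he
  · rw [List.map_ofFn]
    refine List.ext_getElem (by simp [hm]) fun k h1 h2 => by simp

theorem exists_support_subset (νs : List (ℕ →₀ ℤ)) : ∃ S : Finset ℕ, ∀ ν ∈ νs, ν.support ⊆ S := by
  induction νs with
  | nil => exact ⟨∅, by simp⟩
  | cons ν νs ih =>
    obtain ⟨S, hS⟩ := ih
    refine ⟨ν.support ∪ S, fun ν' h => ?_⟩
    rcases List.mem_cons.mp h with rfl | h
    · exact Finset.subset_union_left
    · exact (hS _ h).trans Finset.subset_union_right

namespace ChevalleyRep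

variable {r d : ℕ} {A : Matrix (Fin r) (Fin r) ℤ} (R : ChevalleyRep A d)

/-! ## Products of coroots -/

/-- The torus element `∏ lam_p(u_p)`. -/
def torProd (lams : List (Fin r → ℤ)) (us : List ℂˣ) : GL (Fin d) ℂ := (List.zipWith R.tor lams us).prod

theorem torProd_cons (lam : Fin r → ℤ) (lams : List (Fin r → ℤ)) (u : ℂˣ) (us : List ℂˣ) :
    R.torProd (lam :: lams) (u :: us) = R.tor lam u * R.torProd lams us := by
  simp [torProd]

theorem torProd_mem_HH (lams : List (Fin r → ℤ)) (us : List ℂˣ) : R.torProd lams us ∈ R.HH := by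
  refine Subgroup.list_prod_mem _ fun g hg => ?_
  obtain ⟨k, hk, rfl⟩ := List.getElem_of_mem hg
  rw [List.getElem_zipWith]
  exact R.tor_mem_HH _ _

theorem torProd_monomial_val (x : ℕ → ℂˣ) (S : Finset ℕ) (lams : List (Fin r → ℤ))
    (νs : List (ℕ →₀ ℤ)) (hS : ∀ ν ∈ νs, ν.support ⊆ S) :
    (R.torProd lams (νs.map (monomial x)) : Matrix (Fin d) (Fin d) ℂ) = diagonal fun a =>
      ((∏ e ∈ S, x e ^ R.deg (List.zipWith (fun lam (n : ℤ) => n • lam) lams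
        (νs.map (· e))).sum a : ℂˣ) : ℂ) := by
  induction lams generalizing νs with
  | nil => simp [torProd, deg]
  | cons lam lams ih =>
    cases νs with
    | nil => simp [torProd, deg]
    | cons ν νs =>
      rw [List.map_cons, torProd_cons, Units.val_mul, ih νs fun ν' h => hS ν' (by simp [h]),
        tor_val, diagonal_mul_diagonal]
      congr 1
      funext a
      rw [monomial_eq_prod x (hS ν (by simp)), ← Units.val_mul, ← Finset.prod_zpow,
        ← Finset.prod_mul_distrib]
      congr 1
      refine Finset.prod_congr rfl fun e _ => ?_
      rw [List.map_cons, List.zipWith_cons_cons, List.sum_cons, deg_add, deg_smul, _root_.zpow_add,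
        _root_.zpow_mul]

/-- Collecting the powers of each x_e, the torus element depends only on the cocharacters ∑_p ν_p(e)
χ^j_p, one for each e. -/
theorem torProd_monomial_eq (x : ℕ → ℂˣ) {j j' : List (Fin r)} {νs νs' : List (ℕ →₀ ℤ)}
    (h : ∀ e, inversionSum A j (νs.map (· e)) = inversionSum A j' (νs'.map (· e))) :
    R.torProd (inversions A j) (νs.map (monomial x)) =
      R.torProd (inversions A j') (νs'.map (monomial x)) := by
  obtain ⟨S, hS⟩ := exists_support_subset νs
  obtain ⟨S', hS'⟩ := exists_support_subset νs'
  ext1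
  rw [R.torProd_monomial_val x (S ∪ S') _ _ fun ν hν => (hS ν hν).trans Finset.subset_union_left,
    R.torProd_monomial_val x (S ∪ S') _ _ fun ν hν => (hS' ν hν).trans Finset.subset_union_right]
  congr 1
  funext a
  congr 1
  exact Finset.prod_congr rfl fun e _ => by rw [← inversionSum, h, inversionSum]

/-! ## Products of labels -/

theorem coe_lab (hA : IsCartan A) (x : ℕ → ℂˣ) (ed : Edge r) : (R.lab x ed : GL (Fin d) ℂ) =
    R.bb ed.color ed.f * R.tor (Pi.single ed.color 1) (monomial x ed.ν) := by
  rw [← R.coe_chi hA, ← coe_braidMatrix]; rfl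

theorem lab_zero (hA : IsCartan A) (x : ℕ → ℂˣ) (i : Fin r) (z : ℂ) :
    R.lab x ⟨i, z, 0⟩ = R.braidMatrix i z := by
  ext1
  rw [R.coe_lab hA, monomial_zero, tor_one, mul_one, coe_braidMatrix]

theorem coe_prod_lab (hA : IsCartan A) (x : ℕ → ℂˣ) (E : List (Edge r)) :
    ∃ l : List (Fin r × ℂ), l.map Prod.fst = E.map Edge.color ∧
      ((E.map (R.lab x)).prod : R.G).val = R.bprod l *
        R.torProd (inversions A (E.map Edge.color)) ((E.map Edge.ν).map (monomial x)) := by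
  induction E with
  | nil => exact ⟨[], rfl, by simp [bprod_nil, torProd]⟩
  | cons ed E ih =>
    obtain ⟨l, hl, h⟩ := ih
    obtain ⟨l', hl', h'⟩ := R.tor_mul_bprod hA (Pi.single ed.color 1) (monomial x ed.ν) l
    refine ⟨(ed.color, ed.f) :: l', by simp [hl', hl], ?_⟩
    simp only [List.map_cons, List.prod_cons, inversions]
    rw [Subgroup.coe_mul, h, R.coe_lab hA, torProd_cons, bprod_cons, mul_assoc, ← mul_assoc (R.tor _ _),
      h', hl]
    simp only [mul_assoc]; rfl

/-- The converse of `coe_prod_lab`: torus factors are pushed back to the left into their labels, so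
labels with prescribed exponents can realize a given product. -/
theorem exists_prod_lab_eq (hA : IsCartan A) (x : ℕ → ℂˣ) (l : List (Fin r × ℂ))
    (νs : List (ℕ →₀ ℤ)) (h : νs.length = l.length) :
    ∃ E : List (Edge r), E.map Edge.color = l.map Prod.fst ∧ E.map Edge.ν = νs ∧
      ((E.map (R.lab x)).prod : R.G).val = R.bprod l *
        R.torProd (inversions A (l.map Prod.fst)) (νs.map (monomial x)) := by
  -- Pulling a torus factor to the left changes the parameters of the tail, so the induction runs on
  -- the length and not on the list.
  induction hn : l.length generalizing l νs with
  | zero =>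
    obtain rfl := List.length_eq_zero_iff.mp hn
    obtain rfl := List.length_eq_zero_iff.mp h
    exact ⟨[], rfl, rfl, by simp [bprod_nil, torProd]⟩
  | succ n ih =>
    obtain _ | ⟨⟨i, f⟩, l⟩ := l
    · simp at hn
    obtain _ | ⟨ν, νs⟩ := νs
    · simp at h
    obtain ⟨l', hl', h'⟩ := R.bprod_mul_tor hA (Pi.single i 1) (monomial x ν) l
    have hlen : l'.length = l.length := by simpa using congrArg List.length hl'
    obtain ⟨E, hE, hEν, hprod⟩ := ih l' νs (by simpa [hlen] using h) (by simpa [hlen] using hn)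
    refine ⟨⟨i, f, ν⟩ :: E, by simp [hE, hl'], by simp [hEν], ?_⟩
    simp only [List.map_cons, List.prod_cons, inversions]
    rw [Subgroup.coe_mul, hprod, R.coe_lab hA, torProd_cons, bprod_cons, hl']
    have h2 : List.foldl (fun lam k => simpleRefl A k lam) (Pi.single i 1) (l.map Prod.fst) =
      moved A (Pi.single i 1) (l.map Prod.fst) := rfl
    rw [h2, ← mul_assoc, mul_assoc (R.bb i f), ← h']
    simp only [mul_assoc]

end ChevalleyRep
end Weave

namespace Weave

/-! ### Lengths and Demazure products of reduced words -/

section Reduced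

variable {r : ℕ} {A : Matrix (Fin r) (Fin r) ℤ}

theorem IsReduced.len_eq {j : List (Fin r)} (hj : IsReduced A j) : len A (weyl A j) = j.length := by
  refine le_antisymm (Nat.sInf_le ⟨j, rfl, rfl⟩) (le_csInf ⟨_, j, rfl, rfl⟩ ?_)
  rintro _ ⟨k, rfl, hk⟩
  exact hj k hk

theorem isReduced_nil : IsReduced A [] := fun _ _ => Nat.zero_le _

theorem demRight_of_isReduced {j : List (Fin r)} {i : Fin r} (h : IsReduced A (j ++ [i])) :
    demRight A (weyl A j) i = weyl A (j ++ [i]) := by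
  have h1 := h.of_append_left.len_eq
  have h2 := h.len_eq
  rw [List.length_append, List.length_singleton] at h2
  rw [weyl_append, weyl_singleton] at *
  rw [demRight, if_pos (by omega)]

theorem demRight_of_append (hA : IsCartan A) {j : List (Fin r)} {i : Fin r}
    (h : IsReduced A (j ++ [i])) : demRight A (weyl A (j ++ [i])) i = weyl A (j ++ [i]) := by
  have h1 := h.of_append_left.len_eq
  have h2 := h.len_eq
  rw [List.length_append, List.length_singleton] at h2
  rw [demRight, if_neg]
  rw [h2, weyl_append, weyl_singleton, mul_simpleRefl_cancel hA, h1]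
  omega

theorem demLeft_of_isReduced {j : List (Fin r)} {i : Fin r} (h : IsReduced A (i :: j)) :
    demLeft A i (weyl A j) = weyl A (i :: j) := by
  have h1 := h.of_cons.len_eq
  have h2 := h.len_eq
  rw [List.length_cons] at h2
  rw [weyl_cons] at *
  rw [demLeft, if_pos (by omega)]

theorem demLeft_of_cons (hA : IsCartan A) {j : List (Fin r)} {i : Fin r}
    (h : IsReduced A (i :: j)) : demLeft A i (weyl A (i :: j)) = weyl A (i :: j) := by
  have h1 := h.of_cons.len_eq
  have h2 := h.len_eq
  rw [List.length_cons] at h2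
  rw [demLeft, if_neg]
  rw [h2, weyl_cons, simpleRefl_mul_cancel hA, h1]
  omega

end Reduced

namespace ChevalleyRep

variable {r d : ℕ} {A : Matrix (Fin r) (Fin r) ℤ} (R : ChevalleyRep A d)

include R in
-- A trivalent vertex occurs when the word already ends, or begins, with the new letter. The
-- Demazure product is then unchanged, and so is the word.
theorem isReducedExpr_of_weave (hA : IsCartan A) {l : List (Letter r)} {j : List (Fin r)}
    (W : DoubleInductiveWeave A l j) : IsReducedExpr A j (demazure A l) := by
  induction W with
  | nil => exact ⟨isReduced_nil, rfl⟩
  | vertex p s i j hij W ih =>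
    have h : weyl A (p ++ altWord (coxOrder A i j) j i ++ s) =
        weyl A (p ++ altWord (coxOrder A i j) i j ++ s) := by
      simp only [weyl_append, R.weyl_braid hA hij]
    exact ⟨ih.1.congr h (by simp [length_altWord]), h.trans ih.2⟩
  | posKeep i hred W ih => exact ⟨hred, by rw [demazure, ← ih.2, demRight_of_isReduced hred]⟩
  | posTri i W ih => exact ⟨ih.1, by rw [demazure, ← ih.2, demRight_of_append hA ih.1]⟩
  | negKeep i hred W ih => exact ⟨hred, by rw [demazure, ← ih.2, demLeft_of_isReduced hred]⟩
  | negTri i W ih => exact ⟨ih.1, by rw [demazure, ← ih.2, demLeft_of_cons hA ih.1]⟩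

/-! ## The matrix `Y⁻¹ X` -/

/-- The element `Y_0⁻¹ X_0` for the double braid word `l` with coordinates `z`. -/
def braidProd : List (Letter r) → List ℂ → R.G
  | .pos i :: l, z₀ :: z => braidProd l z * R.braidMatrix i z₀
  | .neg i :: l, z₀ :: z => R.braidMatrix (star A i) z₀ * braidProd l z
  | _, _ => 1

theorem Rake.spec {R : ChevalleyRep A d} {x : ℕ → ℂˣ} {t t' : R.G} {E E' : List (Edge r)}
    (h : R.Rake x t E E' t') : t' ∈ R.U ∧ E'.map Edge.color = E.map Edge.color ∧
      E'.map Edge.ν = E.map Edge.ν ∧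
      t * (E.map (R.lab x)).prod = (E'.map (R.lab x)).prod * t' := by
  induction h with
  | nil t ht => simp [ht]
  | cons t t₁ t' ed ed' E E' ht hcolor hν h hrest ih =>
    obtain ⟨h1, h2, h3, h4⟩ := ih
    refine ⟨h1, by simp [hcolor, h2], by simp [hν, h3], ?_⟩
    rw [List.map_cons, List.prod_cons, List.map_cons, List.prod_cons, ← mul_assoc, h, mul_assoc, h4,
      mul_assoc]

/-- The invariant of the propagation. New braid matrices on the right are first met by t, while
those on the left do not interact with it, so every rule only regroups the same product. -/
theorem Labeling.spec {R : ChevalleyRep A d} (hA : IsCartan A) {x : ℕ → ℂˣ} {l : List (Letter r)}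
    {j : List (Fin r)} {W : DoubleInductiveWeave A l j} {z : List ℂ} {E : List (Edge r)} {t : R.G}
    (h : R.Labeling x W z E t) : t ∈ R.U ∧ E.map Edge.color = j ∧
      R.braidProd l z = (E.map (R.lab x)).prod * t := by
  induction h with
  | nil => simp [braidProd, R.U.one_mem]
  | vertex P M M' S hW hP hM hM' htrop hprod ih =>
    obtain ⟨h1, h2, h3⟩ := ih
    refine ⟨h1, ?_, ?_⟩
    · simp only [List.map_append, hP, hM, hM', List.append_assoc, List.append_cancel_left_eq] at h2 ⊢
      exact h2
    · rw [h3]; simp only [List.map_append, List.prod_append, hprod]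
  | posKeep z₀ ed t' hW hr ih =>
    obtain ⟨h1, h2, h3⟩ := ih
    obtain ⟨h4, h5, -, h6⟩ := hr.spec
    refine ⟨h4, by rw [List.map_append, h2, h5]; rfl, ?_⟩
    rw [List.map_singleton, List.prod_singleton, R.lab_zero hA] at h6
    rw [braidProd, h3, mul_assoc, h6, List.map_append, List.prod_append, mul_assoc]
  | posTri z₀ e₁ e₂ e₃ t₁ t₂ hW hr hcolor hν ht₂ hprod ih =>
    obtain ⟨h1, h2, h3⟩ := ih
    obtain ⟨h4, h5, -, h6⟩ := hr.spec
    rw [List.map_append] at h2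
    have h7 := List.append_inj' h2 (by simp)
    refine ⟨R.U.mul_mem ht₂ h4, by rw [List.map_append, h7.1, List.map_singleton, hcolor], ?_⟩
    rw [List.map_singleton, List.prod_singleton, R.lab_zero hA, List.map_singleton,
      List.prod_singleton] at h6
    simp only [List.map_append, List.prod_append, List.map_singleton, List.prod_singleton] at h3 ⊢
    rw [braidProd, h3, mul_assoc, h6, mul_assoc, ← mul_assoc (R.lab _ e₁), hprod]
    simp only [mul_assoc]
  | negKeep z₀ hW ih =>
    obtain ⟨h1, h2, h3⟩ := ih
    refine ⟨h1, by rw [List.map_cons, h2], ?_⟩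
    rw [braidProd, h3, List.map_cons, List.prod_cons, R.lab_zero hA, mul_assoc]
  | negTri z₀ e₂ e₃ E' t₁ t₂ hW hcolor hν hprod hr ih =>
    obtain ⟨h1, h2, h3⟩ := ih
    obtain ⟨h4, h5, -, h6⟩ := hr.spec
    rw [List.map_cons, List.cons.injEq] at h2
    refine ⟨R.U.mul_mem h4 h1, by rw [List.map_cons, hcolor, h5, h2.2], ?_⟩
    rw [R.lab_zero hA] at hprod
    rw [braidProd, h3, List.map_cons, List.prod_cons, ← mul_assoc, ← mul_assoc, hprod,
      List.map_cons, List.prod_cons, mul_assoc (R.lab _ e₃), h6]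
    simp only [mul_assoc]

/-! ## Cycles vanish above their trivalent vertex -/

/-- Lusztig's rules send zero weights to zero weights, so a cycle cannot appear above its own
vertex. The variable of a new vertex can thus be chosen without disturbing labels already
constructed (`Labeling.congr`). -/
theorem Labeling.ν_eq_zero {R : ChevalleyRep A d} (hA : IsCartan A) {x : ℕ → ℂˣ}
    {l : List (Letter r)} {j : List (Fin r)} {W : DoubleInductiveWeave A l j} {z : List ℂ}
    {E : List (Edge r)} {t : R.G} (h : R.Labeling x W z E t) :
    ∀ ν ∈ E.map Edge.ν, ∀ e, l.length ≤ e → ν e = 0 := by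
  induction h with
  | nil => simp
  | @vertex l p s i j hij W z t P M M' S hW hP hM hM' htrop hprod ih =>
    intro ν hν e he
    simp only [List.map_append, List.mem_append] at hν ih
    rcases hν with (hν | hν) | hν
    · exact ih ν (Or.inl (Or.inl hν)) e he
    · have h1 : M.map (fun ed => ed.ν e) = List.replicate (coxOrder A i j) 0 := by
        rw [List.eq_replicate_iff]
        refine ⟨by rw [← length_altWord (coxOrder A i j) i j, ← hM]; simp, ?_⟩
        intro n hn
        obtain ⟨ed, hed, rfl⟩ := List.mem_map.mp hn
        exact ih _ (Or.inl (Or.inr (List.mem_map_of_mem hed))) e he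
      have h2 := htrop e
      rw [h1, R.tropLusztig_zero hA hij] at h2
      obtain ⟨ed, hed, rfl⟩ := List.mem_map.mp hν
      exact List.eq_of_mem_replicate (h2 ▸ List.mem_map_of_mem (f := fun ed : Edge r => ed.ν e) hed)
    · exact ih ν (Or.inr hν) e he
  | posKeep z₀ ed t' hW hr ih =>
    intro ν hν e he
    rw [List.length_cons] at he
    rw [List.map_append, hr.spec.2.2.1, List.mem_append] at hν
    rcases hν with hν | hν
    · exact ih ν hν e (by omega)
    · simp only [List.map_singleton, List.mem_singleton] at hν; simp [hν]
  | posTri z₀ e₁ e₂ e₃ t₁ t₂ hW hr hcolor hν' ht₂ hprod ih =>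
    intro ν hν e he
    rw [List.length_cons] at he
    rw [List.map_append, List.mem_append] at hν
    rcases hν with hν | hν
    · exact ih ν (by simp only [List.map_append, List.mem_append]; exact Or.inl hν) e (by omega)
    · simp only [List.map_singleton, List.mem_singleton] at hν
      rw [hν, hν', Finsupp.single_apply, if_neg (by omega)]
  | negKeep z₀ hW ih =>
    intro ν hν e he
    rw [List.length_cons] at he
    rw [List.map_cons, List.mem_cons] at hν
    rcases hν with hν | hν
    · simp [hν]
    · exact ih ν hν e (by omega)
  | negTri z₀ e₂ e₃ E' t₁ t₂ hW hcolor hν' hprod hr ih =>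
    intro ν hν e he
    rw [List.length_cons] at he
    rw [List.map_cons, hr.spec.2.2.1, List.mem_cons] at hν
    rcases hν with hν | hν
    · rw [hν, hν', Finsupp.single_apply, if_neg (by omega)]
    · exact ih ν (by rw [List.map_cons]; exact List.mem_cons_of_mem _ hν) e (by omega)

theorem lab_congr {x x' : ℕ → ℂˣ} {ed : Edge r} (h : monomial x ed.ν = monomial x' ed.ν) :
    R.lab x ed = R.lab x' ed := by
  change R.braidMatrix _ _ * R.chi _ (monomial x ed.ν) = _ * R.chi _ (monomial x' ed.ν)
  rw [h]

theorem Rake.congr {R : ChevalleyRep A d} {x x' : ℕ → ℂˣ} {t t' : R.G} {E E' : List (Edge r)}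
    (h : R.Rake x t E E' t') (hx : ∀ ν ∈ E.map Edge.ν, monomial x ν = monomial x' ν) :
    R.Rake x' t E E' t' := by
  induction h with
  | nil t ht => exact .nil t ht
  | cons t t₁ t' ed ed' E E' ht hcolor hν h hrest ih =>
    rw [List.map_cons, List.forall_mem_cons] at hx
    refine .cons t t₁ t' ed ed' E E' ht hcolor hν ?_ (ih hx.2)
    have h1 : R.lab x ed' = R.lab x' ed' := R.lab_congr (by rw [hν]; exact hx.1)
    rwa [← R.lab_congr hx.1, ← h1]

theorem Labeling.lab_congr {R : ChevalleyRep A d} (hA : IsCartan A) {x x' : ℕ → ℂˣ}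
    {l : List (Letter r)} {j : List (Fin r)} {W : DoubleInductiveWeave A l j} {z : List ℂ}
    {E : List (Edge r)} {t : R.G} (h : R.Labeling x W z E t) (hx : ∀ e < l.length, x e = x' e)
    {ed : Edge r} (hed : ed ∈ E) : R.lab x ed = R.lab x' ed :=
  R.lab_congr (monomial_congr (h.ν_eq_zero hA _ (List.mem_map_of_mem hed)) hx)

theorem Labeling.congr {R : ChevalleyRep A d} (hA : IsCartan A) {x x' : ℕ → ℂˣ}
    {l : List (Letter r)} {j : List (Fin r)} {W : DoubleInductiveWeave A l j} {z : List ℂ}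
    {E : List (Edge r)} {t : R.G} (h : R.Labeling x W z E t) (hx : ∀ e < l.length, x e = x' e) :
    R.Labeling x' W z E t := by
  have hlab : ∀ ed ∈ E, R.lab x ed = R.lab x' ed := fun ed hed => h.lab_congr hA hx hed
  have hzero : ∀ (i : Fin r) (z : ℂ), R.lab x ⟨i, z, 0⟩ = R.lab x' ⟨i, z, 0⟩ := fun i z =>
    (R.lab_zero hA x i z).trans (R.lab_zero hA x' i z).symm
  induction h with
  | nil => exact .nil
  | vertex P M M' S hW hP hM hM' htrop hprod ih =>
    have h1 : ∀ ed ∈ P ++ M ++ S, R.lab x ed = R.lab x' ed := fun ed hed => hW.lab_congr hA hx hed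
    refine .vertex P M M' S (ih hx h1) hP hM hM' htrop ?_
    have h2 : M.map (R.lab x) = M.map (R.lab x') :=
      List.map_congr_left fun ed hed => h1 ed (by simp [hed])
    have h3 : M'.map (R.lab x) = M'.map (R.lab x') :=
      List.map_congr_left fun ed hed => hlab ed (by simp [hed])
    rw [← h2, ← h3, hprod]
  | posKeep z₀ ed t' hW hr ih =>
    have hx' := fun e he => hx e (Nat.lt_succ_of_lt he)
    exact .posKeep z₀ ed t' (ih hx' fun ed hed => hW.lab_congr hA hx' hed)
      (hr.congr (by simp [monomial_zero]))
  | posTri z₀ e₁ e₂ e₃ t₁ t₂ hW hr hcolor hν ht₂ hprod ih =>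
    have hx' := fun e he => hx e (Nat.lt_succ_of_lt he)
    have h1 : R.lab x e₁ = R.lab x' e₁ := hW.lab_congr hA hx' (by simp)
    have h2 : R.lab x e₂ = R.lab x' e₂ := by
      have := hr.spec.2.2.1
      simp only [List.map_singleton, List.cons.injEq, and_true] at this
      exact R.lab_congr (by rw [this, monomial_zero, monomial_zero])
    have h3 : R.lab x e₃ = R.lab x' e₃ := hlab e₃ (by simp)
    exact .posTri z₀ e₁ e₂ e₃ t₁ t₂ (ih hx' fun ed hed => hW.lab_congr hA hx' hed)
      (hr.congr (by simp [monomial_zero])) hcolor hν ht₂ (by rw [← h1, ← h2, ← h3, hprod])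
  | negKeep z₀ hW ih =>
    have hx' := fun e he => hx e (Nat.lt_succ_of_lt he)
    exact .negKeep z₀ (ih hx' fun ed hed => hW.lab_congr hA hx' hed)
  | negTri z₀ e₂ e₃ E' t₁ t₂ hW hcolor hν hprod hr ih =>
    have hx' := fun e he => hx e (Nat.lt_succ_of_lt he)
    have h2 : R.lab x e₂ = R.lab x' e₂ := hW.lab_congr hA hx' (by simp)
    have h3 : R.lab x e₃ = R.lab x' e₃ := hlab e₃ (by simp)
    refine .negTri z₀ e₂ e₃ E' t₁ t₂ (ih hx' fun ed hed => hW.lab_congr hA hx' hed) hcolor hν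
      (by rw [← hzero, ← h2, ← h3, hprod]) (hr.congr fun ν hν => ?_)
    exact monomial_congr (hW.ν_eq_zero hA _ (by
      rw [List.map_cons]; exact List.mem_cons_of_mem _ hν)) hx'

end ChevalleyRep
end Weave

namespace Weave

namespace ChevalleyRep

variable {r d : ℕ} {A : Matrix (Fin r) (Fin r) ℤ} (R : ChevalleyRep A d)

/-! ## Existence of labelings -/

theorem exists_mul_lab (hA : IsCartan A) (x : ℕ → ℂˣ) {t : R.G} (ht : t ∈ R.U) (ed : Edge r) :
    ∃ f, ∃ t₁ ∈ R.U, t * R.lab x ed = R.lab x ⟨ed.color, f, ed.ν⟩ * t₁ := by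
  obtain ⟨f, t₁, ht₁, h⟩ := R.mul_bb hA ed.color ed.f (R.coe_mem_UU.mpr ht)
  obtain ⟨u, hu, e⟩ := R.exists_coe_eq_of_mem_UU
    (inv_HH_conj_UU (R.tor_mem_HH (Pi.single ed.color 1) (monomial x ed.ν)) ht₁)
  refine ⟨f, u, hu, Subtype.ext ?_⟩
  rw [Subgroup.coe_mul, Subgroup.coe_mul, R.coe_lab hA, R.coe_lab hA, e, ← mul_assoc, h]
  group

theorem exists_rake (hA : IsCartan A) (x : ℕ → ℂˣ) {t : R.G} (ht : t ∈ R.U) (E : List (Edge r)) :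
    ∃ E' t', R.Rake x t E E' t' := by
  induction E generalizing t with
  | nil => exact ⟨[], t, .nil t ht⟩
  | cons ed E ih =>
    obtain ⟨f, t₁, ht₁, h⟩ := R.exists_mul_lab hA x ht ed
    obtain ⟨E', t', h'⟩ := ih ht₁
    exact ⟨_, t', .cons t t₁ t' ed ⟨ed.color, f, ed.ν⟩ E E' ht rfl rfl h h'⟩

theorem exists_rake_singleton (hA : IsCartan A) (x : ℕ → ℂˣ) {t : R.G} (ht : t ∈ R.U) (i : Fin r)
    (z : ℂ) : ∃ f, ∃ t₁ ∈ R.U, R.Rake x t [⟨i, z, 0⟩] [⟨i, f, 0⟩] t₁ := by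
  obtain ⟨f, t₁, ht₁, h⟩ := R.exists_mul_lab hA x ht ⟨i, z, 0⟩
  exact ⟨f, t₁, ht₁, .cons t t₁ t₁ _ _ [] [] ht rfl rfl h (.nil t₁ ht₁)⟩

/-- The relation at a trivalent vertex. -/
theorem exists_lab_mul_lab (hA : IsCartan A) (x : ℕ → ℂˣ) (e₁ e₂ : Edge r)
    (hc : e₂.color = e₁.color) (hf : e₂.f ≠ 0) (n : ℕ) (h₁ : ∀ e, n ≤ e → e₁.ν e = 0)
    (h₂ : ∀ e, n ≤ e → e₂.ν e = 0) :
    ∃ x' : ℕ → ℂˣ, (∀ e < n, x e = x' e) ∧ ∃ f, ∃ t ∈ R.U,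
      R.lab x' e₁ * R.lab x' e₂ = R.lab x' ⟨e₁.color, f, Finsupp.single n 1⟩ * t := by
  obtain ⟨f, t, ht, h⟩ := R.bb_mul_bb hA e₁.color e₁.f (Units.mk0 e₂.f hf) (monomial x e₁.ν)
    (monomial x e₂.ν)
  obtain ⟨u, hu, rfl⟩ := R.exists_coe_eq_of_mem_UU ht
  -- The new cluster variable is forced to be u b v by the relation of `bb_mul_bb`; it is a unit as
  -- b ≠ 0.
  have hx : ∀ e < n, x e = Function.update x n
      (monomial x e₁.ν * Units.mk0 e₂.f hf * monomial x e₂.ν) e := fun e he => by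
    rw [Function.update_of_ne he.ne]
  refine ⟨_, hx, f, u, hu, Subtype.ext ?_⟩
  rw [Subgroup.coe_mul, Subgroup.coe_mul, R.coe_lab hA, R.coe_lab hA, R.coe_lab hA, monomial_single,
    Function.update_self, ← monomial_congr h₁ hx, ← monomial_congr h₂ hx, hc]
  exact h

theorem inCell_prod_lab (hA : IsCartan A) (x : ℕ → ℂˣ) (E : List (Edge r))
    (h : IsReduced A (E.map Edge.color)) :
    R.InCell (E.map Edge.color) ((E.map (R.lab x)).prod : R.G).val := by
  obtain ⟨l, hl, e⟩ := R.coe_prod_lab hA x E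
  rw [e]
  exact (R.inCell_bprod hA hl h).mul_right_HH (R.torProd_mem_HH _ _)

/-- The relation at a `2m`-valent vertex. -/
theorem exists_vertex (hA : IsCartan A) {i j : Fin r} (hij : i ≠ j) (x : ℕ → ℂˣ)
    {M : List (Edge r)} (hM : M.map Edge.color = altWord (coxOrder A i j) i j)
    (hred : IsReduced A (altWord (coxOrder A i j) i j)) :
    ∃ M' : List (Edge r), M'.map Edge.color = altWord (coxOrder A i j) j i ∧
      (∀ e, M'.map (fun ed => ed.ν e) = tropLusztig A i j (M.map (fun ed => ed.ν e))) ∧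
      (M.map (R.lab x)).prod = (M'.map (R.lab x)).prod := by
  have hlen : M.length = coxOrder A i j := by
    rw [← length_altWord (coxOrder A i j) i j, ← hM, List.length_map]
  have hm : coxOrder A i j = 2 ∨ coxOrder A i j = 3 ∨ coxOrder A i j = 4 ∨ coxOrder A i j = 6 := by
    rcases R.coxOrder_cases hA hij with h | h | h | h | h | h <;> omega
  have hred' : IsReduced A (altWord (coxOrder A i j) j i) :=
    hred.congr (R.weyl_braid hA hij).symm (by rw [length_altWord, length_altWord])
  obtain ⟨l, hl, h⟩ := R.coe_prod_lab hA x M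
  -- The unipotent parameters come from here and the exponents from the tropical rule below. The two
  -- choices are independent, since the torus part of the product sees only the exponents.
  obtain ⟨l', hl', h'⟩ := R.exists_bprod_eq hA hred hred' (R.ss_braid hA hij) (hl.trans hM)
  obtain ⟨S, hS⟩ := exists_support_subset (M.map Edge.ν)
  obtain ⟨νs, hνs, htrop⟩ := exists_finsupp_list
    (fun e => tropLusztig A i j (M.map (fun ed => ed.ν e)))
    (fun e => (length_tropLusztig i j _ (by simpa [hlen] using hm)).trans
      (by rw [List.length_map, hlen])) S (fun e he => by
      rw [← R.tropLusztig_zero hA hij]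
      congr 1
      rw [List.eq_replicate_iff]
      refine ⟨by rw [List.length_map, hlen], fun n hn => ?_⟩
      obtain ⟨ed, hed, rfl⟩ := List.mem_map.mp hn
      by_contra hne
      exact he (hS _ (List.mem_map_of_mem hed) (Finsupp.mem_support_iff.mpr hne)))
  obtain ⟨M', hM', hν', hprod⟩ := R.exists_prod_lab_eq hA x l' νs (by
    rw [hνs, ← length_altWord (coxOrder A i j) j i, ← hl', List.length_map])
  rw [hl'] at hM' hprod
  refine ⟨M', hM', fun e => ?_, Subtype.ext ?_⟩
  · rw [← htrop, ← hν', List.map_map]; rfl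
  · rw [h, hprod, h', hM]
    congr 1
    refine R.torProd_monomial_eq x fun e => ?_
    rw [htrop, R.inversionSum_tropLusztig hA hij (by rw [List.length_map, List.length_map, hlen]),
      List.map_map]
    rfl

/-- All partial products of the word lie in the Bruhat cells prescribed by the Deodhar torus. -/
def InCells (l : List (Letter r)) (z : List ℂ) : Prop :=
  ∀ n j, IsReducedExpr A j (demazure A (l.drop n)) →
    R.InCell j (R.braidProd (l.drop n) (z.drop n)).val

theorem InCells.tail {R : ChevalleyRep A d} {a : Letter r} {l : List (Letter r)} {z₀ : ℂ}
    {z : List ℂ} (h : R.InCells (a :: l) (z₀ :: z)) : R.InCells l z := fun n j hj => h (n + 1) j hj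

theorem not_isReducedExpr_of_inCell {R : ChevalleyRep A d} (hA : IsCartan A) {j k : List (Fin r)}
    {g : GL (Fin d) ℂ} (hk : IsReduced A k) (h : R.InCell k g) (h' : R.InCell j g)
    (hlt : j.length < k.length) : False := by
  have := hk j (h.weyl_eq hA hk h')
  omega

/-- Only trivalent vertices can fail, when the parameter f of the second of the two merging labels
vanishes; the cell condition at the same depth excludes this. -/
theorem exists_labeling (hA : IsCartan A) {l : List (Letter r)} {j : List (Fin r)}
    (W : DoubleInductiveWeave A l j) : ∀ z : List ℂ, z.length = l.length → R.InCells l z →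
    ∃ x E t, R.Labeling x W z E t := by
  induction W with
  | nil =>
    intro z hz _
    obtain rfl := List.length_eq_zero_iff.mp hz
    exact ⟨fun _ => 1, [], 1, .nil⟩
  | vertex p s i j hij W ih =>
    intro z hz hcell
    obtain ⟨x, E, t, hL⟩ := ih z hz hcell
    obtain ⟨E', S, rfl, hE', hS⟩ := List.map_eq_append_iff.mp (hL.spec hA).2.1
    obtain ⟨P, M, rfl, hP, hM⟩ := List.map_eq_append_iff.mp hE'
    obtain ⟨M', hM', htrop, hprod⟩ := R.exists_vertex hA hij x hM
      (R.isReducedExpr_of_weave hA W).1.of_append_left.of_append_right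
    exact ⟨x, _, t, .vertex P M M' S hL hP hM hM' htrop hprod⟩
  | posKeep i hred W ih =>
    rintro (_ | ⟨z₀, z⟩) hz hcell
    · simp at hz
    obtain ⟨x, E, t, hL⟩ := ih z (by simpa using hz) hcell.tail
    obtain ⟨f, t₁, ht₁, hr⟩ := R.exists_rake_singleton hA x (hL.spec hA).1 i z₀
    exact ⟨x, _, t₁, .posKeep z₀ _ t₁ hL hr⟩
  | negKeep i hred W ih =>
    rintro (_ | ⟨z₀, z⟩) hz hcell
    · simp at hz
    obtain ⟨x, E, t, hL⟩ := ih z (by simpa using hz) hcell.tail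
    exact ⟨x, _, t, .negKeep z₀ hL⟩
  | @posTri l j i W ih =>
    rintro (_ | ⟨z₀, z⟩) hz hcell
    · simp at hz
    obtain ⟨x, E', t, hL⟩ := ih z (by simpa using hz) hcell.tail
    obtain ⟨ht, hcol, hZ⟩ := hL.spec hA
    obtain ⟨E, E₁, rfl, hE, hE₁⟩ := List.map_eq_append_iff.mp hcol
    obtain ⟨e₁, rfl, hc⟩ := List.map_eq_singleton_iff.mp hE₁
    obtain ⟨f, t₁, ht₁, hr⟩ := R.exists_rake_singleton hA x ht i z₀
    have hred := R.isReducedExpr_of_weave hA (.posTri i W)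
    -- With f = 0 the merging labels reduce to x_i times a torus element, since ṡ_i·H·ṡ_i lies in H.
    -- The partial product then lies in the cell of the word j, whereas it must be in that of `j ++
    -- [i]`.
    have hf : f ≠ 0 := by
      rintro rfl
      refine not_isReducedExpr_of_inCell hA hred.1 (hcell 0 _ hred) (j := j) ?_ (by simp)
      have h1 := hr.spec.2.2.2
      rw [List.map_singleton, List.prod_singleton, R.lab_zero hA, List.map_singleton,
        List.prod_singleton, R.lab_zero hA] at h1
      have h2 : R.braidProd (.pos i :: l) (z₀ :: z) =
          (E.map (R.lab x)).prod * R.lab x e₁ * R.braidMatrix i 0 * t₁ := by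
        rw [braidProd, hZ, mul_assoc _ t, h1, List.map_append, List.prod_append, List.map_singleton,
          List.prod_singleton]
        simp only [mul_assoc]
      have h3 : (R.lab x e₁ * R.braidMatrix i 0).val = R.xx i e₁.f * ((R.ss i *
          R.tor (Pi.single i 1) (monomial x e₁.ν) * (R.ss i)⁻¹) * (R.ss i * R.ss i)) := by
        rw [Subgroup.coe_mul, R.coe_lab hA, coe_braidMatrix, hc, bb, bb, xx_zero]; group
      rw [List.drop_zero, List.drop_zero, h2, mul_assoc _ (R.lab x e₁), Subgroup.coe_mul,
        Subgroup.coe_mul, h3, ← mul_assoc, ss_mul_self R hA]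
      have h4 := R.inCell_prod_lab hA x E (by rw [hE]; exact hred.1.of_append_left)
      rw [hE] at h4
      exact ((h4.mul_right_UU (R.xx_mem_UU _ _)).mul_right_HH (R.HH.mul_mem
        (R.ss_conj_HH hA i (R.tor_mem_HH _ _)) (R.tor_mem_HH _ _))).mul_right_UU
        (R.coe_mem_UU.mpr ht₁)
    obtain ⟨x', hx', f₃, t₂, ht₂, hprod⟩ := R.exists_lab_mul_lab hA x e₁ ⟨i, f, 0⟩ hc.symm hf l.length
      (hL.ν_eq_zero hA _ (List.mem_map_of_mem (by simp))) (fun _ _ => rfl)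
    exact ⟨x', _, _, .posTri z₀ e₁ ⟨i, f, 0⟩
      ⟨e₁.color, f₃, Finsupp.single l.length 1⟩ t₁ t₂ (hL.congr hA hx')
      (hr.congr (by simp [monomial_zero])) hc rfl ht₂ hprod⟩
  | @negTri l j i W ih =>
    rintro (_ | ⟨z₀, z⟩) hz hcell
    · simp at hz
    obtain ⟨x, E', t, hL⟩ := ih z (by simpa using hz) hcell.tail
    obtain ⟨ht, hcol, hZ⟩ := hL.spec hA
    obtain ⟨e₂, E, rfl, hc, hE⟩ := List.map_eq_cons_iff.mp hcol
    have hred := R.isReducedExpr_of_weave hA (.negTri i W)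
    -- On the left side the old edge is the second factor, so its parameter is the one that must not
    -- vanish; the new strand has an arbitrary z₀.
    have hf : e₂.f ≠ 0 := by
      intro hf
      refine not_isReducedExpr_of_inCell hA hred.1 (hcell 0 _ hred) (j := j) ?_ (by simp)
      have h2 : R.braidProd (.neg i :: l) (z₀ :: z) =
          R.braidMatrix (star A i) z₀ * R.lab x e₂ * (E.map (R.lab x)).prod * t := by
        rw [braidProd, hZ, List.map_cons, List.prod_cons]
        simp only [mul_assoc]
      have h3 : (R.braidMatrix (star A i) z₀ * R.lab x e₂).val = R.xx (star A i) z₀ *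
          ((R.ss (star A i) * R.ss (star A i)) *
            R.tor (Pi.single (star A i) 1) (monomial x e₂.ν)) := by
        rw [Subgroup.coe_mul, R.coe_lab hA, coe_braidMatrix, hc, hf, bb, bb, xx_zero]; group
      rw [List.drop_zero, List.drop_zero, h2, Subgroup.coe_mul, Subgroup.coe_mul, h3,
        ss_mul_self R hA, mul_assoc (R.xx _ _)]
      have h4 := R.inCell_prod_lab hA x E (by rw [hE]; exact hred.1.of_cons)
      rw [hE] at h4
      exact ((h4.mul_left_HH hA (R.HH.mul_mem (R.tor_mem_HH _ _) (R.tor_mem_HH _ _))).mul_left_UU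
        (R.xx_mem_UU _ _)).mul_right_UU (R.coe_mem_UU.mpr ht)
    obtain ⟨x', hx', f₃, t₁, ht₁, hprod⟩ := R.exists_lab_mul_lab hA x ⟨star A i, z₀, 0⟩ e₂ hc hf
      l.length (fun _ _ => rfl) (hL.ν_eq_zero hA _ (List.mem_map_of_mem (by simp)))
    obtain ⟨E', t₂, hr⟩ := R.exists_rake hA x' ht₁ E
    exact ⟨x', _, _, .negTri z₀ e₂ _ E' t₁ t₂ (hL.congr hA hx') rfl rfl hprod hr⟩

/-! ## Coordinates -/

/-- Downward induction from the last index, where the representatives of X and Y coincide. -/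
theorem exists_braidProd_eq {R : ChevalleyRep A d} {β : List (Letter r)}
    {X Y : Fin (β.length + 1) → R.WFlag} {z : Fin β.length → ℂ} (h : R.IsCoordinates β X Y z)
    (c : Fin (β.length + 1)) : ∃ p q : R.G, (p : R.WFlag) = X c ∧ (q : R.WFlag) = Y c ∧
      q⁻¹ * p = R.braidProd (β.drop c) ((List.ofFn z).drop c) := by
  obtain ⟨p, q, hp, hq, hlast, hstep⟩ := h
  refine ⟨p c, q c, hp c, hq c, ?_⟩
  induction c using Fin.reverseInduction with
  | last => simp [hlast, braidProd]
  | cast c ih =>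
    have h1 : β.drop c.castSucc = β.get c :: β.drop c.succ := by
      simp
    have h2 : (List.ofFn z).drop c.castSucc = z c :: (List.ofFn z).drop c.succ := by
      have := List.drop_eq_getElem_cons (l := List.ofFn z) (i := c) (by simp)
      simpa using this
    have h3 := hstep c
    rw [h1, h2]
    cases hβ : β.get c with
    | pos i =>
      simp only [hβ] at h3
      rw [braidProd, ← ih, h3.1, h3.2, mul_assoc]
    | neg i =>
      simp only [hβ] at h3
      rw [braidProd, ← ih, h3.1, h3.2]; group

theorem mem_U_of_coe_eq {R : ChevalleyRep A d} {g g' : R.G} (h : (g : R.WFlag) = g') :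
    g⁻¹ * g' ∈ R.U := QuotientGroup.eq.mp h

theorem inCell_of_weakRel {R : ChevalleyRep A d} (hA : IsCartan A) {w : Module.End ℤ (Fin r → ℤ)}
    {p q : R.G} {j : List (Fin r)} (hj : IsReducedExpr A j w) (h : R.WeakRel w (q : R.WFlag) p) :
    R.InCell j (q⁻¹ * p : R.G).val := by
  obtain ⟨g, g', hg, hg', hmem⟩ := h
  obtain ⟨b, hb, b', hb', e⟩ := DoubleCoset.mem_doubleCoset.mp hmem
  obtain ⟨a, ha, u, hu, hau⟩ := R.exists_mul_of_mem_B hA hb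
  obtain ⟨a', ha', u', hu', hau'⟩ := R.exists_mul_of_mem_B hA hb'
  have h1 : R.InCell j (g⁻¹ * g' : R.G).val := by
    rw [e, Subgroup.coe_mul, Subgroup.coe_mul, hau, hau', R.coe_lift hA hj]
    have h0 : R.InCell j (R.wdot j) :=
      ⟨1, R.HH.one_mem, 1, R.UU.one_mem, 1, R.UU.one_mem, by simp⟩
    have := (((h0.mul_left_UU hu).mul_left_HH hA ha).mul_right_HH ha').mul_right_UU hu'
    simpa only [mul_assoc] using this
  have h2 : q⁻¹ * p = (g⁻¹ * q)⁻¹ * (g⁻¹ * g') * (g'⁻¹ * p) := by group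
  rw [h2, Subgroup.coe_mul, Subgroup.coe_mul]
  exact (h1.mul_left_UU (R.coe_mem_UU.mpr (R.U.inv_mem (mem_U_of_coe_eq hg)))).mul_right_UU
    (R.coe_mem_UU.mpr (mem_U_of_coe_eq hg'))

theorem inCells_of_coordinates {R : ChevalleyRep A d} (hA : IsCartan A) {β : List (Letter r)}
    {X Y : Fin (β.length + 1) → R.WFlag} (hXY : R.InDeodharTorus β X Y) {z : Fin β.length → ℂ}
    (h : R.IsCoordinates β X Y z) : R.InCells β (List.ofFn z) := by
  intro n j hj
  rcases lt_or_ge n (β.length + 1) with hn | hn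
  · obtain ⟨p, q, hp, hq, e⟩ := exists_braidProd_eq h ⟨n, hn⟩
    change q⁻¹ * p = R.braidProd (β.drop n) ((List.ofFn z).drop n) at e
    rw [← e]
    refine inCell_of_weakRel hA hj ?_
    rw [hp, hq]
    exact hXY.rel ⟨n, hn⟩
  -- Beyond the end of the word nothing is left: the Weyl group element and the product are both 1.
  · rw [List.drop_eq_nil_of_le (by omega)] at hj ⊢
    have : j = [] := List.length_eq_zero_iff.mp (Nat.le_zero.mp (hj.1 [] hj.2.symm))
    subst this
    refine ⟨1, R.HH.one_mem, 1, R.UU.one_mem, 1, R.UU.one_mem, ?_⟩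
    simp [braidProd, wdot]

theorem InCells.drop {R : ChevalleyRep A d} {l : List (Letter r)} {z : List ℂ} (h : R.InCells l z)
    (c : ℕ) : R.InCells (l.drop c) (z.drop c) := fun n j hj => by
  rw [List.drop_drop] at hj ⊢
  rw [List.drop_drop]
  exact h _ _ hj

/-! ## The Cartan element -/

/-- The labels exhibit one factorization in U_+ ẇh₀ U_+ with h₀ the product of coroots. Other
representatives of the flags change only the unipotent factors, so `bruhat_disjoint` forces any
other torus element to be h₀. -/
theorem isCartanElement_iff {R : ChevalleyRep A d} (hA : IsCartan A) {β : List (Letter r)}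
    {X Y : Fin (β.length + 1) → R.WFlag} {z : Fin β.length → ℂ} (hz : R.IsCoordinates β X Y z)
    (c : Fin (β.length + 1)) {j : List (Fin r)} {W : DoubleInductiveWeave A (β.drop c) j}
    {x : ℕ → ℂˣ} {E : List (Edge r)} {t : R.G} (hL : R.Labeling x W ((List.ofFn z).drop c) E t)
    (h : R.G) : R.IsCartanElement (demazure A (β.drop c)) (X c) (Y c) h ↔
      h = (List.zipWith R.cochar (inversions A j) (E.map fun ed => ed.u x)).prod := by
  obtain ⟨p, q, hp, hq, e⟩ := exists_braidProd_eq hz c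
  obtain ⟨ht, hcol, hZ⟩ := hL.spec hA
  have hred := R.isReducedExpr_of_weave hA W
  have hlift := R.coe_lift hA hred
  set h₀ := (List.zipWith R.cochar (inversions A j) (E.map fun ed => ed.u x)).prod with hh₀
  have hcoe : (h₀ : GL (Fin d) ℂ) =
      R.torProd (inversions A j) ((E.map Edge.ν).map (monomial x)) := by
    rw [hh₀, coe_list_prod, List.map_zipWith, List.map_map, torProd]
    congr 2
    funext lam t
    exact R.coe_cochar hA lam t
  have hmem : h₀ ∈ R.H := by
    refine Subgroup.list_prod_mem _ fun g hg => ?_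
    obtain ⟨k, hk, rfl⟩ := List.getElem_of_mem hg
    rw [List.getElem_zipWith]
    exact R.cochar_mem_H _ _
  -- The torus part stands to the right of u', so u' is conjugated past it, and the unipotent t that
  -- left the slice is absorbed on the right.
  have hcell : ∃ u ∈ R.U, ∃ u' ∈ R.U, q⁻¹ * p = u * (R.lift (demazure A (β.drop c)) * h₀) * u' := by
    obtain ⟨l, hl, h1⟩ := R.coe_prod_lab hA x E
    obtain ⟨u, hu, u', hu', h2⟩ := R.bprod_eq_mul_wdot_mul hA (hl.trans hcol) hred.1
    obtain ⟨v, hv, rfl⟩ := R.exists_coe_eq_of_mem_UU hu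
    obtain ⟨v', hv', hvv⟩ := R.exists_coe_eq_of_mem_UU (inv_HH_conj_UU (R.coe_mem_HH hA hmem) hu')
    refine ⟨v, hv, v' * t, R.U.mul_mem hv' ht, Subtype.ext ?_⟩
    rw [e, hZ]
    simp only [Subgroup.coe_mul]
    rw [hvv, hlift, h1, h2, hcol, ← hcoe]
    group
  constructor
  · rintro ⟨hh, p', q', hp', hq', hmem'⟩
    obtain ⟨v, hv, v', hv', e'⟩ := DoubleCoset.mem_doubleCoset.mp hmem'
    obtain ⟨u, hu, u', hu', e₀⟩ := hcell
    have hu₁ := mem_U_of_coe_eq (hp'.trans hp.symm)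
    have hu₂ := mem_U_of_coe_eq (hq'.trans hq.symm)
    have key : R.lift (demazure A (β.drop c)) * h = (v⁻¹ * (q'⁻¹ * q) * u) *
        (R.lift (demazure A (β.drop c)) * h₀) * (u' * (p'⁻¹ * p)⁻¹ * v'⁻¹) := by
      have h3 : R.lift (demazure A (β.drop c)) * h = v⁻¹ * (q'⁻¹ * p') * v'⁻¹ := by
        rw [e']; group
      have h4 : q'⁻¹ * p' = (q'⁻¹ * q) * (q⁻¹ * p) * (p'⁻¹ * p)⁻¹ := by group
      rw [h3, h4, e₀]
      simp only [mul_assoc]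
    have key' := congrArg Subtype.val key
    rw [Subgroup.coe_mul, Subgroup.coe_mul, Subgroup.coe_mul, Subgroup.coe_mul _ _ h₀, hlift] at key'
    have h5 := (R.bruhat_disjoint hA hred.1 (R.coe_mem_HH hA hmem) (R.coe_mem_HH hA hh)
      (R.coe_mem_UU.mpr (R.U.mul_mem (R.U.mul_mem (R.U.inv_mem hv) hu₂) hu))
      (R.coe_mem_UU.mpr (R.U.mul_mem (R.U.mul_mem hu' (R.U.inv_mem hu₁)) (R.U.inv_mem hv')))
      key').1
    exact Subtype.ext (mul_left_cancel h5)
  · rintro rfl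
    obtain ⟨u, hu, u', hu', e₀⟩ := hcell
    exact ⟨hmem, p, q, hp, hq, DoubleCoset.mem_doubleCoset.mpr ⟨u, hu, u', hu', e₀⟩⟩

end ChevalleyRep
end Weave

end

/-! ### The proposition -/

theorem mainTheorem3 {r d : ℕ} (A : Matrix (Fin r) (Fin r) ℤ) (hA : Weave.IsCartan A)
    (R : Weave.ChevalleyRep A d) (β : List (Weave.Letter r))
    (X Y : Fin (β.length + 1) → R.WFlag) (hXY : R.InDeodharTorus β X Y)
    (z : Fin β.length → ℂ) (hz : R.IsCoordinates β X Y z)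
    (c cbar : Fin (β.length + 1)) (hc : (c : ℕ) + cbar = β.length)
    (j : List (Fin r)) (W : Weave.DoubleInductiveWeave A (β.drop cbar) j) :
    Weave.IsReducedExpr A j (Weave.demazure A (β.drop cbar)) ∧
    (∃ x E t, R.Labeling x W ((List.ofFn z).drop cbar) E t) ∧
    ∀ x E t, R.Labeling x W ((List.ofFn z).drop cbar) E t →
      ∀ h : R.G, R.IsCartanElement (Weave.demazure A (β.drop cbar)) (X cbar) (Y cbar) h ↔
        h = (List.zipWith R.cochar (Weave.inversions A j)
              (E.map fun ed => ed.u x)).prod :=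
  ⟨R.isReducedExpr_of_weave hA W,
    R.exists_labeling hA W _ (by simp)
      ((Weave.ChevalleyRep.inCells_of_coordinates hA hXY hz).drop cbar),
    fun _ _ _ hL h => Weave.ChevalleyRep.isCartanElement_iff hA hz cbar hL h⟩
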